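/- Let $N\ge 1$, $0<s<1$, let $\Omega\subset\mathbb R^N$ be a bounded open set with Lipschitz continuous boundary, let $\alpha,b,c\in\mathbb R$ with $b>0$ and $\alpha-\frac{c^2}{b}>0$, and let $T>0$. Let $$C_{N,s}=\frac{s2^{2s}\Gamma(\frac{2s+N}{2})}{\pi^{N/2}\Gamma(1-s)},\qquad \mathcal F(u,w)=\frac{C_{N,s}}2\int_{\mathbb R^N}\!\int_{\mathbb R^N}\frac{(u(x)-u(y))(w(x)-w(y))}{|x-y|^{N+2s}}\,dx\,dy .$$ For measurable $E\subset\mathbb R^N$ let $\|u\|_{W^{s,2}(E)}^2=\int_E|u|^2dx+\int_E\int_E\frac{|u(x)-u(y)|^2}{|x-y|^{N+2s}}dxdy$. Let $W_0^{s,2}(\overline\Omega)$ be the space of all $u\in W^{s,2}(\mathbb R^N)$ with $u=0$ a.e. in $\mathbb R^N\setminus\Omega$, and let $W^{-s,2}(\overline\Omega)$ be its dual, which contains $L^2(\Omega)$ via $f\mapsto(w\mapsto\int_\Omega fw\,dx)$. For $u\in W^{s,2}(\mathbb R^N)$, $(-\Delta)^su$ denotes the functional $w\mapsto\mathcal F(u,w)$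 on $W_0^{s,2}(\overline\Omega)$, and $(-\Delta)^su=f\in L^2(\Omega)$ means that $\mathcal F(u,w)=\int_\Omega fw\,dx$ for all $w\in W_0^{s,2}(\overline\Omega)$. Let $\mathcal D((\mathbb R^N\setminus\Omega)\times(0,T))$ be the set of smooth functions on $\mathbb R^N\times\mathbb R$ whose support is compact and contained in $(\mathbb R^N\setminus\Omega)\times(0,T)$. Consider the system $$\begin{cases}v_{ttt}+\alpha v_{tt}+c^2(-\Delta)^sv+b(-\Delta)^sv_t=0&\text{in }\Omega\times(0,T),\\ v=g&\text{in }(\mathbb R^N\setminus\Omega)\times(0,T),\\ v(\cdot,0)=v_t(\cdot,0)=v_{tt}(\cdot,0)=0&\text{in }\Omega.\end{cases}\tag{1}$$ A weak solution of (1) is a family $v(\cdot,t)\in L^2(\mathbb R^N)$ with $v|_\Omega\in C([0,T];L^2(\Omega))\cap C^2([0,T];W^{-s,2}(\overline\Omega))$ and $v_{ttt}\in C((0,T);W^{-s,2}(\overline\Omega))$, which satisfies the initial and exterior conditions in (1), and such that for a.e. $t\in(0,T)$ the function $z=c^2v(\cdot,t)+bv_t(\cdot,t)$ (equal to $c^2g+bg_t$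 in $\mathbb R^N\setminus\Omega$) lies in $W^{s,2}(\mathbb R^N)$ and $\langle v_{ttt}+\alpha v_{tt},w\rangle+\mathcal F(z,w)=0$ for all $w\in W_0^{s,2}(\overline\Omega)$. There is a constant $C>0$, depending only on $N,s,\Omega,\alpha,b,c,T$, such that for every $g\in\mathcal D((\mathbb R^N\setminus\Omega)\times(0,T))$ the following holds. 1. The system (1) has a weak solution $v$ such that $v\in C^\infty([0,T];W^{s,2}(\mathbb R^N))$. It is a classical solution: for every $t\in[0,T]$, $(-\Delta)^sv(\cdot,t)$ and $(-\Delta)^sv_t(\cdot,t)$ are in $L^2(\Omega)$, and the equation holds in $L^2(\Omega)$. Every weak solution of (1) equals $v$ in $\mathbb R^N\times(0,T)$, and in $\Omega$ for all $t\in[0,T]$. 2. Let $(\varphi_n)_{n\in\mathbb N}$ be any orthonormal basis of $L^2(\Omega)$ with $\varphi_n\in W^{s,2}_0(\overline\Omega)$ and $(-\Delta)^s\varphi_n=\lambda_n\varphi_n$ in $\Omega$, let $\mathcal N_s\varphi_n(x)=C_{N,s}\int_\Omega\frac{\varphi_n(x)-\varphi_n(y)}{|x-y|^{N+2s}}dy$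 for $x\in\mathbb R^N\setminus\Omega$, let $\lambda_{n,1},\lambda_{n,2},\lambda_{n,3}\in\mathbb C$ be the roots, with multiplicity, of $z^3+\alpha z^2+b\lambda_nz+c^2\lambda_n$, and let $$C_n(t)=\frac{e^{\lambda_{n,1}t}}{(\lambda_{n,1}-\lambda_{n,2})(\lambda_{n,1}-\lambda_{n,3})}-\frac{e^{\lambda_{n,2}t}}{(\lambda_{n,1}-\lambda_{n,2})(\lambda_{n,2}-\lambda_{n,3})}+\frac{e^{\lambda_{n,3}t}}{(\lambda_{n,1}-\lambda_{n,3})(\lambda_{n,2}-\lambda_{n,3})},$$ where, if some of the roots coincide, the right-hand side is replaced by its continuous extension. Then for every $t\in[0,T]$, with convergence in $L^2(\Omega)$, $$v(\cdot,t)|_\Omega=\sum_{n}\left(\int_0^t\big(g(\cdot,\tau),\mathcal N_s\varphi_n\big)_{L^2(\mathbb R^N\setminus\Omega)}\frac1{\lambda_n}\Big[C_n'''(t-\tau)+\alpha C_n''(t-\tau)\Big]d\tau\right)\varphi_n .$$ 3. For all $t\in[0,T]$ and all integers $m\ge 0$, $$\|\partial_t^mv(\cdot,t)\|_{W^{s,2}(\mathbb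 R^N)}\le C\Big(\|\partial_t^{m+3}g+\alpha\,\partial_t^{m+2}g\|_{L^\infty((0,T);W^{s,2}(\mathbb R^N\setminus\Omega))}+\|\partial_t^mg(\cdot,t)\|_{W^{s,2}(\mathbb R^N\setminus\Omega)}\Big).$$ -/

import Mathlib

open Set Filter Topology MeasureTheory
open scoped ENNReal NNReal ContDiff

namespace MGT

noncomputable section

/-- The space `ℝᴺ` with its Euclidean norm. -/
abbrev RN (N : ℕ) : Type := EuclideanSpace ℝ (Fin N)

/-- `Ω` has a Lipschitz continuous boundary: near every boundary point, in suitable Cartesian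
coordinates with last axis `e`, `Ω` is the set of points above the graph of a Lipschitz function
of the component `y - ⟪e, y⟫ e` orthogonal to `e`. -/
def HasLipschitzBoundary {N : ℕ} (Ω : Set (RN N)) : Prop :=
  ∀ x ∈ frontier Ω, ∃ r > 0, ∃ e : RN N, ‖e‖ = 1 ∧ ∃ (K : ℝ≥0) (h : RN N → ℝ),
    LipschitzWith K h ∧
    ∀ y ∈ Metric.ball x r, (y ∈ Ω ↔ h (y - (inner ℝ e y : ℝ) • e) < inner ℝ e y)

/-- The test functions `g ∈ 𝒟((ℝᴺ ∖ Ω) × (0, T))`: smooth functions on space-time whose support is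
compact and contained in `(ℝᴺ ∖ Ω) × (0, T)`. -/
structure IsTestFunction {N : ℕ} (Ω : Set (RN N)) (T : ℝ) (g : RN N × ℝ → ℝ) : Prop where
  smooth : ContDiff ℝ ∞ g
  compact : HasCompactSupport g
  support : tsupport g ⊆ Ωᶜ ×ˢ Ioo 0 T

/-- The time derivative `∂ₜᵐ g (x, t)`. -/
def timeDeriv {N : ℕ} (m : ℕ) (g : RN N × ℝ → ℝ) (x : RN N) (t : ℝ) : ℝ :=
  iteratedDeriv m (fun τ => g (x, τ)) t

/-- The difference quotient `(u(x) - u(y)) / |x - y|^{N/2 + s}`, whose square is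
`|u(x) - u(y)|² / |x - y|^{N + 2s}`. -/
def diffQuot {N : ℕ} (s : ℝ) (u : RN N → ℝ) (z : RN N × RN N) : ℝ :=
  (u z.1 - u z.2) / ‖z.1 - z.2‖ ^ ((N : ℝ) / 2 + s)

/-- The norm of `W^{s,2}(E)` of a function, with values in `[0, ∞]`. -/
def sobolevENorm {N : ℕ} (s : ℝ) (E : Set (RN N)) (u : RN N → ℝ) : ℝ≥0∞ :=
  ((∫⁻ x in E, ‖u x‖ₑ ^ 2) + ∫⁻ x in E, ∫⁻ y in E, ‖diffQuot s u (x, y)‖ₑ ^ 2) ^ (1 / 2 : ℝ)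

theorem diffQuot_congr {N : ℕ} (s : ℝ) {u v : RN N → ℝ} (h : u =ᵐ[volume] v) :
    diffQuot s u =ᵐ[volume] diffQuot s v := by
  have h1 : ∀ᵐ z : RN N × RN N, u z.1 = v z.1 :=
    Measure.quasiMeasurePreserving_fst.ae h
  have h2 : ∀ᵐ z : RN N × RN N, u z.2 = v z.2 :=
    Measure.quasiMeasurePreserving_snd.ae h
  filter_upwards [h1, h2] with z a b
  simp only [diffQuot, a, b]

/-- The space `W^{s,2}(ℝᴺ)`, realized as the space of all pairs `(u, U)` in
`L²(ℝᴺ) × L²(ℝᴺ × ℝᴺ)` such that `U` is the difference quotient of `u`. The component `U` is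
determined by `u`, and the norm inherited from the Hilbert product is
`‖u‖² = ∫ |u|² + ∬ |u(x) - u(y)|² / |x - y|^{N + 2s}`. -/
def sobolev (N : ℕ) (s : ℝ) :
    Submodule ℝ (WithLp 2 (Lp ℝ 2 (volume : Measure (RN N)) ×
      Lp ℝ 2 (volume : Measure (RN N × RN N)))) where
  carrier := {p | (p.snd : RN N × RN N → ℝ) =ᵐ[volume] diffQuot s p.fst}
  zero_mem' := by
    have h := diffQuot_congr s (Lp.coeFn_zero ℝ 2 (volume : Measure (RN N)))
    have h0 := Lp.coeFn_zero ℝ 2 (volume : Measure (RN N × RN N))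
    filter_upwards [h, h0] with z a b
    simp only [WithLp.zero_fst, WithLp.zero_snd]
    rw [a, b]
    simp [diffQuot]
  add_mem' := by
    intro p q hp hq
    change _ =ᵐ[volume] _
    have h := diffQuot_congr s (Lp.coeFn_add p.fst q.fst)
    have h0 := Lp.coeFn_add p.snd q.snd
    filter_upwards [h, h0, hp, hq] with z a b c d
    simp only [WithLp.add_fst, WithLp.add_snd]
    rw [a, b, Pi.add_apply, c, d]
    simp only [diffQuot, Pi.add_apply]
    ring
  smul_mem' := by
    intro k p hp
    change _ =ᵐ[volume] _
    have h := diffQuot_congr s (Lp.coeFn_smul k p.fst)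
    have h0 := Lp.coeFn_smul k p.snd
    filter_upwards [h, h0, hp] with z a b c
    simp only [WithLp.smul_fst, WithLp.smul_snd]
    rw [a, b, Pi.smul_apply, c]
    simp only [diffQuot, Pi.smul_apply, smul_eq_mul]
    ring

/-- The continuous inclusion `W^{s,2}(ℝᴺ) → L²(ℝᴺ)`. -/
def toL2 (N : ℕ) (s : ℝ) : sobolev N s →L[ℝ] Lp ℝ 2 (volume : Measure (RN N)) :=
  (WithLp.fstL 2 ℝ _ _).comp (sobolev N s).subtypeL

/-- The restriction `L²(ℝᴺ) → L²(Ω)`. -/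
def restr {N : ℕ} (Ω : Set (RN N)) :
    Lp ℝ 2 (volume : Measure (RN N)) →L[ℝ] Lp ℝ 2 ((volume : Measure (RN N)).restrict Ω) :=
  LpToLpRestrictCLM (RN N) ℝ ℝ volume 2 Ω

/-- The space `W₀^{s,2}(Ω̄)` of all `u ∈ W^{s,2}(ℝᴺ)` with `u = 0` (a.e.) in `ℝᴺ ∖ Ω`. -/
def sobolevZero {N : ℕ} (s : ℝ) (Ω : Set (RN N)) : Submodule ℝ (sobolev N s) :=
  LinearMap.ker (((restr Ωᶜ).comp (toL2 N s)) :
    sobolev N s →ₗ[ℝ] Lp ℝ 2 ((volume : Measure (RN N)).restrict Ωᶜ))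

/-- The dual space `W^{-s,2}(Ω̄)` of `W₀^{s,2}(Ω̄)`. -/
abbrev DualSobolev {N : ℕ} (s : ℝ) (Ω : Set (RN N)) : Type :=
  StrongDual ℝ (sobolevZero s Ω)

/-- The embedding of `L²(Ω)` into `W^{-s,2}(Ω̄)`: the functional `w ↦ ∫_Ω f w`. -/
def toDual {N : ℕ} (s : ℝ) (Ω : Set (RN N))
    (f : Lp ℝ 2 ((volume : Measure (RN N)).restrict Ω)) : DualSobolev s Ω :=
  (innerSL ℝ f).comp ((restr Ω).comp ((toL2 N s).comp (sobolevZero s Ω).subtypeL))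

/-- The normalization constant `C_{N,s}` of the fractional Laplacian. -/
def fracConst (N : ℕ) (s : ℝ) : ℝ :=
  s * 2 ^ (2 * s) * Real.Gamma ((2 * s + N) / 2) / (Real.pi ^ ((N : ℝ) / 2) * Real.Gamma (1 - s))

/-- The bilinear form
`(C_{N,s} / 2) ∬ (u(x) - u(y)) (v(x) - v(y)) / |x - y|^{N + 2s} dx dy` on `W^{s,2}(ℝᴺ)`. For
`v ∈ W₀^{s,2}(Ω̄)` it is the pairing `⟨(-Δ)ˢ u, v⟩`. -/
def energy {N : ℕ} {s : ℝ} (u v : sobolev N s) : ℝ :=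
  fracConst N s / 2 * inner ℝ (WithLp.snd u.1) (WithLp.snd v.1)

/-- `(-Δ)ˢ u = f` in `Ω`, with `u ∈ W^{s,2}(ℝᴺ)` and `f ∈ L²(Ω)`. For `u ∈ W₀^{s,2}(Ω̄)` this says
that `u` is in the domain of the Dirichlet realization `(-Δ)ˢ_D`, and `(-Δ)ˢ_D u = f`. -/
def HasFracLap {N : ℕ} {s : ℝ} (Ω : Set (RN N)) (u : sobolev N s)
    (f : Lp ℝ 2 ((volume : Measure (RN N)).restrict Ω)) : Prop :=
  ∀ w : sobolevZero s Ω, energy u (w : sobolev N s) = toDual s Ω f w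

/-- `(φ n)` is an orthonormal basis of `L²(Ω)` made of eigenfunctions of `(-Δ)ˢ_D`, and `lam n` is
the eigenvalue of `φ n`. -/
structure IsEigenbasis {N : ℕ} (s : ℝ) (Ω : Set (RN N)) (φ : ℕ → sobolevZero s Ω)
    (lam : ℕ → ℝ) : Prop where
  orthonormal : Orthonormal ℝ (fun n => restr Ω (toL2 N s (φ n)))
  total : (Submodule.span ℝ (range fun n => restr Ω (toL2 N s (φ n)))).topologicalClosure = ⊤
  eigen : ∀ n, HasFracLap Ω (φ n : sobolev N s) (lam n • restr Ω (toL2 N s (φ n)))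

/-- The nonlocal normal derivative `𝒩ₛ u (x) = C_{N,s} ∫_Ω (u(x) - u(y)) / |x - y|^{N + 2s} dy`. -/
def nonlocalNormal {N : ℕ} (s : ℝ) (Ω : Set (RN N)) (u : RN N → ℝ) (x : RN N) : ℝ :=
  fracConst N s * ∫ y in Ω, (u x - u y) / ‖x - y‖ ^ ((N : ℝ) + 2 * s)

open Classical in
/-- The function `C(t)` belonging to three complex numbers `p, q, r`. For pairwise different
`p, q, r` it is
`e^{pt} / ((p - q)(p - r)) - e^{qt} / ((p - q)(q - r)) + e^{rt} / ((p - r)(q - r))`;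
if some of them coincide, it is the continuous extension of this expression. -/
def fundC (p q r : ℂ) (t : ℝ) : ℂ :=
  let dbl : ℂ → ℂ → ℂ := fun a d =>
    (Complex.exp (d * t) - Complex.exp (a * t) - (d - a) * t * Complex.exp (a * t)) / (d - a) ^ 2
  if p = q then
    if q = r then (t : ℂ) ^ 2 / 2 * Complex.exp (p * t) else dbl p r
  else if q = r then dbl q p
  else if p = r then dbl p q
  else
    Complex.exp (p * t) / ((p - q) * (p - r)) - Complex.exp (q * t) / ((p - q) * (q - r))
      + Complex.exp (r * t) / ((p - r) * (q - r))

/-- `μ 0, μ 1, μ 2` are the roots, with multiplicity, of `z³ + α z² + b λ z + c² λ`. -/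
def AreRoots (α b c lam : ℝ) (μ : Fin 3 → ℂ) : Prop :=
  ∀ z : ℂ, z ^ 3 + α * z ^ 2 + b * lam * z + c ^ 2 * lam = (z - μ 0) * (z - μ 1) * (z - μ 2)

/-- The kernel `C''' + α C''`, where `C` belongs to `μ 0, μ 1, μ 2`. It is real if these are the
roots of a real cubic polynomial. -/
def kernel (α : ℝ) (μ : Fin 3 → ℂ) (t : ℝ) : ℝ :=
  (iteratedDeriv 3 (fundC (μ 0) (μ 1) (μ 2)) t
    + α * iteratedDeriv 2 (fundC (μ 0) (μ 1) (μ 2)) t).re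

/-- The coefficient
`∫₀ᵗ (g(·,τ), 𝒩ₛ φ)_{L²(ℝᴺ ∖ Ω)} (1 / λ) (C'''(t - τ) + α C''(t - τ)) dτ`. -/
def coeff {N : ℕ} (s : ℝ) (Ω : Set (RN N)) (α : ℝ) (g : RN N × ℝ → ℝ) (φ : RN N → ℝ) (lam : ℝ)
    (μ : Fin 3 → ℂ) (t : ℝ) : ℝ :=
  ∫ τ in (0 : ℝ)..t,
    (∫ x in Ωᶜ, g (x, τ) * nonlocalNormal s Ω φ x) * (1 / lam) * kernel α μ (t - τ)

/-- Weak solutions of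
`v_ttt + α v_tt + c² (-Δ)ˢ v + b (-Δ)ˢ v_t = 0` in `Ω × (0, T)`, `v = g` in `(ℝᴺ ∖ Ω) × (0, T)`,
`v = v_t = v_tt = 0` in `Ω` at time `0`. Derivatives of `v` in time are taken in `W^{-s,2}(Ω̄)`. -/
structure IsWeakSolution {N : ℕ} (s : ℝ) (Ω : Set (RN N)) (T α b c : ℝ) (g : RN N × ℝ → ℝ)
    (v : ℝ → Lp ℝ 2 (volume : Measure (RN N))) : Prop where
  continuous : ContinuousOn (fun t => restr Ω (v t)) (Icc 0 T)
  contDiff_two : ContDiffOn ℝ 2 (fun t => toDual s Ω (restr Ω (v t))) (Icc 0 T)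
  contDiff_three : ContDiffOn ℝ 3 (fun t => toDual s Ω (restr Ω (v t))) (Ioo 0 T)
  /-- The variational identity; `z` is the function `c² v + b v_t` at time `t`. That it lies in
  `W^{s,2}(ℝᴺ)` is what gives a meaning to the pairing `⟨(-Δ)ˢ (c² v + b v_t), w⟩`. -/
  variational : ∀ᵐ t ∂(volume.restrict (Ioo 0 T)), ∃ z : sobolev N s,
    toDual s Ω (restr Ω (toL2 N s z)) = c ^ 2 • toDual s Ω (restr Ω (v t))
      + b • deriv (fun τ => toDual s Ω (restr Ω (v τ))) t ∧
    (∀ᵐ x ∂(volume.restrict Ωᶜ),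
      toL2 N s z x = c ^ 2 * g (x, t) + b * timeDeriv 1 g x t) ∧
    ∀ w : sobolevZero s Ω,
      (iteratedDeriv 3 (fun τ => toDual s Ω (restr Ω (v τ))) t
        + α • iteratedDeriv 2 (fun τ => toDual s Ω (restr Ω (v τ))) t) w
        + energy z (w : sobolev N s) = 0
  initial : ∀ k ∈ Finset.range 3,
    iteratedDerivWithin k (fun τ => toDual s Ω (restr Ω (v τ))) (Icc 0 T) 0 = 0
  exterior : ∀ t ∈ Ioo 0 T, ∀ᵐ x ∂(volume.restrict Ωᶜ), v t x = g (x, t)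

/-- Classical solutions of the same problem, of class `C^∞([0, T]; W^{s,2}(ℝᴺ))`: at all times
`(-Δ)ˢ v` and `(-Δ)ˢ v_t` are in `L²(Ω)`, and the equation holds in `L²(Ω)`. -/
structure IsSmoothClassicalSolution {N : ℕ} (s : ℝ) (Ω : Set (RN N)) (T α b c : ℝ)
    (g : RN N × ℝ → ℝ) (v : ℝ → sobolev N s) : Prop where
  smooth : ContDiffOn ℝ ∞ v (Icc 0 T)
  equation : ∀ t ∈ Icc 0 T, ∃ f₀ f₁ : Lp ℝ 2 ((volume : Measure (RN N)).restrict Ω),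
    HasFracLap Ω (v t) f₀ ∧ HasFracLap Ω (iteratedDerivWithin 1 v (Icc 0 T) t) f₁ ∧
    restr Ω (toL2 N s (iteratedDerivWithin 3 v (Icc 0 T) t))
      + α • restr Ω (toL2 N s (iteratedDerivWithin 2 v (Icc 0 T) t))
      + c ^ 2 • f₀ + b • f₁ = 0
  initial : ∀ k ∈ Finset.range 3,
    restr Ω (toL2 N s (iteratedDerivWithin k v (Icc 0 T) 0)) = 0
  exterior : ∀ t ∈ Icc 0 T, ∀ᵐ x ∂(volume.restrict Ωᶜ), toL2 N s (v t) x = g (x, t)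

end

end MGT

open MGT

/-! ### Singular kernels: integrability of the truncated kernel and a Schur-type bound -/

namespace MGT

noncomputable section

variable {N : ℕ} {s : ℝ}

/-! Let `V` be `sobolevZero s Ω`, `A` the operator on `V` representing the energy form, and `J` the
restriction `V → L²(Ω)`. By a fractional Poincaré inequality `A` is coercive (`exists_coercive`).
The rest is mostly Hilbert space theory for `J*J (w''' + α w'') + A (c² w + b w') = J* f`.

A priori bound (`energy_estimate`). Put `σ = c²/b`, `γ = α - σ`, `p = w' + σ w`, `q = p'`. Then `c²
w + b w' = b p`, and `w''' + α w''` is `q' + γ q` plus lower order terms in `p` and `w`. Pairing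
with `q` controls `⟪B q, q⟫ + b ⟪A p, p⟫ + ‖w‖²` by Gronwall, where `B` stands for `J*J`; `γ > 0`
makes `γ ⟪B q, q⟫` a harmless damping term. No lower bound on `B` enters, so one may replace `J*J`
by `J*J + ε`, solve a linear ODE with bounded operators, and let `ε → 0`
(`exists_isSolutionOperator`). Forces vanish up to time `0`, so the solution operator commutes with
`d/dt`; this gives smoothness in time and bounds for all derivatives.

Exterior data (`exists_isInhomSolutionOperator`). Let `P` be the energy projection onto `V` and `L =
1 - P`. Then `v = L g + w`, where `w` solves the problem above with the force `-(L g)''' - α (L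
g)''` restricted to `Ω`. Since `L` kills `V`, only the class of `g` modulo `V` matters, and the
extension theorem for Lipschitz domains (`exists_sobolev_extension`) bounds that class by the norm
on the complement of `Ω`. This is the form of the final estimate.

Classical solution (`exists_classical`). The equation is a first order ODE in time for the
functional `(-Δ)ˢ v`, with an `L²(Ω)` source and zero initial value; solving the ODE in `L²(Ω)`
shows that the functional is a function.

Uniqueness (`eq_zero_of_weak_solution`). The difference of two weak solutions lives in the dual of
`V`. After `A⁻¹` it becomes `V`-valued and solves the same equation, so the energy bound applies.

Series (`coeff_eq`, `duhamel_kernel`). Testing with an eigenfunction gives a scalar third order ODE,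
solved by Duhamel's formula; its source is turned into an integral against the nonlocal normal
derivative by `energy_eq_integral_nonlocalNormal`. -/

/-- The square of the `W^{s,2}(E)` norm. -/
def sobolevSq (s : ℝ) (E : Set (RN N)) (u : RN N → ℝ) : ℝ≥0∞ :=
  (∫⁻ x in E, ‖u x‖ₑ ^ 2) + ∫⁻ x in E, ∫⁻ y in E, ‖diffQuot s u (x, y)‖ₑ ^ 2

theorem sobolevENorm_sq (s : ℝ) (E : Set (RN N)) (u : RN N → ℝ) :
    sobolevENorm s E u ^ 2 = sobolevSq s E u := by
  unfold sobolevENorm sobolevSq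
  rw [← ENNReal.rpow_natCast, ← ENNReal.rpow_mul]
  norm_num

theorem enorm_sq_eq_ofReal (r : ℝ) : ‖r‖ₑ ^ 2 = ENNReal.ofReal (r ^ 2) := by
  rw [Real.enorm_eq_ofReal_abs, ← ENNReal.ofReal_pow (abs_nonneg _), sq_abs]

/-- The kernel `min (|z|², 1) / |z|^{N + 2s}`, which is integrable. -/
def tailKernel (N : ℕ) (s : ℝ) (z : RN N) : ℝ :=
  min (‖z‖ ^ 2) 1 / (‖z‖ ^ ((N : ℝ) / 2 + s)) ^ 2

theorem tailKernel_nonneg (z : RN N) : 0 ≤ tailKernel N s z := by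
  unfold tailKernel; positivity

theorem measurable_tailKernel : Measurable (tailKernel N s) := by
  unfold tailKernel; fun_prop

/-- In polar coordinates the radial density is `y^(1 - 2s)` on `(0, 1]`, integrable because `s < 1`,
and `y^(-1 - 2s)` beyond `1`, integrable because `s > 0`. -/
theorem integrable_tailKernel (hN : 1 ≤ N) (hs0 : 0 < s) (hs1 : s < 1) :
    Integrable (tailKernel N s) := by
  have : Nontrivial (RN N) := by
    have : Nonempty (Fin N) := ⟨⟨0, hN⟩⟩
    infer_instance
  have key : ∀ y : ℝ, 0 < y → y ^ (N - 1) * (1 / (y ^ ((N : ℝ) / 2 + s)) ^ 2) = y ^ (-1 - 2 * s) := by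
    intro y hy
    rw [← Real.rpow_natCast y (N - 1), ← Real.rpow_natCast (_ ^ _) 2, ← Real.rpow_mul hy.le,
      one_div, ← Real.rpow_neg hy.le, ← Real.rpow_add hy]
    congr 1
    push_cast [hN]
    ring
  have h := (integrable_fun_norm_addHaar (E := RN N) volume
    (f := fun r : ℝ => min (r ^ 2) 1 / (r ^ ((N : ℝ) / 2 + s)) ^ 2)).2
  refine h ?_
  rw [show Ioi (0 : ℝ) = Ioc 0 1 ∪ Ioi 1 from (Ioc_union_Ioi_eq_Ioi zero_le_one).symm]
  simp only [finrank_euclideanSpace, Fintype.card_fin, smul_eq_mul]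
  refine IntegrableOn.union ?_ ?_
  · have h1 : IntegrableOn (fun y : ℝ => y ^ (1 - 2 * s)) (Ioc 0 1) := by
      rw [← intervalIntegrable_iff_integrableOn_Ioc_of_le zero_le_one]
      exact intervalIntegral.intervalIntegrable_rpow' (by linarith)
    refine h1.congr_fun ?_ measurableSet_Ioc
    intro y hy
    have : min (y ^ 2) 1 = y ^ 2 := min_eq_left (by nlinarith [hy.1, hy.2])
    simp only [this]
    rw [show y ^ 2 / (y ^ ((N : ℝ) / 2 + s)) ^ 2 = y ^ 2 * (1 / (y ^ ((N : ℝ) / 2 + s)) ^ 2) by ring,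
      mul_left_comm, key y hy.1, ← Real.rpow_natCast y 2, ← Real.rpow_add hy.1]
    congr 1
    push_cast
    ring
  · refine (integrableOn_Ioi_rpow_of_lt (a := -1 - 2 * s) (by linarith) one_pos).congr_fun ?_
      measurableSet_Ioi
    intro y hy
    have hy' : (1 : ℝ) < y := hy
    have : min (y ^ 2) 1 = 1 := min_eq_right (by nlinarith)
    simp only [this]
    rw [key y (by linarith)]

/-- The integral of `tailKernel`. -/
def tailMass (N : ℕ) (s : ℝ) : ℝ≥0∞ := ∫⁻ z, ENNReal.ofReal (tailKernel N s z)

theorem tailMass_ne_top (hN : 1 ≤ N) (hs0 : 0 < s) (hs1 : s < 1) : tailMass N s ≠ ⊤ :=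
  (integrable_tailKernel hN hs0 hs1).lintegral_lt_top.ne

theorem tailKernel_sub_comm (x y : RN N) : tailKernel N s (x - y) = tailKernel N s (y - x) := by
  unfold tailKernel; rw [norm_sub_rev]

theorem lintegral_tailKernel_le (E : Set (RN N)) (x : RN N) :
    ∫⁻ y in E, ENNReal.ofReal (tailKernel N s (x - y)) ≤ tailMass N s := by
  refine (setLIntegral_le_lintegral _ _).trans ?_
  rw [tailMass, lintegral_sub_left_eq_self (fun z => ENNReal.ofReal (tailKernel N s z)) x]

theorem measurable_diffQuot {u : RN N → ℝ} (hu : Measurable u) : Measurable (diffQuot s u) := by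
  unfold diffQuot; fun_prop

/-- The inner integral of the kernel is at most `tailMass`, uniformly in `x`, by translation
invariance. The primed version exchanges the two variables. -/
theorem lintegral_mul_tailKernel_le (A B : Set (RN N)) {φ : RN N → ℝ≥0∞} (hφ : Measurable φ) :
    ∫⁻ x in A, ∫⁻ y in B, φ x * ENNReal.ofReal (tailKernel N s (x - y))
      ≤ tailMass N s * ∫⁻ x in A, φ x := by
  rw [← lintegral_const_mul _ hφ]
  refine lintegral_mono fun x => ?_
  rw [lintegral_const_mul _ (by have := measurable_tailKernel (N := N) (s := s); fun_prop), mul_comm]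
  exact mul_le_mul_left (lintegral_tailKernel_le B x) _

theorem lintegral_mul_tailKernel_le' (A B : Set (RN N)) {φ : RN N → ℝ≥0∞} (hφ : Measurable φ) :
    ∫⁻ x in A, ∫⁻ y in B, φ y * ENNReal.ofReal (tailKernel N s (x - y))
      ≤ tailMass N s * ∫⁻ x in B, φ x := by
  have hk := measurable_tailKernel (N := N) (s := s)
  rw [lintegral_lintegral_swap (by fun_prop)]
  simp_rw [tailKernel_sub_comm (s := s) _ _]
  refine le_trans (le_of_eq ?_) (lintegral_mul_tailKernel_le B A hφ)
  refine lintegral_congr fun x => lintegral_congr fun y => ?_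
  rw [tailKernel_sub_comm]

/-- A pointwise bound on the squared difference quotients by a function of both variables plus zero
order terms yields an integral bound. -/
theorem lintegral_diffQuot_le {A : Set (RN N)} (hA : MeasurableSet A) {u : RN N → ℝ}
    {φ ψ : RN N → ℝ≥0∞} {w : RN N → RN N → ℝ≥0∞} (hφ : Measurable φ) (hψ : Measurable ψ)
    (h : ∀ x ∈ A, ∀ y ∈ A, ‖diffQuot s u (x, y)‖ₑ ^ 2 ≤ w x y
      + φ x * ENNReal.ofReal (tailKernel N s (x - y))
      + ψ y * ENNReal.ofReal (tailKernel N s (x - y))) :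
    ∫⁻ x in A, ∫⁻ y in A, ‖diffQuot s u (x, y)‖ₑ ^ 2
      ≤ (∫⁻ x in A, ∫⁻ y in A, w x y) + tailMass N s * (∫⁻ x in A, φ x)
        + tailMass N s * (∫⁻ x in A, ψ x) := by
  have hk := measurable_tailKernel (N := N) (s := s)
  calc _ ≤ ∫⁻ x in A, ∫⁻ y in A, (w x y
      + φ x * ENNReal.ofReal (tailKernel N s (x - y))
      + ψ y * ENNReal.ofReal (tailKernel N s (x - y))) :=
        setLIntegral_mono' hA fun x hx => setLIntegral_mono' hA fun y hy => h x hx y hy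
    _ = (∫⁻ x in A, ∫⁻ y in A, w x y)
        + (∫⁻ x in A, ∫⁻ y in A, φ x * ENNReal.ofReal (tailKernel N s (x - y)))
        + (∫⁻ x in A, ∫⁻ y in A, ψ y * ENNReal.ofReal (tailKernel N s (x - y))) := by
      have e1 : ∀ x, ∫⁻ y in A, (w x y
          + φ x * ENNReal.ofReal (tailKernel N s (x - y))
          + ψ y * ENNReal.ofReal (tailKernel N s (x - y))) = (∫⁻ y in A, w x y)
          + (∫⁻ y in A, φ x * ENNReal.ofReal (tailKernel N s (x - y)))
          + (∫⁻ y in A, ψ y * ENNReal.ofReal (tailKernel N s (x - y))) := by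
        intro x
        rw [lintegral_add_right _ (by fun_prop), lintegral_add_right _ (by fun_prop)]
      simp_rw [e1]
      rw [lintegral_add_right, lintegral_add_right]
      · apply Measurable.lintegral_prod_right' (f := fun z : RN N × RN N =>
          φ z.1 * ENNReal.ofReal (tailKernel N s (z.1 - z.2)))
        fun_prop
      · apply Measurable.lintegral_prod_right' (f := fun z : RN N × RN N =>
          ψ z.2 * ENNReal.ofReal (tailKernel N s (z.1 - z.2)))
        fun_prop
    _ ≤ _ := by
      gcongr
      · exact lintegral_mul_tailKernel_le A A hφ
      · exact lintegral_mul_tailKernel_le' A A hψ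

end

end MGT

/-! ### Cutoff by Lipschitz functions and extension by zero -/

namespace MGT

noncomputable section

variable {N : ℕ} {s : ℝ}

theorem diffQuot_sq (u : RN N → ℝ) (x y : RN N) :
    diffQuot s u (x, y) ^ 2 = (u x - u y) ^ 2 / (‖x - y‖ ^ ((N : ℝ) / 2 + s)) ^ 2 := by
  simp only [diffQuot, div_pow]

theorem sobolevSq_mono {A B : Set (RN N)} (h : A ⊆ B) (u : RN N → ℝ) :
    sobolevSq s A u ≤ sobolevSq s B u := by
  unfold sobolevSq
  refine add_le_add (lintegral_mono_set h) ?_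
  exact (lintegral_mono fun x => lintegral_mono_set h).trans (lintegral_mono_set h)

theorem sobolevSq_congr {A : Set (RN N)} (hA : MeasurableSet A) {u v : RN N → ℝ}
    (h : ∀ x ∈ A, u x = v x) : sobolevSq s A u = sobolevSq s A v := by
  unfold sobolevSq
  congr 1
  · exact setLIntegral_congr_fun hA fun x hx => by simp only [h x hx]
  · refine setLIntegral_congr_fun hA fun x hx => setLIntegral_congr_fun hA fun y hy => ?_
    simp only [diffQuot, h x hx, h y hy]

theorem enorm_add_sq_le (a b : ℝ) : ‖a + b‖ₑ ^ 2 ≤ 2 * ‖a‖ₑ ^ 2 + 2 * ‖b‖ₑ ^ 2 := by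
  simp only [enorm_sq_eq_ofReal]
  rw [← ENNReal.ofReal_ofNat 2, ← ENNReal.ofReal_mul (by norm_num),
    ← ENNReal.ofReal_mul (by norm_num), ← ENNReal.ofReal_add (by positivity) (by positivity)]
  exact ENNReal.ofReal_le_ofReal (by nlinarith [sq_nonneg (a - b)])

theorem measurable_enorm_diffQuot_sq {u : RN N → ℝ} (hu : Measurable u) (x : RN N) :
    Measurable fun y => ‖diffQuot s u (x, y)‖ₑ ^ 2 :=
  ((measurable_diffQuot hu).comp measurable_prodMk_left).enorm.pow_const 2

theorem measurable_lintegral_diffQuot {u : RN N → ℝ} (hu : Measurable u) (A : Set (RN N)) :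
    Measurable fun x => ∫⁻ y in A, ‖diffQuot s u (x, y)‖ₑ ^ 2 := by
  apply Measurable.lintegral_prod_right' (f := fun z : RN N × RN N => ‖diffQuot s u z‖ₑ ^ 2)
  exact (measurable_diffQuot hu).enorm.pow_const 2

theorem sobolevSq_add_le {A : Set (RN N)} {u v : RN N → ℝ} (hu : Measurable u)
    (hv : Measurable v) :
    sobolevSq s A (fun x => u x + v x) ≤ 2 * sobolevSq s A u + 2 * sobolevSq s A v := by
  have hm := fun x => measurable_enorm_diffQuot_sq (s := s) hu x
  have hm' := fun x => measurable_enorm_diffQuot_sq (s := s) hv x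
  have h1 : ∫⁻ x in A, ‖u x + v x‖ₑ ^ 2
      ≤ 2 * (∫⁻ x in A, ‖u x‖ₑ ^ 2) + 2 * ∫⁻ x in A, ‖v x‖ₑ ^ 2 := by
    rw [← lintegral_const_mul _ (by fun_prop), ← lintegral_const_mul _ (by fun_prop),
      ← lintegral_add_left (by fun_prop)]
    exact lintegral_mono fun x => enorm_add_sq_le _ _
  have h2 : ∫⁻ x in A, ∫⁻ y in A, ‖diffQuot s (fun x => u x + v x) (x, y)‖ₑ ^ 2
      ≤ 2 * (∫⁻ x in A, ∫⁻ y in A, ‖diffQuot s u (x, y)‖ₑ ^ 2)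
        + 2 * ∫⁻ x in A, ∫⁻ y in A, ‖diffQuot s v (x, y)‖ₑ ^ 2 := by
    rw [← lintegral_const_mul _ (measurable_lintegral_diffQuot hu A),
      ← lintegral_const_mul _ (measurable_lintegral_diffQuot hv A),
      ← lintegral_add_left ((measurable_lintegral_diffQuot hu A).const_mul 2)]
    refine lintegral_mono fun x => ?_
    rw [← lintegral_const_mul _ (hm x), ← lintegral_const_mul _ (hm' x),
      ← lintegral_add_left ((hm x).const_mul 2)]
    refine lintegral_mono fun y => ?_
    have : diffQuot s (fun x => u x + v x) (x, y) = diffQuot s u (x, y) + diffQuot s v (x, y) := by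
      simp only [diffQuot]; ring
    rw [this]
    exact enorm_add_sq_le _ _
  calc _ ≤ _ := add_le_add h1 h2
    _ = _ := by unfold sobolevSq; ring

/-- A bounded Lipschitz function multiplies `W^{s,2}(A)` into itself. -/
theorem exists_sobolevSq_mul_le (hN : 1 ≤ N) (hs0 : 0 < s) (hs1 : s < 1) {χ : RN N → ℝ} {L : ℝ≥0}
    (hL : LipschitzWith L χ) (hχ : ∀ x, χ x ∈ Icc (0 : ℝ) 1) :
    ∃ C : ℝ≥0, ∀ (A : Set (RN N)) (_ : MeasurableSet A) (u : RN N → ℝ) (_ : Measurable u),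
      sobolevSq s A (fun x => χ x * u x) ≤ C * sobolevSq s A u := by
  have hfin := tailMass_ne_top hN hs0 hs1
  refine ⟨2 + 2 * (L ^ 2 + 1) * (tailMass N s).toNNReal, fun A hA u hu => ?_⟩
  have key : ∀ x y, ‖diffQuot s (fun x => χ x * u x) (x, y)‖ₑ ^ 2
      ≤ 2 * ‖diffQuot s u (x, y)‖ₑ ^ 2 + 0 * ENNReal.ofReal (tailKernel N s (x - y))
        + (2 * ((L : ℝ≥0∞) ^ 2 + 1) * ‖u y‖ₑ ^ 2) * ENNReal.ofReal (tailKernel N s (x - y)) := by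
    intro x y
    -- Lipschitz continuity serves for nearby points, boundedness for distant ones; together they
    -- produce the truncated factor in `tailKernel`.
    have hd : (χ x - χ y) ^ 2 ≤ ((L : ℝ) ^ 2 + 1) * min (‖x - y‖ ^ 2) 1 := by
      have h1 : |χ x - χ y| ≤ L * ‖x - y‖ := by
        simpa [Real.dist_eq, dist_eq_norm] using hL.dist_le_mul x y
      have h2 : |χ x - χ y| ≤ 1 := by
        rw [abs_le]; constructor <;> linarith [(hχ x).1, (hχ y).1, (hχ x).2, (hχ y).2]
      have h3 : (χ x - χ y) ^ 2 ≤ (L : ℝ) ^ 2 * ‖x - y‖ ^ 2 := by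
        rw [← sq_abs, ← mul_pow]; gcongr
      have h4 : (χ x - χ y) ^ 2 ≤ 1 := by
        rw [← sq_abs]; exact pow_le_one₀ (abs_nonneg _) h2
      rcases min_cases (‖x - y‖ ^ 2) 1 with h | h <;> rw [h.1] <;>
        nlinarith [sq_nonneg (L : ℝ), sq_nonneg ‖x - y‖]
    have hreal : diffQuot s (fun x => χ x * u x) (x, y) ^ 2 ≤ 2 * diffQuot s u (x, y) ^ 2
        + 2 * ((L : ℝ) ^ 2 + 1) * u y ^ 2 * tailKernel N s (x - y) := by
      simp only [diffQuot_sq, tailKernel]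
      rw [← mul_div_assoc, ← mul_div_assoc, ← add_div]
      gcongr
      have hx2 : χ x ^ 2 ≤ 1 := pow_le_one₀ (hχ x).1 (hχ x).2
      -- Leibniz splitting with the difference of `χ` multiplied by `u y` only, so that one of the
      -- two zero order terms can be taken to be `0`.
      have e : χ x * u x - χ y * u y = χ x * (u x - u y) + u y * (χ x - χ y) := by ring
      rw [e]
      calc _ ≤ 2 * (χ x ^ 2 * (u x - u y) ^ 2) + 2 * (u y ^ 2 * (χ x - χ y) ^ 2) := by
            nlinarith [sq_nonneg (χ x * (u x - u y) - u y * (χ x - χ y))]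
        _ ≤ 2 * (1 * (u x - u y) ^ 2)
            + 2 * (u y ^ 2 * (((L : ℝ) ^ 2 + 1) * min (‖x - y‖ ^ 2) 1)) := by gcongr
        _ = _ := by ring
    simp only [zero_mul, add_zero, enorm_sq_eq_ofReal]
    calc _ ≤ _ := ENNReal.ofReal_le_ofReal hreal
      _ = _ := by
        have hk := tailKernel_nonneg (s := s) (x - y)
        rw [ENNReal.ofReal_add (by positivity) (mul_nonneg (by positivity) hk),
          ENNReal.ofReal_mul (by positivity), ENNReal.ofReal_mul (by positivity), ENNReal.ofReal_mul (by positivity),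
          ENNReal.ofReal_mul (by positivity), ENNReal.ofReal_add (by positivity) (by positivity),
          ENNReal.ofReal_pow L.coe_nonneg]
        simp
  have h2 := lintegral_diffQuot_le (s := s) hA (φ := fun _ => 0)
    (ψ := fun y => 2 * ((L : ℝ≥0∞) ^ 2 + 1) * ‖u y‖ₑ ^ 2)
    measurable_const (by fun_prop) fun x _ y _ => key x y
  have e1 : ∫⁻ x in A, ∫⁻ y in A, 2 * ‖diffQuot s u (x, y)‖ₑ ^ 2
      = 2 * ∫⁻ x in A, ∫⁻ y in A, ‖diffQuot s u (x, y)‖ₑ ^ 2 := by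
    rw [← lintegral_const_mul _ (measurable_lintegral_diffQuot hu A)]
    refine lintegral_congr fun x => ?_
    rw [lintegral_const_mul _ (measurable_enorm_diffQuot_sq hu x)]
  rw [e1, lintegral_const_mul _ (by fun_prop)] at h2
  have h1 : ∫⁻ x in A, ‖χ x * u x‖ₑ ^ 2 ≤ ∫⁻ x in A, ‖u x‖ₑ ^ 2 := by
    refine lintegral_mono fun x => ?_
    simp only [enorm_sq_eq_ofReal, mul_pow]
    refine ENNReal.ofReal_le_ofReal ?_
    have hx2 : χ x ^ 2 ≤ 1 := pow_le_one₀ (hχ x).1 (hχ x).2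
    nlinarith [sq_nonneg (u x)]
  unfold sobolevSq
  refine (add_le_add h1 h2).trans ?_
  push_cast
  rw [ENNReal.coe_toNNReal hfin]
  simp only [lintegral_zero, mul_zero, add_zero]
  generalize (∫⁻ x in A, ‖u x‖ₑ ^ 2) = a
  generalize (∫⁻ x in A, ∫⁻ y in A, ‖diffQuot s u (x, y)‖ₑ ^ 2) = d
  -- The added nonnegative terms only complete the sum to a multiple of `a + d`.
  calc a + (2 * d + tailMass N s * (2 * ((L : ℝ≥0∞) ^ 2 + 1) * a))
      ≤ a + (2 * d + tailMass N s * (2 * ((L : ℝ≥0∞) ^ 2 + 1) * a)) + (a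
        + 2 * (L ^ 2 + 1) * tailMass N s * d) := le_self_add
    _ = _ := by ring

/-- Extension by zero across a region of positive width. -/
theorem exists_sobolevSq_zeroExt_le (hN : 1 ≤ N) (hs0 : 0 < s) (hs1 : s < 1) {δ : ℝ} (hδ : 0 < δ) :
    ∃ C : ℝ≥0, ∀ (A B : Set (RN N)) (_ : MeasurableSet A) (_ : MeasurableSet B) (_ : A ⊆ B)
      (u : RN N → ℝ) (_ : Measurable u) (_ : ∀ x ∉ A, u x = 0)
      (_ : ∀ x ∈ A, u x ≠ 0 → ∀ y ∈ B \ A, δ ≤ ‖x - y‖),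
      sobolevSq s B u ≤ C * sobolevSq s A u := by
  have hfin := tailMass_ne_top hN hs0 hs1
  -- Chosen so that `1 ≤ K * min (‖x - y‖ ^ 2) 1` whenever `δ ≤ ‖x - y‖`. Mixed pairs, with exactly
  -- one point in `A`, then cost only a zero order term.
  set K : ℝ≥0 := ⟨1 + (δ ^ 2)⁻¹, by positivity⟩
  refine ⟨1 + 2 * K * (tailMass N s).toNNReal, fun A B hA hB hAB u hu h0 hsep => ?_⟩
  have hsupp : ∀ f : RN N → ℝ≥0∞, (∀ x ∉ A, f x = 0) → ∫⁻ x in B, f x = ∫⁻ x in A, f x := by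
    intro f hf
    rw [← lintegral_indicator hB, ← lintegral_indicator hA]
    refine lintegral_congr fun x => ?_
    by_cases hx : x ∈ A
    · rw [indicator_of_mem (hAB hx), indicator_of_mem hx]
    · rw [indicator_of_notMem hx]
      by_cases hx' : x ∈ B
      · rw [indicator_of_mem hx', hf x hx]
      · rw [indicator_of_notMem hx']
  have hfar : ∀ x ∈ A, ∀ y ∈ B \ A, (u x) ^ 2 / (‖x - y‖ ^ ((N : ℝ) / 2 + s)) ^ 2
      ≤ (K : ℝ) * u x ^ 2 * tailKernel N s (x - y) := by
    intro x hx y hy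
    by_cases hux : u x = 0
    · simp [hux]
    have hd := hsep x hx hux y hy
    unfold tailKernel
    rw [← mul_div_assoc]
    gcongr
    have : 1 ≤ (K : ℝ) * min (‖x - y‖ ^ 2) 1 := by
      have hKv : (K : ℝ) = 1 + (δ ^ 2)⁻¹ := rfl
      rw [hKv]
      have hd2 : δ ^ 2 ≤ ‖x - y‖ ^ 2 := by gcongr
      have hi : 0 < (δ ^ 2)⁻¹ := by positivity
      rcases min_cases (‖x - y‖ ^ 2) 1 with h | h <;> rw [h.1]
      · have : (δ ^ 2)⁻¹ * δ ^ 2 = 1 := inv_mul_cancel₀ (by positivity)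
        nlinarith
      · linarith
    nlinarith [sq_nonneg (u x)]
  have key : ∀ x ∈ B, ∀ y ∈ B, ‖diffQuot s u (x, y)‖ₑ ^ 2
      ≤ A.indicator (fun x => A.indicator (fun y => ‖diffQuot s u (x, y)‖ₑ ^ 2) y) x
        + (K * ‖u x‖ₑ ^ 2) * ENNReal.ofReal (tailKernel N s (x - y))
        + (K * ‖u y‖ₑ ^ 2) * ENNReal.ofReal (tailKernel N s (x - y)) := by
    have hcoe : ∀ x y, (K * ‖u x‖ₑ ^ 2) * ENNReal.ofReal (tailKernel N s y)
        = ENNReal.ofReal ((K : ℝ) * u x ^ 2 * tailKernel N s y) := by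
      intro x y
      rw [ENNReal.ofReal_mul (by positivity), ENNReal.ofReal_mul (by positivity),
        enorm_sq_eq_ofReal, ENNReal.ofReal_coe_nnreal]
    intro x hx y hy
    by_cases hxA : x ∈ A <;> by_cases hyA : y ∈ A
    · rw [indicator_of_mem hxA, indicator_of_mem hyA, add_assoc]
      exact le_self_add
    · refine le_trans ?_ le_self_add
      refine le_trans ?_ le_add_self
      rw [hcoe, enorm_sq_eq_ofReal, diffQuot_sq, h0 y hyA, sub_zero]
      exact ENNReal.ofReal_le_ofReal (hfar x hxA y ⟨hy, hyA⟩)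
    · refine le_trans ?_ le_add_self
      rw [hcoe, enorm_sq_eq_ofReal, diffQuot_sq, h0 x hxA, zero_sub, neg_sq, norm_sub_rev,
        tailKernel_sub_comm]
      exact ENNReal.ofReal_le_ofReal (hfar y hyA x ⟨hx, hxA⟩)
    · rw [enorm_sq_eq_ofReal, diffQuot_sq, h0 x hxA, h0 y hyA]
      simp
  have h2 := lintegral_diffQuot_le (s := s) hB (φ := fun y => K * ‖u y‖ₑ ^ 2)
    (ψ := fun y => K * ‖u y‖ₑ ^ 2) (by fun_prop) (by fun_prop) key
  have e1 : ∫⁻ x in B, ∫⁻ y in B,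
        A.indicator (fun x => A.indicator (fun y => ‖diffQuot s u (x, y)‖ₑ ^ 2) y) x
      = ∫⁻ x in A, ∫⁻ y in A, ‖diffQuot s u (x, y)‖ₑ ^ 2 := by
    rw [hsupp]
    · refine setLIntegral_congr_fun hA fun x hx => ?_
      simp only [indicator_of_mem hx]
      rw [hsupp]
      · exact setLIntegral_congr_fun hA fun y hy => by simp only [indicator_of_mem hy]
      · exact fun y hy => indicator_of_notMem hy _
    · intro x hx
      simp [indicator_of_notMem hx]
  have e2 : ∫⁻ x in B, ‖u x‖ₑ ^ 2 = ∫⁻ x in A, ‖u x‖ₑ ^ 2 :=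
    hsupp _ fun x hx => by simp [h0 x hx]
  rw [e1, lintegral_const_mul _ (by fun_prop), e2] at h2
  unfold sobolevSq
  rw [e2]
  refine (add_le_add le_rfl h2).trans ?_
  push_cast
  rw [ENNReal.coe_toNNReal hfin]
  generalize (∫⁻ x in A, ‖u x‖ₑ ^ 2) = a
  generalize (∫⁻ x in A, ∫⁻ y in A, ‖diffQuot s u (x, y)‖ₑ ^ 2) = d
  calc _ ≤ a + (d + tailMass N s * (K * a) + tailMass N s * (K * a))
        + 2 * K * tailMass N s * d := le_self_add
    _ = _ := by ring

end

end MGT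

/-! ### Lipschitz changes of variables, shears and folding across a graph -/

namespace MGT

noncomputable section

variable {N : ℕ} {s : ℝ}

/-- Composition with a Lipschitz map which does not increase volumes by more than a factor `2`. -/
theorem exists_sobolevSq_comp_le (hs0 : 0 < s) {F : Set (RN N)}
    {f : RN N → RN N} {L : ℝ≥0} (hf : LipschitzWith L f)
    (hmap : Measure.map f volume ≤ (2 : ℝ≥0∞) • volume.restrict F) :
    ∃ C : ℝ≥0, ∀ u : RN N → ℝ, Measurable u → sobolevSq s univ (u ∘ f) ≤ C * sobolevSq s F u := by
  have hfm : Measurable f := hf.continuous.measurable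
  have hcomp : ∀ φ : RN N → ℝ≥0∞, Measurable φ → ∫⁻ x, φ (f x) ≤ 2 * ∫⁻ x in F, φ x := by
    intro φ hφ
    rw [← lintegral_map hφ hfm]
    refine (lintegral_mono' hmap le_rfl).trans ?_
    rw [lintegral_smul_measure, smul_eq_mul]
  -- The factor `L^(N + 2s)` compares `‖f x - f y‖` with `‖x - y‖` in the denominator. The
  -- substitutions in `x` and in `y` cost a further factor `2` each.
  set K : ℝ≥0 := ⟨((L : ℝ) ^ ((N : ℝ) / 2 + s)) ^ 2, by positivity⟩
  refine ⟨2 + 4 * K, fun u hu => ?_⟩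
  have hpt : ∀ x y, ‖diffQuot s (u ∘ f) (x, y)‖ₑ ^ 2 ≤ K * ‖diffQuot s u (f x, f y)‖ₑ ^ 2 := by
    intro x y
    rw [enorm_sq_eq_ofReal, enorm_sq_eq_ofReal, ← ENNReal.ofReal_coe_nnreal,
      ← ENNReal.ofReal_mul (by positivity)]
    refine ENNReal.ofReal_le_ofReal ?_
    rw [diffQuot_sq, diffQuot_sq]
    simp only [Function.comp]
    have hd : ‖f x - f y‖ ≤ L * ‖x - y‖ := hf.norm_sub_le x y
    by_cases h0 : f x = f y
    · rw [h0]; simp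
    have h1 : 0 < ‖f x - f y‖ := norm_pos_iff.2 (sub_ne_zero.2 h0)
    have h2 : 0 < ‖x - y‖ := norm_pos_iff.2 (sub_ne_zero.2 fun h => h0 (by rw [h]))
    have h3 : (‖f x - f y‖ ^ ((N : ℝ) / 2 + s)) ^ 2
        ≤ (K : ℝ) * (‖x - y‖ ^ ((N : ℝ) / 2 + s)) ^ 2 := by
      change _ ≤ ((L : ℝ) ^ ((N : ℝ) / 2 + s)) ^ 2 * _
      rw [← mul_pow, ← Real.mul_rpow (by positivity) (by positivity)]
      gcongr
    rw [div_le_iff₀ (by positivity), mul_div_assoc', div_mul_eq_mul_div, le_div_iff₀ (by positivity)]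
    nlinarith [sq_nonneg (u (f x) - u (f y))]
  have h2 : ∫⁻ x, ∫⁻ y, ‖diffQuot s (u ∘ f) (x, y)‖ₑ ^ 2
      ≤ 4 * K * ∫⁻ x in F, ∫⁻ y in F, ‖diffQuot s u (x, y)‖ₑ ^ 2 := by
    calc _ ≤ ∫⁻ x, ∫⁻ y, K * ‖diffQuot s u (f x, f y)‖ₑ ^ 2 :=
          lintegral_mono fun x => lintegral_mono fun y => hpt x y
      _ ≤ ∫⁻ x, 2 * K * ∫⁻ y in F, ‖diffQuot s u (f x, y)‖ₑ ^ 2 := by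
          refine lintegral_mono fun x => ?_
          have hm := measurable_enorm_diffQuot_sq (s := s) hu (f x)
          refine (hcomp (fun y => K * ‖diffQuot s u (f x, y)‖ₑ ^ 2) (hm.const_mul _)).trans ?_
          rw [lintegral_const_mul _ hm, mul_assoc]
      _ ≤ _ := by
          have hm := measurable_lintegral_diffQuot (s := s) hu F
          refine (hcomp (fun x => 2 * K * ∫⁻ y in F, ‖diffQuot s u (x, y)‖ₑ ^ 2)
            (hm.const_mul _)).trans ?_
          rw [lintegral_const_mul _ hm]
          apply le_of_eq
          ring
  unfold sobolevSq
  simp only [Measure.restrict_univ]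
  refine (add_le_add (hcomp (fun x => ‖u x‖ₑ ^ 2) (by fun_prop)) h2).trans ?_
  push_cast
  generalize (∫⁻ x in F, ‖u x‖ₑ ^ 2) = a
  generalize (∫⁻ x in F, ∫⁻ y in F, ‖diffQuot s u (x, y)‖ₑ ^ 2) = d
  calc _ ≤ 2 * a + 4 * K * d + (4 * K * a + 2 * d) := le_self_add
    _ = _ := by ring

/-- The component of `y` orthogonal to the unit vector `e`. -/
def orthPart (e y : RN N) : RN N := y - (inner ℝ e y : ℝ) • e

theorem orthPart_add_smul {e : RN N} (he : ‖e‖ = 1) (y : RN N) (τ : ℝ) :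
    orthPart e (y + τ • e) = orthPart e y := by
  unfold orthPart
  rw [inner_add_right, inner_smul_right, real_inner_self_eq_norm_sq, he]
  module

theorem continuous_orthPart (e : RN N) : Continuous (orthPart e) := by
  unfold orthPart; fun_prop

/-- Shears are volume preserving. -/
theorem measurePreserving_shear {e : RN N} (he : ‖e‖ = 1) {k : RN N → ℝ} (hk : Measurable k) :
    MeasurePreserving (fun y => y + k (orthPart e y) • e) (volume : Measure (RN N)) volume := by
  have hP : Measurable (orthPart e) := (continuous_orthPart e).measurable
  have hm : Measurable fun y => y + k (orthPart e y) • e := by fun_prop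
  refine ⟨hm, Measure.ext_of_lintegral _ fun φ hφ => ?_⟩
  rw [lintegral_map hφ hm]
  -- A weight of total mass one replaces the choice of coordinates along `e`. Averaging over the
  -- translations by `τ • e` leaves `orthPart e` unchanged, so by Tonelli the shear becomes a
  -- translation of `τ`, which `η` absorbs after integration.
  set η : ℝ → ℝ≥0∞ := (Icc (0 : ℝ) 1).indicator 1 with hη
  have hηm : Measurable η := measurable_one.indicator measurableSet_Icc
  have hη1 : ∫⁻ τ, η τ = 1 := by
    rw [hη, lintegral_indicator_one measurableSet_Icc]; simp
  calc ∫⁻ y, φ (y + k (orthPart e y) • e)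
      = ∫⁻ τ : ℝ, η τ * ∫⁻ y, φ (y + k (orthPart e y) • e) := by
        rw [lintegral_mul_const _ hηm, hη1, one_mul]
    _ = ∫⁻ τ : ℝ, ∫⁻ y, η τ * φ (y + (τ + k (orthPart e y)) • e) := by
        refine lintegral_congr fun τ => ?_
        rw [lintegral_const_mul _ (by fun_prop),
          ← lintegral_add_right_eq_self (fun y => φ (y + k (orthPart e y) • e)) (τ • e)]
        congr 1
        refine lintegral_congr fun y => ?_
        rw [orthPart_add_smul he, add_smul, add_assoc]
    _ = ∫⁻ y, ∫⁻ τ : ℝ, η τ * φ (y + (τ + k (orthPart e y)) • e) :=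
        lintegral_lintegral_swap (by fun_prop)
    _ = ∫⁻ y, ∫⁻ τ : ℝ, η (τ - k (orthPart e y)) * φ (y + τ • e) := by
        refine lintegral_congr fun y => ?_
        rw [← lintegral_add_right_eq_self (fun τ => η (τ - k (orthPart e y)) * φ (y + τ • e))
          (k (orthPart e y))]
        simp only [add_sub_cancel_right]
    _ = ∫⁻ τ : ℝ, ∫⁻ y, η (τ - k (orthPart e y)) * φ (y + τ • e) :=
        lintegral_lintegral_swap (by fun_prop)
    _ = ∫⁻ τ : ℝ, ∫⁻ y, η (τ - k (orthPart e y)) * φ y := by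
        refine lintegral_congr fun τ => ?_
        rw [← lintegral_add_right_eq_self (fun y => η (τ - k (orthPart e y)) * φ y) (τ • e)]
        simp only [orthPart_add_smul he]
    _ = ∫⁻ y, ∫⁻ τ : ℝ, η (τ - k (orthPart e y)) * φ y :=
        lintegral_lintegral_swap (by fun_prop)
    _ = ∫⁻ y, φ y := by
        refine lintegral_congr fun y => ?_
        rw [lintegral_mul_const _ (by fun_prop), lintegral_sub_right_eq_self, hη1, one_mul]

/-- The reflection across the graph of `h` in the direction `e`. -/
def graphReflection (e : RN N) (h : RN N → ℝ) (y : RN N) : RN N :=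
  y - (2 * (inner ℝ e y - h (orthPart e y))) • e

/-- The map which folds `ℝᴺ` onto the region below the graph of `h`. -/
def graphFold (e : RN N) (h : RN N → ℝ) (y : RN N) : RN N :=
  y - (2 * max (inner ℝ e y - h (orthPart e y)) 0) • e

/-- The region below the graph of `h`. -/
def subgraph (e : RN N) (h : RN N → ℝ) : Set (RN N) := {y | inner ℝ e y ≤ h (orthPart e y)}

section graph

variable {e : RN N} {h : RN N → ℝ}

theorem orthPart_graphReflection (he : ‖e‖ = 1) (y : RN N) :
    orthPart e (graphReflection e h y) = orthPart e y := by
  unfold graphReflection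
  rw [sub_eq_add_neg, ← neg_smul, orthPart_add_smul he]

theorem inner_graphReflection (he : ‖e‖ = 1) (y : RN N) :
    inner ℝ e (graphReflection e h y) = 2 * h (orthPart e y) - inner ℝ e y := by
  unfold graphReflection
  rw [inner_sub_right, inner_smul_right, real_inner_self_eq_norm_sq, he]
  ring

theorem graphReflection_involutive (he : ‖e‖ = 1) (y : RN N) :
    graphReflection e h (graphReflection e h y) = y := by
  have h1 : graphReflection e h (graphReflection e h y) = graphReflection e h y
      - (2 * (inner ℝ e (graphReflection e h y)
        - h (orthPart e (graphReflection e h y)))) • e := rfl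
  rw [h1, orthPart_graphReflection he, inner_graphReflection he]
  unfold graphReflection
  module

theorem graphFold_of_mem {y : RN N} (hy : y ∈ subgraph e h) : graphFold e h y = y := by
  have : (inner ℝ e y : ℝ) ≤ h (orthPart e y) := hy
  simp [graphFold, this]

theorem graphFold_of_notMem {y : RN N} (hy : y ∉ subgraph e h) :
    graphFold e h y = graphReflection e h y := by
  have : h (orthPart e y) < (inner ℝ e y : ℝ) := not_le.1 hy
  unfold graphFold graphReflection
  rw [max_eq_left (by linarith)]

theorem graphReflection_mem {y : RN N} (he : ‖e‖ = 1) (hy : y ∉ subgraph e h) :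
    graphReflection e h y ∈ subgraph e h := by
  have : h (orthPart e y) < (inner ℝ e y : ℝ) := not_le.1 hy
  change (inner ℝ e (graphReflection e h y) : ℝ) ≤ h (orthPart e (graphReflection e h y))
  rw [orthPart_graphReflection he, inner_graphReflection he]
  linarith

theorem measurableSet_subgraph (hh : Continuous h) : MeasurableSet (subgraph e h) :=
  measurableSet_le (by fun_prop) (hh.comp (continuous_orthPart e)).measurable

/-- The reflection across the graph is the linear reflection in the hyperplane orthogonal to `e`,
followed by the shear along `e` by `2 h`. -/
theorem measurePreserving_graphReflection (he : ‖e‖ = 1) (hh : Continuous h) :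
    MeasurePreserving (graphReflection e h) (volume : Measure (RN N)) volume := by
  have h1 := measurePreserving_shear he (k := fun y => 2 * h y) (by fun_prop)
  have h2 : MeasurePreserving ((ℝ ∙ e)ᗮ.reflection) (volume : Measure (RN N)) volume :=
    ((ℝ ∙ e)ᗮ.reflection).measurePreserving
  refine (congrArg (fun f => MeasurePreserving f (volume : Measure (RN N)) volume) ?_).mp
    (h1.comp h2)
  funext y
  have hr : (ℝ ∙ e)ᗮ.reflection y = y + (-2 * inner ℝ e y) • e := by
    rw [Submodule.reflection_orthogonal_apply, Submodule.reflection_singleton_apply]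
    simp only [he]
    norm_num
    module
  simp only [Function.comp]
  rw [hr, orthPart_add_smul he]
  unfold graphReflection
  module

/-- The fold is the identity below the graph and the volume preserving reflection above it, so each
point below the graph is covered at most twice. -/
theorem map_graphFold_le (he : ‖e‖ = 1) (hh : Continuous h) :
    Measure.map (graphFold e h) volume
      ≤ (2 : ℝ≥0∞) • (volume : Measure (RN N)).restrict (subgraph e h) := by
  have hF := measurableSet_subgraph (e := e) hh
  have hc := continuous_orthPart e
  have hm : Measurable (graphFold e h) := by
    have := hh.measurable
    have := hc.measurable
    unfold graphFold; fun_prop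
  refine Measure.le_iff.2 fun S hS => ?_
  rw [Measure.map_apply hm hS, Measure.smul_apply, Measure.restrict_apply hS, smul_eq_mul, two_mul]
  have hsub : graphFold e h ⁻¹' S ⊆ (S ∩ subgraph e h) ∪
      (graphReflection e h ⁻¹' (S ∩ subgraph e h)) := by
    intro y hy
    by_cases hyF : y ∈ subgraph e h
    · left
      rw [mem_preimage, graphFold_of_mem hyF] at hy
      exact ⟨hy, hyF⟩
    · right
      rw [mem_preimage, graphFold_of_notMem hyF] at hy
      exact ⟨hy, graphReflection_mem he hyF⟩
  refine (measure_mono hsub).trans ((measure_union_le _ _).trans ?_)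
  rw [(measurePreserving_graphReflection he hh).measure_preimage (hS.inter hF).nullMeasurableSet]

theorem exists_lipschitzWith_height {K : ℝ≥0} (hh : LipschitzWith K h) :
    ∃ L, LipschitzWith L fun y => (inner ℝ e y : ℝ) - h (orthPart e y) := by
  have h1 : LipschitzWith ‖innerSL ℝ e‖₊ fun y : RN N => (inner ℝ e y : ℝ) :=
    (innerSL ℝ e).lipschitz
  have h2 : LipschitzWith ‖ContinuousLinearMap.id ℝ (RN N) - (innerSL ℝ e).smulRight e‖₊
      (orthPart e) :=
    (ContinuousLinearMap.id ℝ (RN N) - (innerSL ℝ e).smulRight e).lipschitz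
  exact ⟨_, h1.sub (hh.comp h2)⟩

theorem exists_lipschitzWith_graphReflection {K : ℝ≥0} (hh : LipschitzWith K h) :
    ∃ L, LipschitzWith L (graphReflection e h) := by
  obtain ⟨L, hL⟩ := exists_lipschitzWith_height (e := e) hh
  have h3 : LipschitzWith ‖ContinuousLinearMap.toSpanSingleton ℝ ((2 : ℝ) • e)‖₊
      fun t : ℝ => t • ((2 : ℝ) • e) :=
    (ContinuousLinearMap.toSpanSingleton ℝ ((2 : ℝ) • e)).lipschitz
  have := LipschitzWith.id.sub (h3.comp hL)
  refine ⟨_, (congrArg (LipschitzWith _) ?_).mp this⟩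
  funext y
  simp only [id, Function.comp, graphReflection]
  module

theorem exists_lipschitzWith_graphFold {K : ℝ≥0} (hh : LipschitzWith K h) :
    ∃ L, LipschitzWith L (graphFold e h) := by
  obtain ⟨L, hL⟩ := exists_lipschitzWith_height (e := e) hh
  have h3 : LipschitzWith ‖ContinuousLinearMap.toSpanSingleton ℝ ((2 : ℝ) • e)‖₊
      fun t : ℝ => t • ((2 : ℝ) • e) :=
    (ContinuousLinearMap.toSpanSingleton ℝ ((2 : ℝ) • e)).lipschitz
  have := LipschitzWith.id.sub (h3.comp (hL.max_const 0))
  refine ⟨_, (congrArg (LipschitzWith _) ?_).mp this⟩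
  funext y
  simp only [id, Function.comp, graphFold]
  module

end graph

end

end MGT

/-! ### The extension theorem for the complement of a Lipschitz domain -/

namespace MGT

noncomputable section

variable {N : ℕ} {s : ℝ}

/-- Every function `χ u`, `u ∈ W^{s,2}(ℝᴺ ∖ Ω)`, has an extension to `ℝᴺ`, with a bound. -/
def CutoffExtends (s : ℝ) (Ω : Set (RN N)) (χ : RN N → ℝ) : Prop :=
  ∃ C : ℝ≥0, ∀ u : RN N → ℝ, Measurable u → ∃ G : RN N → ℝ, Measurable G ∧
    (∀ x ∈ Ωᶜ, G x = χ x * u x) ∧ sobolevSq s univ G ≤ C * sobolevSq s Ωᶜ u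

/-- A Lipschitz cutoff around a point. -/
theorem exists_lipschitz_bump (x : RN N) {ρ : ℝ} (hρ : 0 < ρ) :
    ∃ (L : ℝ≥0) (χ : RN N → ℝ), LipschitzWith L χ ∧ (∀ y, χ y ∈ Icc (0 : ℝ) 1) ∧
      (∀ y ∈ Metric.ball x (ρ / 2), χ y = 1) ∧ ∀ y ∉ Metric.ball x ρ, χ y = 0 := by
  have h1 : LipschitzWith ⟨2 / ρ, by positivity⟩ fun y : RN N => 2 - 2 / ρ * dist y x := by
    refine LipschitzWith.of_dist_le_mul fun y z => ?_
    rw [Real.dist_eq]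
    have : (2 - 2 / ρ * dist y x) - (2 - 2 / ρ * dist z x) = 2 / ρ * (dist z x - dist y x) := by
      ring
    rw [this, abs_mul, abs_of_pos (by positivity : 0 < 2 / ρ)]
    change _ ≤ 2 / ρ * dist y z
    gcongr
    rw [dist_comm y z]
    exact abs_dist_sub_le z y x
  refine ⟨_, fun y => max (min (2 - 2 / ρ * dist y x) 1) 0, (h1.min_const 1).max_const 0,
    fun y => ⟨le_max_right _ _, max_le (min_le_right _ _) zero_le_one⟩, fun y hy => ?_,
    fun y hy => ?_⟩
  · have hy' : dist y x < ρ / 2 := hy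
    have : 2 / ρ * dist y x ≤ 1 := by
      rw [div_mul_eq_mul_div, div_le_one hρ]; linarith
    beta_reduce
    rw [min_eq_right (by linarith), max_eq_left zero_le_one]
  · have hy' : ρ ≤ dist y x := not_lt.1 hy
    have : 2 ≤ 2 / ρ * dist y x := by
      rw [div_mul_eq_mul_div, le_div_iff₀ hρ]; linarith
    beta_reduce
    rw [max_eq_right]
    exact (min_le_left _ _).trans (by linarith)

/-- Near a boundary point the complement of `Ω` is the region below a Lipschitz graph. The cut off
function is extended by zero to the whole subgraph and then composed with the fold. A small cutoff
radius ensures that no reflected values reach points of the complement outside the coordinate ball.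
-/
theorem exists_cutoffExtends (hN : 1 ≤ N) (hs0 : 0 < s) (hs1 : s < 1) {Ω : Set (RN N)}
    (hΩ : IsOpen Ω) (hL : HasLipschitzBoundary Ω) {x : RN N} (hx : x ∈ frontier Ω) :
    ∃ (L : ℝ≥0) (χ : RN N → ℝ) (ρ : ℝ), 0 < ρ ∧ LipschitzWith L χ ∧ (∀ y, χ y ∈ Icc (0 : ℝ) 1) ∧
      (∀ y ∈ Metric.ball x ρ, χ y = 1) ∧ CutoffExtends s Ω χ := by
  obtain ⟨r, hr, e, he, K, h, hK, hgraph⟩ := hL x hx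
  obtain ⟨LR, hLR⟩ := exists_lipschitzWith_graphReflection (e := e) hK
  obtain ⟨LF, hLF⟩ := exists_lipschitzWith_graphFold (e := e) hK
  have hhc : Continuous h := hK.continuous
  have hxΩ : x ∉ Ω := by
    rw [hΩ.frontier_eq] at hx
    exact hx.2
  have hgr : ∀ y ∈ Metric.ball x r, (y ∈ Ω ↔ y ∉ subgraph e h) := by
    intro y hy
    rw [hgraph y hy]
    exact not_le.symm
  -- The point `x` lies on the graph: it is not in `Ω`, hence not above the graph, and it is a limit
  -- of points of `Ω`, hence not below.
  have hRx : graphReflection e h x = x := by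
    have hle : (inner ℝ e x : ℝ) ≤ h (orthPart e x) := by
      by_contra hcon
      exact hxΩ ((hgr x (Metric.mem_ball_self hr)).2 hcon)
    have hge : h (orthPart e x) ≤ (inner ℝ e x : ℝ) := by
      have hcl : x ∈ closure (Ω ∩ Metric.ball x r) := by
        rw [mem_closure_iff_nhds]
        intro t ht
        have := mem_closure_iff_nhds.1 hx.1 _ (inter_mem ht (Metric.ball_mem_nhds x hr))
        exact this.mono fun y hy => ⟨hy.1.1, hy.2, hy.1.2⟩
      have hclosed : IsClosed {y : RN N | h (orthPart e y) ≤ (inner ℝ e y : ℝ)} :=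
        isClosed_le (hhc.comp (continuous_orthPart e)) (by fun_prop)
      have hsub : Ω ∩ Metric.ball x r ⊆ {y : RN N | h (orthPart e y) ≤ (inner ℝ e y : ℝ)} :=
        fun y hy => le_of_lt (show h (orthPart e y) < (inner ℝ e y : ℝ) from
          not_le.1 ((hgr y hy.2).1 hy.1))
      exact closure_minimal hsub hclosed hcl
    unfold graphReflection
    rw [le_antisymm hle hge]
    simp
  -- Two requirements: `ρ ≤ r / 2` leaves a gap of width `r / 2` for the extension by zero, and `LR
  -- * ρ < r` keeps the reflected image of the `ρ`-ball inside the ball of radius `r`, as the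
  -- reflection fixes `x`.
  set ρ : ℝ := r / (2 * (LR + 1)) with hρdef
  have hρ : 0 < ρ := by positivity
  have hρr : ρ * (2 * (LR + 1)) = r := by rw [hρdef]; field_simp
  have hLR0 : (0 : ℝ) ≤ LR := LR.coe_nonneg
  have hρr2 : ρ ≤ r / 2 := by nlinarith
  obtain ⟨L, χ, hχL, hχ, hχ1, hχ0⟩ := exists_lipschitz_bump x hρ
  refine ⟨L, χ, ρ / 2, by positivity, hχL, hχ, hχ1, ?_⟩
  obtain ⟨C1, hC1⟩ := exists_sobolevSq_mul_le hN hs0 hs1 hχL hχ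
  obtain ⟨C2, hC2⟩ := exists_sobolevSq_zeroExt_le hN hs0 hs1 (half_pos hr)
  obtain ⟨C3, hC3⟩ := exists_sobolevSq_comp_le hs0 hLF (map_graphFold_le he hhc)
  refine ⟨C3 * C2 * C1, fun u hu => ?_⟩
  have hΩm : MeasurableSet Ωᶜ := hΩ.measurableSet.compl
  have hχm : Measurable χ := hχL.continuous.measurable
  set A : Set (RN N) := Ωᶜ ∩ Metric.ball x r with hA
  have hAm : MeasurableSet A := hΩm.inter measurableSet_ball
  set u1 : RN N → ℝ := A.indicator fun y => χ y * u y with hu1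
  have hu1m : Measurable u1 := (hχm.mul hu).indicator hAm
  have hASub : A ⊆ subgraph e h := by
    intro y hy
    by_contra hcon
    exact hy.1 ((hgr y hy.2).2 hcon)
  have hu1ne : ∀ y, u1 y ≠ 0 → y ∈ Metric.ball x ρ := by
    intro y hy
    by_contra hcon
    refine hy ?_
    by_cases hyA : y ∈ A
    · rw [hu1, indicator_of_mem hyA, hχ0 y hcon, zero_mul]
    · rw [hu1, indicator_of_notMem hyA]
  refine ⟨u1 ∘ graphFold e h, hu1m.comp hLF.continuous.measurable, fun y hy => ?_, ?_⟩
  · simp only [Function.comp]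
    by_cases hyF : y ∈ subgraph e h
    · rw [graphFold_of_mem hyF]
      by_cases hyA : y ∈ A
      · rw [hu1, indicator_of_mem hyA]
      · rw [hu1, indicator_of_notMem hyA, hχ0 y, zero_mul]
        intro hyb
        exact hyA ⟨hy, Metric.ball_subset_ball (by linarith) hyb⟩
    -- A point of the complement above the graph must lie outside the coordinate ball, so `χ`
    -- vanishes there. The folded function vanishes too: otherwise the reflected point would be
    -- within `ρ` of `x`, and reflecting back would give `dist y x < r`.
    · rw [graphFold_of_notMem hyF]
      have hyr : y ∉ Metric.ball x r := fun hyb => hy ((hgr y hyb).2 hyF)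
      rw [hχ0 y fun hyb => hyr (Metric.ball_subset_ball (by linarith) hyb), zero_mul]
      by_contra hne
      have hd : dist (graphReflection e h y) x < ρ := hu1ne _ hne
      refine hyr ?_
      have := hLR.dist_le_mul (graphReflection e h y) x
      rw [graphReflection_involutive he, hRx] at this
      rw [Metric.mem_ball]
      nlinarith
  · calc sobolevSq s univ (u1 ∘ graphFold e h) ≤ C3 * sobolevSq s (subgraph e h) u1 := hC3 u1 hu1m
      _ ≤ C3 * (C2 * sobolevSq s A u1) := by
          gcongr
          refine hC2 A (subgraph e h) hAm (measurableSet_subgraph hhc) hASub u1 hu1m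
            (fun y hy => indicator_of_notMem hy _) ?_
          intro z hz hzne y hy
          have hzρ : dist z x < ρ := hu1ne z hzne
          have hyr : r ≤ dist y x := by
            by_contra hcon
            have hyb : y ∈ Metric.ball x r := not_le.1 hcon
            exact hy.2 ⟨fun hyΩ => (hgr y hyb).1 hyΩ hy.1, hyb⟩
          rw [← dist_eq_norm]
          have := dist_triangle y z x
          rw [dist_comm y z] at this
          linarith
      _ = C3 * (C2 * sobolevSq s A fun y => χ y * u y) := by
          rw [sobolevSq_congr hAm fun y hy => indicator_of_mem hy _]
      _ ≤ C3 * (C2 * sobolevSq s Ωᶜ fun y => χ y * u y) := by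
          gcongr
          exact sobolevSq_mono inter_subset_left _
      _ ≤ C3 * (C2 * (C1 * sobolevSq s Ωᶜ u)) := by
          gcongr
          exact hC1 Ωᶜ hΩm u hu
      _ = _ := by push_cast; ring

/-- A cutoff around a compact part of the boundary which admits extensions. -/
def ExtendsNear (s : ℝ) (Ω S : Set (RN N)) : Prop :=
  ∃ (L : ℝ≥0) (χ : RN N → ℝ) (U : Set (RN N)), IsOpen U ∧ S ⊆ U ∧ LipschitzWith L χ ∧
    (∀ y, χ y ∈ Icc (0 : ℝ) 1) ∧ (∀ y ∈ U, χ y = 1) ∧ CutoffExtends s Ω χ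

theorem lipschitzWith_one_sub {χ : RN N → ℝ} {L : ℝ≥0} (h : LipschitzWith L χ) :
    LipschitzWith L fun x => 1 - χ x := by
  refine LipschitzWith.of_dist_le_mul fun x y => ?_
  have := h.dist_le_mul x y
  rw [Real.dist_eq] at *
  rwa [show 1 - χ x - (1 - χ y) = -(χ x - χ y) by ring, abs_neg]

/-- The new cutoff `1 - (1 - χ₁)(1 - χ₂)` equals `χ₁ + χ₂ (1 - χ₁)`: extend `χ₁ u` by the first
operator, and apply the second one to `(1 - χ₁) u`, which is again controlled because `1 - χ₁` is a
bounded Lipschitz multiplier. -/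
theorem ExtendsNear.union (hN : 1 ≤ N) (hs0 : 0 < s) (hs1 : s < 1) {Ω S T : Set (RN N)}
    (hΩ : IsOpen Ω) (hS : ExtendsNear s Ω S) (hT : ExtendsNear s Ω T) :
    ExtendsNear s Ω (S ∪ T) := by
  obtain ⟨L1, χ1, U1, hU1, hSU1, hL1, hχ1, h11, C1, hC1⟩ := hS
  obtain ⟨L2, χ2, U2, hU2, hSU2, hL2, hχ2, h12, C2, hC2⟩ := hT
  have hχ1' : ∀ x, 1 - χ1 x ∈ Icc (0 : ℝ) 1 := fun x =>
    ⟨by linarith [(hχ1 x).2], by linarith [(hχ1 x).1]⟩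
  refine ⟨L1 + L2, fun x => 1 - (1 - χ1 x) * (1 - χ2 x), U1 ∪ U2, hU1.union hU2,
    union_subset_union hSU1 hSU2, ?_, fun x => ?_, ?_, ?_⟩
  · refine LipschitzWith.of_dist_le_mul fun x y => ?_
    have d1 := hL1.dist_le_mul x y
    have d2 := hL2.dist_le_mul x y
    rw [Real.dist_eq] at *
    have e : 1 - (1 - χ1 x) * (1 - χ2 x) - (1 - (1 - χ1 y) * (1 - χ2 y))
        = (1 - χ2 x) * (χ1 x - χ1 y) + (1 - χ1 y) * (χ2 x - χ2 y) := by ring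
    rw [e]
    push_cast
    calc _ ≤ |1 - χ2 x| * |χ1 x - χ1 y| + |1 - χ1 y| * |χ2 x - χ2 y| := by
          rw [← abs_mul, ← abs_mul]; exact abs_add_le _ _
      _ ≤ 1 * (L1 * dist x y) + 1 * (L2 * dist x y) := by
          gcongr
          · rw [abs_le]; constructor <;> linarith [(hχ2 x).1, (hχ2 x).2]
          · rw [abs_le]; constructor <;> linarith [(hχ1 y).1, (hχ1 y).2]
      _ = _ := by ring
  · have a1 := hχ1 x
    have a2 := hχ2 x
    have : (1 - χ1 x) * (1 - χ2 x) ≤ 1 := mul_le_one₀ (by linarith [a1.1]) (by linarith [a2.2])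
      (by linarith [a2.1])
    have : 0 ≤ (1 - χ1 x) * (1 - χ2 x) := mul_nonneg (by linarith [a1.2]) (by linarith [a2.2])
    constructor <;> linarith
  · rintro x (hx | hx)
    · simp [h11 x hx]
    · simp [h12 x hx]
  · obtain ⟨C3, hC3⟩ := exists_sobolevSq_mul_le hN hs0 hs1 (lipschitzWith_one_sub hL1) hχ1'
    refine ⟨2 * C1 + 2 * (C2 * C3), fun u hu => ?_⟩
    have hm1 : Measurable χ1 := hL1.continuous.measurable
    obtain ⟨G1, hG1, hG1', hG1''⟩ := hC1 u hu
    obtain ⟨G2, hG2, hG2', hG2''⟩ := hC2 (fun x => (1 - χ1 x) * u x) (by fun_prop)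
    refine ⟨fun x => G1 x + G2 x, hG1.add hG2, fun x hx => ?_, ?_⟩
    · beta_reduce
      rw [hG1' x hx, hG2' x hx]; ring
    · refine (sobolevSq_add_le hG1 hG2).trans ?_
      calc _ ≤ 2 * (C1 * sobolevSq s Ωᶜ u) + 2 * (C2 * (C3 * sobolevSq s Ωᶜ u)) := by
            gcongr
            refine hG2''.trans ?_
            gcongr
            exact hC3 _ hΩ.measurableSet.compl u hu
        _ = _ := by push_cast; ring

/-- Compactness induction: the property passes to subsets and unions, and it holds on a ball around
each boundary point. -/
theorem extendsNear_frontier (hN : 1 ≤ N) (hs0 : 0 < s) (hs1 : s < 1) {Ω : Set (RN N)}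
    (hΩ : IsOpen Ω) (hb : Bornology.IsBounded Ω) (hL : HasLipschitzBoundary Ω) :
    ExtendsNear s Ω (frontier Ω) := by
  have hc : IsCompact (frontier Ω) :=
    hb.isCompact_closure.of_isClosed_subset isClosed_frontier frontier_subset_closure
  refine hc.induction_on ?_ ?_ (fun S T hS hT => hS.union hN hs0 hs1 hΩ hT) ?_
  · refine ⟨0, fun _ => 0, ∅, isOpen_empty, subset_rfl, LipschitzWith.const 0, fun y => by simp,
      fun y hy => hy.elim, 0, fun u hu => ⟨fun _ => 0, measurable_const, by simp, ?_⟩⟩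
    simp [sobolevSq, diffQuot]
  · rintro S T hST ⟨L, χ, U, hU, hSU, h⟩
    exact ⟨L, χ, U, hU, hST.trans hSU, h⟩
  · intro x hx
    obtain ⟨L, χ, ρ, hρ, hχL, hχ, hχ1, hext⟩ := exists_cutoffExtends hN hs0 hs1 hΩ hL hx
    exact ⟨Metric.ball x ρ, mem_nhdsWithin_of_mem_nhds (Metric.ball_mem_nhds x hρ), L, χ,
      Metric.ball x ρ, Metric.isOpen_ball, subset_rfl, hχL, hχ, hχ1, hext⟩

/-- The extension theorem for `W^{s,2}(ℝᴺ ∖ Ω)`. -/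
theorem exists_sobolev_extension (hN : 1 ≤ N) (hs0 : 0 < s) (hs1 : s < 1) {Ω : Set (RN N)}
    (hΩ : IsOpen Ω) (hb : Bornology.IsBounded Ω) (hL : HasLipschitzBoundary Ω) :
    ∃ C : ℝ≥0, ∀ u : RN N → ℝ, Measurable u → ∃ G : RN N → ℝ, Measurable G ∧
      (∀ x ∈ Ωᶜ, G x = u x) ∧ sobolevSq s univ G ≤ C * sobolevSq s Ωᶜ u := by
  obtain ⟨L, χ, U, hU, hSU, hχL, hχ, hχ1, C1, hC1⟩ := extendsNear_frontier hN hs0 hs1 hΩ hb hL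
  have hΩm : MeasurableSet Ωᶜ := hΩ.measurableSet.compl
  have hχm : Measurable χ := hχL.continuous.measurable
  have hχ' : ∀ x, 1 - χ x ∈ Icc (0 : ℝ) 1 := fun x =>
    ⟨by linarith [(hχ x).2], by linarith [(hχ x).1]⟩
  -- The remainder `(1 - χ) u` lives on `Ωᶜ \ U`, a closed set disjoint from the compact closure of
  -- `Ω`. The resulting positive distance `δ` permits extension by zero.
  have hdisj : Disjoint (closure Ω) (Ωᶜ \ U) := by
    rw [disjoint_left]
    intro x hx hx'
    refine hx'.2 (hSU ?_)
    rw [hΩ.frontier_eq]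
    exact ⟨hx, hx'.1⟩
  obtain ⟨δ, hδ, hsep⟩ := hdisj.exists_thickenings hb.isCompact_closure
    (hΩ.isClosed_compl.sdiff hU)
  obtain ⟨C2, hC2⟩ := exists_sobolevSq_mul_le hN hs0 hs1 (lipschitzWith_one_sub hχL) hχ'
  obtain ⟨C3, hC3⟩ := exists_sobolevSq_zeroExt_le hN hs0 hs1 hδ
  refine ⟨2 * C1 + 2 * (C3 * C2), fun u hu => ?_⟩
  obtain ⟨G, hG, hG1, hG2⟩ := hC1 u hu
  set w : RN N → ℝ := Ωᶜ.indicator fun x => (1 - χ x) * u x with hw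
  have hwm : Measurable w := Measurable.indicator (by fun_prop) hΩm
  refine ⟨fun x => G x + w x, hG.add hwm, fun x hx => ?_, ?_⟩
  · beta_reduce
    rw [hG1 x hx, hw, indicator_of_mem hx]; ring
  · refine (sobolevSq_add_le hG hwm).trans ?_
    have h3 : sobolevSq s univ w ≤ C3 * sobolevSq s Ωᶜ w := by
      refine hC3 Ωᶜ univ hΩm MeasurableSet.univ (subset_univ _) w hwm
        (fun x hx => indicator_of_notMem hx _) ?_
      intro x hx hne y hy
      have hxU : x ∉ U := by
        intro hxU
        apply hne
        rw [hw, indicator_of_mem hx, hχ1 x hxU]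
        ring
      have hyΩ : y ∈ Ω := by simpa using hy.2
      by_contra hcon
      refine disjoint_left.1 hsep (Metric.self_subset_thickening hδ _ (subset_closure hyΩ)) ?_
      rw [Metric.mem_thickening_iff]
      refine ⟨x, ⟨hx, hxU⟩, ?_⟩
      rw [dist_comm, dist_eq_norm]
      exact not_le.1 hcon
    have h4 : sobolevSq s Ωᶜ w ≤ C2 * sobolevSq s Ωᶜ u := by
      rw [sobolevSq_congr hΩm (v := fun x => (1 - χ x) * u x) fun x hx => indicator_of_mem hx _]
      exact hC2 _ hΩm u hu
    calc _ ≤ 2 * (C1 * sobolevSq s Ωᶜ u) + 2 * (C3 * (C2 * sobolevSq s Ωᶜ u)) := by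
          gcongr
          refine h3.trans ?_
          gcongr
      _ = _ := by push_cast; ring

end

end MGT

/-! ### Gronwall, the abstract energy estimate, Lax–Milgram and linear ODEs -/

namespace MGT

noncomputable section

/-- A form of Gronwall's inequality. -/
theorem le_of_deriv_le_Icc {E E' : ℝ → ℝ} {K m T : ℝ} (hK : 0 ≤ K) (hm : 0 ≤ m)
    (hEc : ContinuousOn E (Icc 0 T)) (hEd : ∀ t ∈ Ioo 0 T, HasDerivAt E (E' t) t)
    (hEd' : ∀ t ∈ Ioo 0 T, E' t ≤ K * E t + m) (hE0 : E 0 = 0) :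
    ∀ t ∈ Icc 0 T, E t ≤ m * T * Real.exp (K * T) := by
  intro t ht
  have hanti : AntitoneOn (fun t => Real.exp (-K * t) * E t - m * t) (Icc 0 T) := by
    have hder : ∀ t ∈ Ioo 0 T, HasDerivAt (fun t => Real.exp (-K * t) * E t - m * t)
        (Real.exp (-K * t) * (-K) * E t + Real.exp (-K * t) * E' t - m) t := by
      intro t ht
      have e1 : HasDerivAt (fun t => Real.exp (-K * t)) (Real.exp (-K * t) * (-K)) t := by
        simpa using ((hasDerivAt_id t).const_mul (-K)).exp
      have e2 : HasDerivAt (fun t => m * t) m t := by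
        simpa using (hasDerivAt_id t).const_mul m
      exact (e1.mul (hEd t ht)).sub e2
    refine antitoneOn_of_deriv_nonpos (convex_Icc 0 T) ?_ ?_ ?_
    · exact (ContinuousOn.mul (by fun_prop) hEc).sub (by fun_prop)
    · rw [interior_Icc]
      exact fun t ht => (hder t ht).differentiableAt.differentiableWithinAt
    · rw [interior_Icc]
      intro t ht
      rw [(hder t ht).deriv]
      have h2 : Real.exp (-K * t) ≤ 1 := by
        rw [Real.exp_le_one_iff]; nlinarith [ht.1]
      have h3 := Real.exp_pos (-K * t)
      have h4 := mul_le_mul_of_nonneg_left (hEd' t ht) h3.le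
      have h5 : Real.exp (-K * t) * m ≤ m := by nlinarith
      linarith
  have hT : 0 ≤ T := ht.1.trans ht.2
  have h := hanti ⟨le_rfl, hT⟩ ht ht.1
  simp only [hE0, mul_zero, sub_zero] at h
  have h6 : Real.exp (-K * t) * E t ≤ m * t := by linarith
  have h7 : E t ≤ m * t * Real.exp (K * t) := by
    have := mul_le_mul_of_nonneg_right h6 (Real.exp_pos (K * t)).le
    have hone : Real.exp (-K * t) * Real.exp (K * t) = 1 := by rw [← Real.exp_add]; simp
    calc E t = Real.exp (-K * t) * E t * Real.exp (K * t) := by linear_combination (-E t) * hone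
      _ ≤ _ := this
  have h8 : m * t * Real.exp (K * t) ≤ m * T * Real.exp (K * T) := by
    have := ht.2
    have := ht.1
    gcongr
  exact h7.trans h8

section Abstract

variable {V : Type*} [NormedAddCommGroup V] [InnerProductSpace ℝ V]

local notation "⟪" x ", " y "⟫" => inner ℝ x y

theorem inner_le_half_of_nonneg {B : V →L[ℝ] V} (hsym : ∀ x y, ⟪B x, y⟫ = ⟪x, B y⟫)
    (hpos : ∀ x, 0 ≤ ⟪B x, x⟫) (x y : V) : ⟪B x, y⟫ ≤ (⟪B x, x⟫ + ⟪B y, y⟫) / 2 := by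
  have h := hpos (x - y)
  rw [map_sub, inner_sub_left, inner_sub_right, inner_sub_right] at h
  have h2 : ⟪B y, x⟫ = ⟪B x, y⟫ := by rw [hsym y x, real_inner_comm]
  linarith

theorem neg_inner_le_half_of_nonneg {B : V →L[ℝ] V} (hsym : ∀ x y, ⟪B x, y⟫ = ⟪x, B y⟫)
    (hpos : ∀ x, 0 ≤ ⟪B x, x⟫) (x y : V) : -⟪B x, y⟫ ≤ (⟪B x, x⟫ + ⟪B y, y⟫) / 2 := by
  have h := inner_le_half_of_nonneg hsym hpos x (-y)
  simpa [inner_neg_right] using h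

/-- The growth rate in the energy estimate. -/
def energyRate (α b c β δ : ℝ) : ℝ :=
  let σ := c ^ 2 / b
  let γ := α - σ
  (1 + γ * σ + γ * σ ^ 2) + (1 + γ * σ * β) / (b * δ) + (1 + γ * σ ^ 2 * β)

set_option maxHeartbeats 800000 in
/-- The energy estimate for `B (w''' + α w'') + A (c² w + b w') = F`. -/
theorem energy_estimate {A B : V →L[ℝ] V} (hBsym : ∀ x y, ⟪B x, y⟫ = ⟪x, B y⟫)
    (hBpos : ∀ x, 0 ≤ ⟪B x, x⟫) {β : ℝ} (hβ : ∀ x, ⟪B x, x⟫ ≤ β * ‖x‖ ^ 2)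
    (hAsym : ∀ x y, ⟪A x, y⟫ = ⟪x, A y⟫) {δ : ℝ} (hδ : 0 < δ)
    (hA : ∀ x, δ * ‖x‖ ^ 2 ≤ ⟪A x, x⟫) {α b c : ℝ} (hb : 0 < b) (hγ : 0 < α - c ^ 2 / b)
    (hβ0 : 0 ≤ β) {T M : ℝ} {w0 w1 w2 w3 F : ℝ → V}
    (hc0 : ContinuousOn w0 (Icc 0 T)) (hc1 : ContinuousOn w1 (Icc 0 T))
    (hc2 : ContinuousOn w2 (Icc 0 T))
    (hd0 : ∀ t ∈ Ioo 0 T, HasDerivAt w0 (w1 t) t) (hd1 : ∀ t ∈ Ioo 0 T, HasDerivAt w1 (w2 t) t)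
    (hd2 : ∀ t ∈ Ioo 0 T, HasDerivAt w2 (w3 t) t)
    (heq : ∀ t ∈ Ioo 0 T, B (w3 t + α • w2 t) + A (c ^ 2 • w0 t + b • w1 t) = F t)
    (hF : ∀ t ∈ Ioo 0 T, ⟪F t, w2 t + (c ^ 2 / b) • w1 t⟫ ≤
      ⟪B (w2 t + (c ^ 2 / b) • w1 t), w2 t + (c ^ 2 / b) • w1 t⟫ / 2 + M ^ 2 / 2)
    (h0 : w0 0 = 0) (h1 : w1 0 = 0) (h2 : w2 0 = 0) :
    ∀ t ∈ Icc 0 T, ‖w0 t‖ ^ 2 ≤ M ^ 2 * T * Real.exp (energyRate α b c β δ * T) := by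
  set σ := c ^ 2 / b with hσ
  set γ := α - σ with hγdef
  have hσ0 : 0 ≤ σ := by positivity
  have hσb : c ^ 2 = b * σ := by rw [hσ]; field_simp
  set K := energyRate α b c β δ with hK
  have hKdef : K = (1 + γ * σ + γ * σ ^ 2) + (1 + γ * σ * β) / (b * δ) + (1 + γ * σ ^ 2 * β) := rfl
  have hK0 : 0 ≤ K := by rw [hKdef]; positivity
  -- With this `p` and `q = p'`, the elliptic part of the equation is exactly `b • A p`, whose
  -- pairing with `q` is a time derivative.
  set p : ℝ → V := fun t => w1 t + σ • w0 t with hp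
  set q : ℝ → V := fun t => w2 t + σ • w1 t with hq
  -- The term `‖w0‖² / 2` is added because `p` and `q` alone do not bound `w0` pointwise; it obeys
  -- `w0' = p - σ w0`.
  set E : ℝ → ℝ := fun t => ⟪B (q t), q t⟫ / 2 + b / 2 * ⟪A (p t), p t⟫ + ⟪w0 t, w0 t⟫ / 2 with hE
  have hpc : ContinuousOn p (Icc 0 T) := hc1.add (hc0.const_smul σ)
  have hqc : ContinuousOn q (Icc 0 T) := hc2.add (hc1.const_smul σ)
  have hEc : ContinuousOn E (Icc 0 T) := by
    refine ContinuousOn.add (ContinuousOn.add ?_ ?_) ?_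
    · exact ((B.continuous.comp_continuousOn hqc).inner hqc).div_const 2
    · exact continuousOn_const.mul ((A.continuous.comp_continuousOn hpc).inner hpc)
    · exact (hc0.inner hc0).div_const 2
  have hEd : ∀ t ∈ Ioo 0 T, HasDerivAt E (⟪B (w3 t + σ • w2 t), q t⟫ + b * ⟪A (p t), q t⟫
      + ⟪w0 t, w1 t⟫) t := by
    intro t ht
    have hpd : HasDerivAt p (q t) t := (hd1 t ht).add ((hd0 t ht).const_smul σ)
    have hqd : HasDerivAt q (w3 t + σ • w2 t) t := (hd2 t ht).add ((hd1 t ht).const_smul σ)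
    have e1 := ((B.hasFDerivAt.comp_hasDerivAt t hqd).inner ℝ hqd).div_const 2
    have e2 := ((A.hasFDerivAt.comp_hasDerivAt t hpd).inner ℝ hpd).const_mul (b / 2)
    have e3 := ((hd0 t ht).inner ℝ (hd0 t ht)).div_const 2
    refine ((e1.add e2).add e3).congr_deriv ?_
    have s1 : ⟪B (q t), w3 t + σ • w2 t⟫ = ⟪B (w3 t + σ • w2 t), q t⟫ := by
      rw [hBsym, real_inner_comm]
    have s2 : ⟪A (q t), p t⟫ = ⟪A (p t), q t⟫ := by rw [hAsym, real_inner_comm]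
    have s3 : ⟪w1 t, w0 t⟫ = ⟪w0 t, w1 t⟫ := real_inner_comm _ _
    simp only [Function.comp]
    rw [s1, s2, s3]
    ring
  have hEd' : ∀ t ∈ Ioo 0 T, ⟪B (w3 t + σ • w2 t), q t⟫ + b * ⟪A (p t), q t⟫ + ⟪w0 t, w1 t⟫
      ≤ K * E t + M ^ 2 / 2 := by
    intro t ht
    have hw1 : w1 t = p t - σ • w0 t := by simp [hp]
    have hw2 : w2 t = q t - σ • p t + σ ^ 2 • w0 t := by
      simp only [hp, hq]; module
    -- The equation in terms of `p` and `q`, obtained from `w2 = q - σ p + σ² w0`.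
    have hsplit : B (w3 t + σ • w2 t) = F t - γ • B (q t) + (γ * σ) • B (p t)
        - (γ * σ ^ 2) • B (w0 t) - b • A (p t) := by
      rw [← heq t ht, ← map_smul, ← map_smul, ← map_smul, ← map_smul]
      have e1 : c ^ 2 • w0 t + b • w1 t = b • p t := by
        simp only [hp, hσb]; module
      rw [e1]
      have e2 : w3 t + σ • w2 t = (w3 t + α • w2 t) - γ • q t + (γ * σ) • p t
          - (γ * σ ^ 2) • w0 t := by
        have : σ • w2 t = α • w2 t - γ • w2 t := by rw [← sub_smul]; congr 1; simp [hγdef]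
        rw [this]
        rw [show γ • w2 t = γ • (q t - σ • p t + σ ^ 2 • w0 t) by rw [← hw2]]
        module
      rw [e2]
      simp only [map_sub, map_add, map_smul]
      module
    rw [hsplit, hw1]
    simp only [inner_sub_left, inner_add_left, inner_sub_right, real_inner_smul_left,
      real_inner_smul_right]
    have f1 := hF t ht
    have f2 := inner_le_half_of_nonneg hBsym hBpos (p t) (q t)
    have f3 := neg_inner_le_half_of_nonneg hBsym hBpos (w0 t) (q t)
    have f4 := hβ (p t)
    have f5 := hβ (w0 t)
    have f6 := hA (p t)
    have f7 := hBpos (q t)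
    have f8 : ⟪w0 t, p t⟫ ≤ (‖w0 t‖ ^ 2 + ‖p t‖ ^ 2) / 2 := by
      have := real_inner_le_norm (w0 t) (p t)
      nlinarith [sq_nonneg (‖w0 t‖ - ‖p t‖)]
    have f9 : (⟪w0 t, w0 t⟫ : ℝ) = ‖w0 t‖ ^ 2 := real_inner_self_eq_norm_sq _
    simp only [hE]
    rw [f9]
    change ⟪F t, q t⟫ ≤ ⟪B (q t), q t⟫ / 2 + M ^ 2 / 2 at f1
    set X := (⟪B (q t), q t⟫ : ℝ)
    set Y := (⟪A (p t), p t⟫ : ℝ)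
    set Z := ‖w0 t‖ ^ 2
    set P := ‖p t‖ ^ 2
    have hP0 : 0 ≤ P := by positivity
    have hZ0 : 0 ≤ Z := by positivity
    have hY0 : 0 ≤ Y := le_trans (by positivity) f6
    have g2 : γ * σ * ⟪B (p t), q t⟫ ≤ γ * σ * ((β * P + X) / 2) := by
      gcongr; linarith
    have g3 : -(γ * σ ^ 2 * ⟪B (w0 t), q t⟫) ≤ γ * σ ^ 2 * ((β * Z + X) / 2) := by
      rw [← mul_neg]; gcongr; linarith
    -- This is the damping term; it enters the energy balance with a favourable sign and is dropped.
    have g4 : 0 ≤ γ * X := by positivity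
    have g5 : 0 ≤ σ * Z := by positivity
    have g6 : (1 + γ * σ * β) * P ≤ (1 + γ * σ * β) / (b * δ) * (b * Y) := by
      have : P ≤ Y / δ := by rw [le_div_iff₀ hδ]; linarith
      calc _ ≤ (1 + γ * σ * β) * (Y / δ) := by gcongr
        _ = _ := by field_simp
    have g7 : (1 + γ * σ + γ * σ ^ 2) * X ≤ K * X := by
      gcongr
      rw [hKdef]
      have : 0 ≤ (1 + γ * σ * β) / (b * δ) := by positivity
      have : 0 ≤ (1 + γ * σ ^ 2 * β) := by positivity
      linarith
    have g8 : (1 + γ * σ * β) / (b * δ) * (b * Y) ≤ K * (b * Y) := by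
      gcongr
      rw [hKdef]
      have : 0 ≤ 1 + γ * σ + γ * σ ^ 2 := by positivity
      have : 0 ≤ (1 + γ * σ ^ 2 * β) := by positivity
      linarith
    have g9 : (1 + γ * σ ^ 2 * β) * Z ≤ K * Z := by
      gcongr
      rw [hKdef]
      have : 0 ≤ (1 + γ * σ * β) / (b * δ) := by positivity
      have : 0 ≤ 1 + γ * σ + γ * σ ^ 2 := by positivity
      linarith
    linarith
  intro t ht
  have hE0 : E 0 = 0 := by simp [hE, hp, hq, h0, h1, h2]
  have h8 := le_of_deriv_le_Icc hK0 (by positivity : 0 ≤ M ^ 2 / 2) hEc hEd hEd' hE0 t ht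
  have hEt : ‖w0 t‖ ^ 2 / 2 ≤ E t := by
    have f6 := hA (p t)
    have f7 := hBpos (q t)
    have : 0 ≤ ⟪A (p t), p t⟫ := le_trans (by positivity) f6
    simp only [hE, real_inner_self_eq_norm_sq]
    have : 0 ≤ b / 2 * ⟪A (p t), p t⟫ := by positivity
    linarith
  linarith

/-- Lax–Milgram for the bilinear form `⟪S x, y⟫`. -/
theorem exists_inverse_of_coercive [CompleteSpace V] {S : V →L[ℝ] V} {δ : ℝ} (hδ : 0 < δ)
    (hS : ∀ x, δ * ‖x‖ ^ 2 ≤ ⟪S x, x⟫) :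
    ∃ R : V →L[ℝ] V, (∀ x, S (R x) = x) ∧ ∀ x, R (S x) = x := by
  have hco : IsCoercive ((innerSL ℝ).comp S : V →L[ℝ] V →L[ℝ] ℝ) :=
    ⟨δ, hδ, fun u => by
      have := hS u
      rw [mul_assoc, ← sq]
      exact this⟩
  have hS' : ∀ x, hco.continuousLinearEquivOfBilin x = S x := fun x =>
    ext_inner_right ℝ fun y => by
      rw [IsCoercive.continuousLinearEquivOfBilin_apply]
      rfl
  refine ⟨hco.continuousLinearEquivOfBilin.symm, fun x => ?_, fun x => ?_⟩
  · rw [← hS']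
    exact hco.continuousLinearEquivOfBilin.apply_symm_apply x
  · rw [← hS']
    exact hco.continuousLinearEquivOfBilin.symm_apply_apply x

end Abstract

section LinearODE

variable {Y : Type*} [NormedAddCommGroup Y] [NormedSpace ℝ Y]

/-- The solution of `y' = M y + G`, `y(0) = 0`. -/
def linSol (M : Y →L[ℝ] Y) (G : ℝ → Y) (t : ℝ) : Y :=
  NormedSpace.exp (t • M) (∫ τ in (0 : ℝ)..t, NormedSpace.exp (τ • (-M)) (G τ))

theorem hasDerivAt_linSol [CompleteSpace Y] (M : Y →L[ℝ] Y) {G : ℝ → Y} (hG : Continuous G) (t : ℝ) :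
    HasDerivAt (linSol M G) (M (linSol M G t) + G t) t := by
  have hc : Continuous fun τ : ℝ => NormedSpace.exp (τ • (-M)) (G τ) := by
    have : Continuous fun τ : ℝ => NormedSpace.exp (τ • (-M)) :=
      continuous_iff_continuousAt.2 fun τ => (hasDerivAt_exp_smul_const (-M) τ).continuousAt
    exact this.clm_apply hG
  have h1 := hasDerivAt_exp_smul_const' (𝕂 := ℝ) M t
  have h2 := intervalIntegral.integral_hasDerivAt_right (hc.intervalIntegrable 0 t)
    (hc.stronglyMeasurableAtFilter _ _) hc.continuousAt
  refine (h1.clm_apply h2).congr_deriv ?_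
  have hinv : NormedSpace.exp (t • M) * NormedSpace.exp (t • (-M)) = 1 := by
    let _ : NormedAlgebra ℚ (Y →L[ℝ] Y) := NormedAlgebra.restrictScalars ℚ ℝ _
    rw [smul_neg, ← NormedSpace.exp_add_of_commute (Commute.neg_right (Commute.refl _)), add_neg_cancel,
      NormedSpace.exp_zero]
  have h3 : NormedSpace.exp (t • M) (NormedSpace.exp (t • (-M)) (G t)) = G t := by
    rw [← mul_apply_eq_comp, hinv]; rfl
  rw [h3]
  rfl

theorem linSol_of_nonpos (M : Y →L[ℝ] Y) {G : ℝ → Y} (hG : ∀ t ≤ 0, G t = 0) {t : ℝ}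
    (ht : t ≤ 0) : linSol M G t = 0 := by
  unfold linSol
  have : ∫ τ in (0 : ℝ)..t, NormedSpace.exp (τ • (-M)) (G τ) = ∫ τ in (0 : ℝ)..t, (0 : Y) := by
    refine intervalIntegral.integral_congr fun τ hτ => ?_
    rw [uIcc_of_ge ht] at hτ
    simp only [hG τ hτ.2, map_zero]
  rw [this]
  simp

/-- Because `G 0 = 0`, both `M y + G` (with `y` the solution for `G`) and the solution for `G'`
solve the same initial value problem. Hence differentiating the solution amounts to differentiating
the source. -/
theorem hasDerivAt_linSol_deriv [CompleteSpace Y] (M : Y →L[ℝ] Y) {G G' : ℝ → Y} (hG : ∀ t, HasDerivAt G (G' t) t)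
    (hG' : Continuous G') (h0 : G 0 = 0) (t : ℝ) :
    HasDerivAt (linSol M G) (linSol M G' t) t := by
  have hGc : Continuous G := continuous_iff_continuousAt.2 fun t => (hG t).continuousAt
  have key : (fun t => M (linSol M G t) + G t) = linSol M G' := by
    refine ODE_solution_unique_univ (v := fun t y => M y + G' t) (s := fun _ => univ) (K := ‖M‖₊)
      (t₀ := 0) (fun t => ?_) (fun t => ⟨?_, mem_univ _⟩)
      (fun t => ⟨hasDerivAt_linSol M hG' t, mem_univ _⟩) ?_
    · refine LipschitzWith.lipschitzOnWith ?_
      simpa using M.lipschitz.add (LipschitzWith.const (G' t))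
    · exact (M.hasFDerivAt.comp_hasDerivAt t (hasDerivAt_linSol M hGc t)).add (hG t)
    · simp [linSol, h0]
  rw [← key]
  exact hasDerivAt_linSol M hGc t

end LinearODE

end

end MGT

/-! ### The solution operator with homogeneous exterior data -/

namespace MGT

noncomputable section

section Existence

variable {V H : Type*} [NormedAddCommGroup V] [InnerProductSpace ℝ V]
  [NormedAddCommGroup H] [InnerProductSpace ℝ H]

local notation "⟪" x ", " y "⟫" => inner ℝ x y

/-- Smooth functions of time which vanish up to time `0`. -/
structure IsForcing {X : Type*} [NormedAddCommGroup X] [NormedSpace ℝ X] (f : ℝ → X) : Prop where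
  smooth : ContDiff ℝ ∞ f
  zero : ∀ t ≤ 0, f t = 0

/-- For negative times the derivative vanishes by locality, and at time `0` by its continuity. -/
theorem IsForcing.deriv {X : Type*} [NormedAddCommGroup X] [NormedSpace ℝ X] {f : ℝ → X}
    (hf : IsForcing f) : IsForcing (_root_.deriv f) := by
  have hs := (contDiff_infty_iff_deriv.1 hf.smooth).2
  refine ⟨hs, fun t ht => ?_⟩
  have h1 : Iio (0 : ℝ) ⊆ {t | _root_.deriv f t = 0} := by
    intro t ht
    have : f =ᶠ[𝓝 t] fun _ => 0 := by
      filter_upwards [Iio_mem_nhds (show t < 0 from ht)] with τ hτ using hf.zero τ (le_of_lt hτ)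
    change _root_.deriv f t = 0
    rw [this.deriv_eq, deriv_const]
  have h2 : closure (Iio (0 : ℝ)) ⊆ {t | _root_.deriv f t = 0} :=
    closure_minimal h1 (isClosed_eq hs.continuous continuous_const)
  rw [closure_Iio] at h2
  exact h2 ht

theorem IsForcing.hasDerivAt {X : Type*} [NormedAddCommGroup X] [NormedSpace ℝ X] {f : ℝ → X}
    (hf : IsForcing f) (t : ℝ) : HasDerivAt f (_root_.deriv f t) t :=
  ((contDiff_infty_iff_deriv.1 hf.smooth).1 t).hasDerivAt

/-- `W` is the solution operator of `B (w''' + α w'') + A (c² w + b w') = P f`, for vanishing data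
up to time `0`. -/
structure IsSolutionOperator (A B : V →L[ℝ] V) (P : H →L[ℝ] V) (α b c : ℝ)
    (W : (ℝ → H) → ℝ → V) : Prop where
  zero : ∀ f, IsForcing f → ∀ t ≤ 0, W f t = 0
  hasDerivAt : ∀ f, IsForcing f → ∀ t, HasDerivAt (W f) (W (deriv f) t) t
  equation : ∀ f, IsForcing f → ∀ t,
    B (W (deriv (deriv (deriv f))) t + α • W (deriv (deriv f)) t)
      + A (c ^ 2 • W f t + b • W (deriv f) t) = P (f t)

/-- When `B` is invertible, the equation is a linear first order ODE with bounded generator for the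
triple `(w, w', w'')`. -/
theorem exists_isSolutionOperator_of_coercive [CompleteSpace V] {A B : V →L[ℝ] V} {P : H →L[ℝ] V}
    {α b c ε : ℝ} (hε : 0 < ε) (hB : ∀ x, ε * ‖x‖ ^ 2 ≤ ⟪B x, x⟫) :
    ∃ W, IsSolutionOperator A B P α b c W := by
  obtain ⟨R, hR, -⟩ := exists_inverse_of_coercive hε hB
  set π0 : V × V × V →L[ℝ] V := ContinuousLinearMap.fst ℝ V (V × V)
  set π1 : V × V × V →L[ℝ] V :=
    (ContinuousLinearMap.fst ℝ V V).comp (ContinuousLinearMap.snd ℝ V (V × V))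
  set π2 : V × V × V →L[ℝ] V :=
    (ContinuousLinearMap.snd ℝ V V).comp (ContinuousLinearMap.snd ℝ V (V × V))
  set M : V × V × V →L[ℝ] V × V × V := π1.prod (π2.prod
    (-(α • π2) - (R.comp A).comp (c ^ 2 • π0 + b • π1))) with hM
  set G : (ℝ → H) → ℝ → V × V × V := fun f t => (0, 0, R (P (f t))) with hG
  set Y : (ℝ → H) → ℝ → V × V × V := fun f => linSol M (G f) with hY
  have hGd : ∀ f, IsForcing f → ∀ t, HasDerivAt (G f) (G (deriv f) t) t := fun f hf t =>
    (hasDerivAt_const t (0 : V)).prodMk ((hasDerivAt_const t (0 : V)).prodMk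
      ((R.comp P).hasFDerivAt.comp_hasDerivAt t (hf.hasDerivAt t)))
  have hGc : ∀ f, IsForcing f → Continuous (G f) := fun f hf =>
    continuous_iff_continuousAt.2 fun t => (hGd f hf t).continuousAt
  have hG0 : ∀ f, IsForcing f → ∀ t ≤ 0, G f t = 0 := fun f hf t ht => by
    simp [hG, hf.zero t ht]
  have hd : ∀ f, IsForcing f → ∀ t, HasDerivAt (Y f) (Y (deriv f) t) t := fun f hf t =>
    hasDerivAt_linSol_deriv M (hGd f hf) (hGc _ hf.deriv) (hG0 f hf 0 le_rfl) t
  have hrec : ∀ f, IsForcing f → ∀ t, Y (deriv f) t = M (Y f t) + G f t := fun f hf t =>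
    (hd f hf t).unique (hasDerivAt_linSol M (hGc f hf) t)
  have r0 : ∀ f, IsForcing f → ∀ t, (Y (deriv f) t).1 = (Y f t).2.1 := fun f hf t => by
    rw [hrec f hf t]; simp [hM, hG, π1]
  have r1 : ∀ f, IsForcing f → ∀ t, (Y (deriv f) t).2.1 = (Y f t).2.2 := fun f hf t => by
    rw [hrec f hf t]; simp [hM, hG, π2]
  have r2 : ∀ f, IsForcing f → ∀ t, (Y (deriv f) t).2.2 = -(α • (Y f t).2.2)
      - R (A (c ^ 2 • (Y f t).1 + b • (Y f t).2.1)) + R (P (f t)) := fun f hf t => by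
    rw [hrec f hf t]; simp [hM, hG, π0, π1, π2]
  refine ⟨fun f t => (Y f t).1, fun f hf t ht => ?_, fun f hf t => ?_, fun f hf t => ?_⟩
  · simp only [hY, linSol_of_nonpos M (hG0 f hf) ht, Prod.fst_zero]
  · exact π0.hasFDerivAt.comp_hasDerivAt t (hd f hf t)
  · rw [r0 _ hf.deriv.deriv, r1 _ hf.deriv, r2 _ hf, r0 _ hf.deriv, r1 _ hf, r0 _ hf]
    have : -(α • (Y f t).2.2) - R (A (c ^ 2 • (Y f t).1 + b • (Y f t).2.1)) + R (P (f t))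
        + α • (Y f t).2.2 = R (P (f t) - A (c ^ 2 • (Y f t).1 + b • (Y f t).2.1)) := by
      rw [map_sub]; abel
    rw [this, hR]
    abel

variable [CompleteSpace V] [CompleteSpace H]

/-- `J*J` need not be invertible, so it is replaced by the coercive `J*J + ε`. The energy estimate
is uniform in `ε ≤ 1`, and applied to differences it gives a Cauchy property with rate `√ε`. Each
regularized operator commutes with `d/dt`, so derivatives converge in the same way and the equation
passes to the limit. -/
theorem exists_isSolutionOperator {A : V →L[ℝ] V} (J : V →L[ℝ] H)
    (hAsym : ∀ x y, ⟪A x, y⟫ = ⟪x, A y⟫) {δ : ℝ} (hδ : 0 < δ)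
    (hA : ∀ x, δ * ‖x‖ ^ 2 ≤ ⟪A x, x⟫) {α b c : ℝ} (hb : 0 < b) (hγ : 0 < α - c ^ 2 / b) :
    ∃ W, IsSolutionOperator A (J.adjoint.comp J) J.adjoint α b c W ∧
      ∀ T : ℝ, 0 < T → ∃ C : ℝ, 0 ≤ C ∧ ∀ f, IsForcing f → ∀ M, (∀ τ ∈ Icc 0 T, ‖f τ‖ ≤ M) →
        ∀ t ∈ Icc 0 T, ‖W f t‖ ≤ C * M := by
  set B : ℝ → V →L[ℝ] V := fun ε => J.adjoint.comp J + ε • ContinuousLinearMap.id ℝ V with hB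
  have hBapp : ∀ ε x y, ⟪B ε x, y⟫ = ⟪J x, J y⟫ + ε * ⟪x, y⟫ := by
    intro ε x y
    simp [hB, inner_add_left, ContinuousLinearMap.adjoint_inner_left, real_inner_smul_left]
  have hBself : ∀ ε x, ⟪B ε x, x⟫ = ‖J x‖ ^ 2 + ε * ‖x‖ ^ 2 := by
    intro ε x
    rw [hBapp, real_inner_self_eq_norm_sq, real_inner_self_eq_norm_sq]
  have hBsym : ∀ ε x y, ⟪B ε x, y⟫ = ⟪x, B ε y⟫ := by
    intro ε x y
    rw [real_inner_comm (B ε y), hBapp, hBapp, real_inner_comm (J x), real_inner_comm x]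
  -- The summand `1` covers all `ε ≤ 1`, so the growth rate does not depend on `ε`.
  set β : ℝ := ‖J‖ ^ 2 + 1 with hβdef
  have hBβ : ∀ ε ≤ 1, ∀ x, ⟪B ε x, x⟫ ≤ β * ‖x‖ ^ 2 := by
    intro ε hε x
    rw [hBself, hβdef, add_mul, ← mul_pow]
    gcongr
    exact J.le_opNorm x
  set e : ℕ → ℝ := fun n => 1 / ((n : ℝ) + 1) with he
  have he0 : ∀ n, 0 < e n := fun n => Nat.one_div_pos_of_nat
  have he1 : ∀ n, e n ≤ 1 := fun n => by
    rw [he]; exact div_le_one_of_le₀ (by linarith [n.cast_nonneg (α := ℝ)]) (by positivity)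
  have hemono : ∀ m n, m ≤ n → e n ≤ e m := fun m n h => one_div_le_one_div_of_le (by positivity)
    (by exact_mod_cast Nat.add_le_add_right h 1)
  have hex : ∀ n, ∃ W, IsSolutionOperator A (B (e n)) J.adjoint α b c W := fun n =>
    exists_isSolutionOperator_of_coercive (he0 n) fun x => by
      rw [hBself]; nlinarith [sq_nonneg ‖J x‖]
  choose W hW using hex
  have hWc : ∀ n f, IsForcing f → Continuous (W n f) := fun n f hf =>
    continuous_iff_continuousAt.2 fun t => ((hW n).hasDerivAt f hf t).continuousAt
  have hBpos : ∀ n x, 0 ≤ ⟪B (e n) x, x⟫ := fun n x => by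
    rw [hBself]; have := (he0 n).le; positivity
  set rate := energyRate α b c β δ
  have hest : ∀ n f, IsForcing f → ∀ T M, (∀ τ ∈ Icc 0 T, ‖f τ‖ ≤ M) →
      ∀ t ∈ Icc 0 T, ‖W n f t‖ ^ 2 ≤ M ^ 2 * T * Real.exp (rate * T) := by
    intro n f hf T M hM
    refine energy_estimate (hBsym (e n)) (hBpos n) (hBβ _ (he1 n)) hAsym hδ hA hb hγ
      (by positivity) (w1 := W n (deriv f)) (w2 := W n (deriv (deriv f)))
      (w3 := W n (deriv (deriv (deriv f)))) (F := fun t => J.adjoint (f t))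
      (hWc n _ hf).continuousOn (hWc n _ hf.deriv).continuousOn
      (hWc n _ hf.deriv.deriv).continuousOn
      (fun t _ => (hW n).hasDerivAt f hf t) (fun t _ => (hW n).hasDerivAt _ hf.deriv t)
      (fun t _ => (hW n).hasDerivAt _ hf.deriv.deriv t) (fun t _ => (hW n).equation f hf t)
      (fun t ht => ?_) ((hW n).zero _ hf 0 le_rfl) ((hW n).zero _ hf.deriv 0 le_rfl)
      ((hW n).zero _ hf.deriv.deriv 0 le_rfl)
    rw [ContinuousLinearMap.adjoint_inner_left, hBself]
    set x := W n (deriv (deriv f)) t + (c ^ 2 / b) • W n (deriv f) t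
    have h1 := real_inner_le_norm (f t) (J x)
    have h2 : ‖f t‖ ^ 2 ≤ M ^ 2 := by
      have := hM t (Ioo_subset_Icc_self ht); gcongr
    have h3 : 0 ≤ e n * ‖x‖ ^ 2 := by have := (he0 n).le; positivity
    nlinarith [sq_nonneg (‖f t‖ - ‖J x‖)]
  have hbdd : ∀ f, IsForcing f → ∀ T, ∃ D, ∀ n, ∀ t ∈ Icc 0 T, ‖W n f t‖ ≤ D := by
    intro f hf T
    obtain ⟨M, hM⟩ := isCompact_Icc.exists_bound_of_continuousOn (s := Icc 0 T)
      hf.smooth.continuous.continuousOn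
    exact ⟨_, fun n t ht => Real.le_sqrt_of_sq_le (hest n f hf T M hM t ht)⟩
  have hdiff : ∀ f, IsForcing f → ∀ T, ∃ D, ∀ m n, m ≤ n → ∀ t ∈ Icc 0 T,
      ‖W m f t - W n f t‖ ^ 2 ≤ e m * D := by
    intro f hf T
    obtain ⟨D2, hD2⟩ := hbdd _ hf.deriv.deriv T
    obtain ⟨D3, hD3⟩ := hbdd _ hf.deriv.deriv.deriv T
    refine ⟨(D3 + |α| * D2) ^ 2 * T * Real.exp (rate * T), fun m n hmn t ht => ?_⟩
    -- The difference of two regularized solutions solves the equation for `B (e m)` with source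
    -- `-(e m - e n) • h`. The bounds on `W n f'''` and `W n f''` make `h` bounded uniformly in `n`.
    set h : ℝ → V := fun t => W n (deriv (deriv (deriv f))) t + α • W n (deriv (deriv f)) t
    have hh : ∀ t ∈ Icc 0 T, ‖h t‖ ≤ D3 + |α| * D2 := by
      intro t ht
      refine (norm_add_le _ _).trans ?_
      rw [norm_smul, Real.norm_eq_abs]
      gcongr
      · exact hD3 n t ht
      · exact hD2 n t ht
    have hmn' := hemono m n hmn
    have key := energy_estimate (hBsym (e m)) (hBpos m) (hBβ _ (he1 m)) hAsym hδ hA hb hγ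
      (by positivity) (T := T) (M := Real.sqrt (e m) * (D3 + |α| * D2))
      (w0 := fun t => W m f t - W n f t)
      (w1 := fun t => W m (deriv f) t - W n (deriv f) t)
      (w2 := fun t => W m (deriv (deriv f)) t - W n (deriv (deriv f)) t)
      (w3 := fun t => W m (deriv (deriv (deriv f))) t - W n (deriv (deriv (deriv f))) t)
      (F := fun t => -((e m - e n) • h t))
      ((hWc m _ hf).sub (hWc n _ hf)).continuousOn
      ((hWc m _ hf.deriv).sub (hWc n _ hf.deriv)).continuousOn
      ((hWc m _ hf.deriv.deriv).sub (hWc n _ hf.deriv.deriv)).continuousOn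
      (fun t _ => ((hW m).hasDerivAt f hf t).sub ((hW n).hasDerivAt f hf t))
      (fun t _ => ((hW m).hasDerivAt _ hf.deriv t).sub ((hW n).hasDerivAt _ hf.deriv t))
      (fun t _ => ((hW m).hasDerivAt _ hf.deriv.deriv t).sub
        ((hW n).hasDerivAt _ hf.deriv.deriv t)) ?_ ?_
      (by simp [(hW m).zero _ hf 0 le_rfl, (hW n).zero _ hf 0 le_rfl])
      (by simp [(hW m).zero _ hf.deriv 0 le_rfl, (hW n).zero _ hf.deriv 0 le_rfl])
      (by simp [(hW m).zero _ hf.deriv.deriv 0 le_rfl, (hW n).zero _ hf.deriv.deriv 0 le_rfl])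
      t ht
    · rw [mul_pow, Real.sq_sqrt (he0 m).le] at key
      calc _ ≤ _ := key
        _ = _ := by ring
    · intro t _
      have e1 := (hW m).equation f hf t
      have e2 := (hW n).equation f hf t
      have e3 : B (e n) (h t) = B (e m) (h t) - (e m - e n) • h t := by
        simp only [hB, add_apply, smul_apply,
          ContinuousLinearMap.id_apply]
        module
      change B (e n) (h t) + _ = _ at e2
      rw [e3] at e2
      simp only [h, map_sub, map_add, map_smul, smul_sub] at e1 e2 ⊢
      rw [← sub_eq_zero] at e1 e2 ⊢
      rw [← sub_eq_zero.2 (e1.trans e2.symm)]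
      module
    · intro t ht
      rw [hBself]
      set x := W m (deriv (deriv f)) t - W n (deriv (deriv f)) t
        + (c ^ 2 / b) • (W m (deriv f) t - W n (deriv f) t)
      rw [inner_neg_left, real_inner_smul_left, mul_pow, Real.sq_sqrt (he0 m).le]
      have h1 : -⟪h t, x⟫ ≤ ‖h t‖ * ‖x‖ := by
        rw [← inner_neg_left, ← norm_neg (h t)]; exact real_inner_le_norm _ _
      have h2 : ‖h t‖ ^ 2 ≤ (D3 + |α| * D2) ^ 2 := by
        have := hh t (Ioo_subset_Icc_self ht); gcongr
      have h3 : 0 ≤ e m - e n := by linarith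
      have h4 : -((e m - e n) * ⟪h t, x⟫) ≤ e m * (‖h t‖ * ‖x‖) := by
        rw [← mul_neg]
        calc _ ≤ (e m - e n) * (‖h t‖ * ‖x‖) := by gcongr
          _ ≤ _ := by
            have := (he0 n).le
            gcongr
            linarith
      -- The part `e m * ‖x‖²` of the regularized form absorbs the source, at the price `e m *
      -- ‖h‖²`; this explains the factor `√(e m)` in the choice of `M`.
      have h5 : e m * (‖h t‖ * ‖x‖) ≤ e m * ((‖h t‖ ^ 2 + ‖x‖ ^ 2) / 2) := by
        have := (he0 m).le
        gcongr
        nlinarith [sq_nonneg (‖h t‖ - ‖x‖)]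
      have h6 : e m * ‖h t‖ ^ 2 ≤ e m * (D3 + |α| * D2) ^ 2 := by
        have := (he0 m).le
        gcongr
      have h7 : 0 ≤ ‖J x‖ ^ 2 := by positivity
      linarith
  have helim : Tendsto e atTop (𝓝 0) := tendsto_one_div_add_atTop_nhds_zero_nat
  -- Uniformity on the whole half-line comes for free, since all solutions vanish for `t ≤ 0`.
  have hcauchy : ∀ f, IsForcing f → ∀ T, UniformCauchySeqOn (fun n => W n f) atTop (Iio T) := by
    intro f hf T
    obtain ⟨D, hD⟩ := hdiff f hf T
    rw [Metric.uniformCauchySeqOn_iff]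
    intro η hη
    have hlim : Tendsto (fun n => e n * D) atTop (𝓝 0) := by simpa using helim.mul_const D
    obtain ⟨n0, hn0⟩ := ((tendsto_order.1 hlim).2 (η ^ 2) (by positivity)).exists_forall_of_atTop
    have main : ∀ m ≥ n0, ∀ n ≥ m, ∀ t ∈ Iio T, dist (W m f t) (W n f t) < η := by
      intro m hm n hn t ht
      rw [dist_eq_norm]
      rcases le_or_gt t 0 with h0 | h0
      · rw [(hW m).zero f hf t h0, (hW n).zero f hf t h0]
        simpa using hη
      · exact lt_of_pow_lt_pow_left₀ 2 hη.le
          ((hD m n hn t ⟨h0.le, le_of_lt ht⟩).trans_lt (hn0 m hm))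
    refine ⟨n0, fun m hm n hn t ht => ?_⟩
    rcases le_total m n with h | h
    · exact main m hm n h t ht
    · rw [dist_comm]; exact main n hn m h t ht
  have hconv : ∀ f, IsForcing f → ∀ t, ∃ w, Tendsto (fun n => W n f t) atTop (𝓝 w) := fun f hf t =>
    cauchySeq_tendsto_of_complete
      ((hcauchy f hf (t + 1)).cauchySeq (show t < t + 1 by linarith))
  set U : (ℝ → H) → ℝ → V := fun f t => limUnder atTop fun n => W n f t with hU
  have hUt : ∀ f, IsForcing f → ∀ t, Tendsto (fun n => W n f t) atTop (𝓝 (U f t)) := fun f hf t =>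
    tendsto_nhds_limUnder (hconv f hf t)
  have hUunif : ∀ f, IsForcing f → ∀ T, TendstoUniformlyOn (fun n => W n f) (U f) atTop (Iio T) :=
    fun f hf T => (hcauchy f hf T).tendstoUniformlyOn_of_tendsto fun t _ => hUt f hf t
  refine ⟨U, ⟨fun f hf t ht => ?_, fun f hf t => ?_, fun f hf t => ?_⟩, fun T hT => ?_⟩
  · refine tendsto_nhds_unique (hUt f hf t) ?_
    simp only [(hW _).zero f hf t ht]
    exact tendsto_const_nhds
  · exact hasDerivAt_of_tendstoUniformlyOn isOpen_Iio (hUunif _ hf.deriv (t + 1))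
      (Eventually.of_forall fun n x _ => (hW n).hasDerivAt f hf x) (fun x _ => hUt f hf x)
      (show t < t + 1 by linarith)
  · have l3 := hUt _ hf.deriv.deriv.deriv t
    have l2 := hUt _ hf.deriv.deriv t
    have l1 := hUt _ hf.deriv t
    have l0 := hUt _ hf t
    have lx := l3.add (l2.const_smul α)
    have L := ((((J.adjoint.comp J).continuous.tendsto _).comp lx).add (helim.smul lx)).add
      ((A.continuous.tendsto _).comp ((l0.const_smul (c ^ 2)).add (l1.const_smul b)))
    rw [zero_smul, add_zero] at L
    refine tendsto_nhds_unique L ?_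
    refine tendsto_const_nhds.congr fun n => ?_
    rw [← (hW n).equation f hf t]
    simp [hB]
  · refine ⟨Real.sqrt (T * Real.exp (rate * T)), by positivity, fun f hf M hM t ht => ?_⟩
    have hM0 : 0 ≤ M := (norm_nonneg _).trans (hM 0 ⟨le_rfl, hT.le⟩)
    refine le_of_tendsto (hUt f hf t).norm (Eventually.of_forall fun n => ?_)
    have := hest n f hf T M hM t ht
    refine (Real.le_sqrt_of_sq_le this).trans (le_of_eq ?_)
    rw [mul_assoc, Real.sqrt_mul (by positivity), Real.sqrt_sq hM0, mul_comm]

end Existence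

end

end MGT

/-! ### The scalar kernel and Duhamel's formula -/

namespace MGT

noncomputable section

section ScalarKernel

theorem hasDerivAt_cexp_mul (p : ℂ) (t : ℝ) :
    HasDerivAt (fun t : ℝ => Complex.exp (p * t)) (p * Complex.exp (p * t)) t := by
  have h1 : HasDerivAt (fun t : ℝ => p * (t : ℂ)) p t := by
    simpa using (Complex.ofRealCLM.hasDerivAt (x := t)).const_mul p
  simpa [mul_comm] using h1.cexp

/-- The function `C` has the derivatives `F₁`, `F₂`, `F₃`, satisfies the differential equation
`(∂ - p) (∂ - q) (∂ - r) C = 0`, and `C(0) = C'(0) = 0`, `C''(0) = 1`. -/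
structure IsFundamental (p q r : ℂ) (C F₁ F₂ F₃ : ℝ → ℂ) : Prop where
  d0 : ∀ t, HasDerivAt C (F₁ t) t
  d1 : ∀ t, HasDerivAt F₁ (F₂ t) t
  d2 : ∀ t, HasDerivAt F₂ (F₃ t) t
  cont : Continuous F₃
  ode : ∀ t, F₃ t - (p + q + r) * F₂ t + (p * q + p * r + q * r) * F₁ t - p * q * r * C t = 0
  i0 : C 0 = 0
  i1 : F₁ 0 = 0
  i2 : F₂ 0 = 1

theorem isFundamental_simple {p q r : ℂ} (hpq : p ≠ q) (hpr : p ≠ r) (hqr : q ≠ r) :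
    ∃ F₁ F₂ F₃, IsFundamental p q r (fun t : ℝ =>
      Complex.exp (p * t) / ((p - q) * (p - r)) - Complex.exp (q * t) / ((p - q) * (q - r))
        + Complex.exp (r * t) / ((p - r) * (q - r))) F₁ F₂ F₃ := by
  have h1 := sub_ne_zero.2 hpq
  have h2 := sub_ne_zero.2 hpr
  have h3 := sub_ne_zero.2 hqr
  -- A three-parameter family closed under differentiation, which acts linearly on the parameters;
  -- the ODE and the initial values become algebra. The multiple-root cases use the same device.
  set F : ℂ → ℂ → ℂ → ℝ → ℂ := fun x y z t =>
    x * Complex.exp (p * t) + y * Complex.exp (q * t) + z * Complex.exp (r * t) with hF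
  have hd : ∀ x y z t, HasDerivAt (F x y z) (F (x * p) (y * q) (z * r) t) t := fun x y z t => by
    refine ((((hasDerivAt_cexp_mul p t).const_mul x).add
      ((hasDerivAt_cexp_mul q t).const_mul y)).add
      ((hasDerivAt_cexp_mul r t).const_mul z)).congr_deriv ?_
    simp only [hF]; ring
  set x := 1 / ((p - q) * (p - r)) with hx
  set y := -1 / ((p - q) * (q - r)) with hy
  set z := 1 / ((p - r) * (q - r)) with hz
  have hC : (fun t : ℝ => Complex.exp (p * t) / ((p - q) * (p - r))
      - Complex.exp (q * t) / ((p - q) * (q - r))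
      + Complex.exp (r * t) / ((p - r) * (q - r))) = F x y z := by
    funext t
    simp only [hF, hx, hy, hz]; ring
  rw [hC]
  refine ⟨_, _, _, hd _ _ _, hd _ _ _, hd _ _ _, ?_, fun t => ?_, ?_, ?_, ?_⟩
  · simp only [hF]; fun_prop
  · simp only [hF]; ring
  all_goals
    simp only [hF, hx, hy, hz, Complex.ofReal_zero, mul_zero, Complex.exp_zero]
    field_simp
    ring

theorem isFundamental_double {a d : ℂ} (had : d ≠ a) :
    ∃ F₁ F₂ F₃, IsFundamental a a d (fun t : ℝ =>
      (Complex.exp (d * t) - Complex.exp (a * t) - (d - a) * t * Complex.exp (a * t))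
        / (d - a) ^ 2) F₁ F₂ F₃ := by
  have h1 := sub_ne_zero.2 had
  set F : ℂ → ℂ → ℂ → ℝ → ℂ := fun x y z t =>
    x * Complex.exp (d * t) + y * Complex.exp (a * t) + z * (t * Complex.exp (a * t)) with hF
  have hd : ∀ x y z t, HasDerivAt (F x y z) (F (x * d) (y * a + z) (z * a) t) t :=
    fun x y z t => by
    refine ((((hasDerivAt_cexp_mul d t).const_mul x).add
      ((hasDerivAt_cexp_mul a t).const_mul y)).add
      (((Complex.ofRealCLM.hasDerivAt (x := t)).mul
        (hasDerivAt_cexp_mul a t)).const_mul z)).congr_deriv ?_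
    simp only [hF, Complex.ofRealCLM_apply, Complex.ofReal_one]; ring
  set x := 1 / (d - a) ^ 2 with hx
  set z := -1 / (d - a) with hz
  have hC : (fun t : ℝ => (Complex.exp (d * t) - Complex.exp (a * t)
      - (d - a) * t * Complex.exp (a * t)) / (d - a) ^ 2) = F x (-x) z := by
    funext t
    simp only [hF, hx, hz]; field_simp; ring
  rw [hC]
  refine ⟨_, _, _, hd _ _ _, hd _ _ _, hd _ _ _, ?_, fun t => ?_, ?_, ?_, ?_⟩
  · simp only [hF]; fun_prop
  · simp only [hF]; ring
  all_goals
    simp only [hF, hx, hz, Complex.ofReal_zero, mul_zero, Complex.exp_zero]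
    field_simp
    ring

theorem isFundamental_triple (p : ℂ) :
    ∃ F₁ F₂ F₃, IsFundamental p p p (fun t : ℝ => (t : ℂ) ^ 2 / 2 * Complex.exp (p * t))
      F₁ F₂ F₃ := by
  set F : ℂ → ℂ → ℂ → ℝ → ℂ := fun x y z t =>
    x * Complex.exp (p * t) + y * (t * Complex.exp (p * t))
      + z * (t * (t * Complex.exp (p * t))) with hF
  have hd : ∀ x y z t, HasDerivAt (F x y z) (F (x * p + y) (y * p + 2 * z) (z * p) t) t :=
    fun x y z t => by
    have e0 := hasDerivAt_cexp_mul p t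
    have e1 := (Complex.ofRealCLM.hasDerivAt (x := t)).mul e0
    have e2 := (Complex.ofRealCLM.hasDerivAt (x := t)).mul e1
    refine (((e0.const_mul x).add (e1.const_mul y)).add (e2.const_mul z)).congr_deriv ?_
    simp only [hF, Complex.ofRealCLM_apply, Complex.ofReal_one, Pi.mul_apply]; ring
  have hC : (fun t : ℝ => (t : ℂ) ^ 2 / 2 * Complex.exp (p * t)) = F 0 0 (1 / 2) := by
    funext t
    simp only [hF]; ring
  rw [hC]
  refine ⟨_, _, _, hd _ _ _, hd _ _ _, hd _ _ _, ?_, fun t => ?_, ?_, ?_, ?_⟩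
  · simp only [hF]; fun_prop
  · simp only [hF]; ring
  all_goals
    simp only [hF, Complex.ofReal_zero, mul_zero, Complex.exp_zero]
    norm_num

/-- Only the elementary symmetric functions of the roots enter, so the roots may be reordered. -/
theorem IsFundamental.of_eq {p q r p' q' r' : ℂ} {C F₁ F₂ F₃ : ℝ → ℂ}
    (h : IsFundamental p q r C F₁ F₂ F₃) (e1 : p' + q' + r' = p + q + r)
    (e2 : p' * q' + p' * r' + q' * r' = p * q + p * r + q * r) (e3 : p' * q' * r' = p * q * r) :
    IsFundamental p' q' r' C F₁ F₂ F₃ :=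
  { h with ode := by rw [e1, e2, e3]; exact h.ode }

theorem exists_isFundamental_fundC (p q r : ℂ) :
    ∃ F₁ F₂ F₃, IsFundamental p q r (fundC p q r) F₁ F₂ F₃ := by
  by_cases hpq : p = q
  · subst hpq
    by_cases hqr : p = r
    · subst hqr
      obtain ⟨F₁, F₂, F₃, h⟩ := isFundamental_triple p
      refine ⟨F₁, F₂, F₃, ?_⟩
      convert h using 1
      funext t; simp [fundC]
    · obtain ⟨F₁, F₂, F₃, h⟩ := isFundamental_double (Ne.symm hqr)
      refine ⟨F₁, F₂, F₃, ?_⟩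
      convert h using 1
      funext t; simp [fundC, hqr]
  · by_cases hqr : q = r
    · subst hqr
      obtain ⟨F₁, F₂, F₃, h⟩ := isFundamental_double hpq
      refine ⟨F₁, F₂, F₃, IsFundamental.of_eq (?_ : IsFundamental q q p _ _ _ _) (by ring)
        (by ring) (by ring)⟩
      convert h using 1
      funext t; simp [fundC, hpq]
    · by_cases hpr : p = r
      · subst hpr
        obtain ⟨F₁, F₂, F₃, h⟩ := isFundamental_double (Ne.symm hpq)
        refine ⟨F₁, F₂, F₃, IsFundamental.of_eq (?_ : IsFundamental p p q _ _ _ _) (by ring)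
          (by ring) (by ring)⟩
        convert h using 1
        funext t; simp [fundC, hpq, hqr]
      · obtain ⟨F₁, F₂, F₃, h⟩ := isFundamental_simple hpq hpr hqr
        refine ⟨F₁, F₂, F₃, ?_⟩
        convert h using 1
        funext t; simp [fundC, hpq, hqr, hpr]

/-- Vieta's formulas, read off from the values of the two monic cubics at `0`, `1` and `-1`. -/
theorem AreRoots.coeffs {α b c lam : ℝ} {μ : Fin 3 → ℂ} (h : AreRoots α b c lam μ) :
    μ 0 + μ 1 + μ 2 = -α ∧ μ 0 * μ 1 + μ 0 * μ 2 + μ 1 * μ 2 = b * lam ∧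
      μ 0 * μ 1 * μ 2 = -(c ^ 2 * lam) := by
  have h0 := h 0
  have h1 := h 1
  have h2 := h (-1)
  refine ⟨?_, ?_, ?_⟩
  · linear_combination (1 / 2 : ℂ) * h1 + (1 / 2 : ℂ) * h2 - h0
  · linear_combination (-1 / 2 : ℂ) * h1 + (1 / 2 : ℂ) * h2
  · linear_combination h0

/-- Duhamel's formula for `X''' + α X'' + b λ X' + c² λ X = -(b G' + c² G)`. -/
theorem duhamel_kernel {α b c lam : ℝ} (hlam : lam ≠ 0) {μ : Fin 3 → ℂ}
    (hμ : AreRoots α b c lam μ) {X X1 X2 X3 G G1 : ℝ → ℝ}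
    (h0 : ∀ t, HasDerivAt X (X1 t) t) (h1 : ∀ t, HasDerivAt X1 (X2 t) t)
    (h2 : ∀ t, HasDerivAt X2 (X3 t) t) (hG : ∀ t, HasDerivAt G (G1 t) t)
    (hode : ∀ t, X3 t + α * X2 t + b * lam * X1 t + c ^ 2 * lam * X t
      = -(b * G1 t + c ^ 2 * G t))
    (i0 : X 0 = 0) (i1 : X1 0 = 0) (i2 : X2 0 = 0) (iG : G 0 = 0) (t : ℝ) :
    ∫ τ in (0 : ℝ)..t, G τ * (1 / lam) * kernel α μ (t - τ) = X t := by
  obtain ⟨F₁, F₂, F₃, hF⟩ := exists_isFundamental_fundC (μ 0) (μ 1) (μ 2)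
  obtain ⟨s1, s2, s3⟩ := hμ.coeffs
  have hre : ∀ {f : ℝ → ℂ} {f' : ℂ} {τ : ℝ}, HasDerivAt f f' τ →
      HasDerivAt (fun τ => (f τ).re) f'.re τ := fun h =>
    Complex.reCLM.hasFDerivAt.comp_hasDerivAt _ h
  have hsub : ∀ {f : ℝ → ℝ} {f' : ℝ → ℝ}, (∀ τ, HasDerivAt f (f' τ) τ) →
      ∀ τ, HasDerivAt (fun τ => f (t - τ)) (-f' (t - τ)) τ := fun h τ => by
    simpa using (h (t - τ)).comp_const_sub t τ
  set C0 : ℝ → ℝ := fun t => (fundC (μ 0) (μ 1) (μ 2) t).re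
  set C1 : ℝ → ℝ := fun t => (F₁ t).re
  set C2 : ℝ → ℝ := fun t => (F₂ t).re
  set C3 : ℝ → ℝ := fun t => (F₃ t).re
  have d0 : ∀ t, HasDerivAt C0 (C1 t) t := fun t => hre (hF.d0 t)
  have d1 : ∀ t, HasDerivAt C1 (C2 t) t := fun t => hre (hF.d1 t)
  have d2 : ∀ t, HasDerivAt C2 (C3 t) t := fun t => hre (hF.d2 t)
  -- The coefficients of the ODE are real, so the real part of the fundamental solution satisfies it
  -- too.
  have hCode : ∀ t, C3 t + α * C2 t + b * lam * C1 t + c ^ 2 * lam * C0 t = 0 := by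
    intro t
    have h := hF.ode t
    rw [s1, s2, s3] at h
    have := congrArg Complex.re h
    simp only [Complex.sub_re, Complex.add_re, neg_mul, Complex.neg_re, Complex.zero_re] at this
    have e1 : ((b : ℂ) * lam * F₁ t).re = b * lam * C1 t := by
      rw [← Complex.ofReal_mul, Complex.re_ofReal_mul]
    have e2 : ((c : ℂ) ^ 2 * lam * fundC (μ 0) (μ 1) (μ 2) t).re = c ^ 2 * lam * C0 t := by
      rw [← Complex.ofReal_pow, ← Complex.ofReal_mul, Complex.re_ofReal_mul]
    rw [e1, e2, Complex.re_ofReal_mul] at this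
    linarith
  have hker : ∀ t, kernel α μ t = C3 t + α * C2 t := by
    intro t
    have f1 : deriv (fundC (μ 0) (μ 1) (μ 2)) = F₁ := funext fun t => (hF.d0 t).deriv
    have f2 : deriv F₁ = F₂ := funext fun t => (hF.d1 t).deriv
    have f3 : deriv F₂ = F₃ := funext fun t => (hF.d2 t).deriv
    have g2 : iteratedDeriv 2 (fundC (μ 0) (μ 1) (μ 2)) = F₂ := by
      rw [iteratedDeriv_succ', iteratedDeriv_one, f1, f2]
    have g3 : iteratedDeriv 3 (fundC (μ 0) (μ 1) (μ 2)) = F₃ := by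
      rw [iteratedDeriv_succ', iteratedDeriv_succ', iteratedDeriv_one, f1, f2, f3]
    rw [kernel, g2, g3, Complex.add_re, Complex.re_ofReal_mul]
  have hcont : ∀ {f f' : ℝ → ℝ}, (∀ τ, HasDerivAt f (f' τ) τ) → Continuous f := fun h =>
    continuous_iff_continuousAt.2 fun t => (h t).continuousAt
  have c3 : Continuous C3 := Complex.continuous_re.comp hF.cont
  -- An antiderivative of the integrand, found by integrating by parts. The key identity is `(C3 + α
  -- C2) / lam = -(b C1 + c² C0)`. At `τ = t` only `C2 0 = 1` survives, leaving `X t`; at `τ = 0`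
  -- everything vanishes.
  set Φ : ℝ → ℝ := fun τ => C2 (t - τ) * X τ + C1 (t - τ) * X1 τ + C0 (t - τ) * X2 τ
    + α * (C1 (t - τ) * X τ + C0 (t - τ) * X1 τ) + b * lam * (C0 (t - τ) * X τ)
    + b * (C0 (t - τ) * G τ) with hΦ
  have hΦd : ∀ τ, HasDerivAt Φ (G τ * (1 / lam) * kernel α μ (t - τ)) τ := by
    intro τ
    have a0 := hsub d0 τ
    have a1 := hsub d1 τ
    have a2 := hsub d2 τ
    refine (((((a2.mul (h0 τ)).add (a1.mul (h1 τ))).add (a0.mul (h2 τ))).add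
      (((a1.mul (h0 τ)).add (a0.mul (h1 τ))).const_mul α)).add
      ((a0.mul (h0 τ)).const_mul (b * lam))).add ((a0.mul (hG τ)).const_mul b) |>.congr_deriv ?_
    rw [hker]
    have o1 := hode τ
    have o2 := hCode (t - τ)
    have hX3 : X3 τ = -(b * G1 τ + c ^ 2 * G τ) - α * X2 τ - b * lam * X1 τ
      - c ^ 2 * lam * X τ := by linarith
    have hC3 : C3 (t - τ) = - α * C2 (t - τ) - b * lam * C1 (t - τ)
      - c ^ 2 * lam * C0 (t - τ) := by linarith
    rw [hX3, hC3]
    field_simp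
    ring
  have hint : IntervalIntegrable (fun τ => G τ * (1 / lam) * kernel α μ (t - τ)) volume 0 t := by
    refine Continuous.intervalIntegrable ?_ _ _
    simp only [hker]
    have := hcont hG
    have := hcont d2
    fun_prop
  rw [intervalIntegral.integral_eq_sub_of_hasDerivAt (fun τ _ => hΦd τ) hint]
  have z0 : C0 0 = 0 := by simp [C0, hF.i0]
  have z1 : C1 0 = 0 := by simp [C1, hF.i1]
  have z2 : C2 0 = 1 := by simp [C2, hF.i2]
  simp [hΦ, i0, i1, i2, iG, z0, z1, z2]

end ScalarKernel

end

end MGT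

/-! ### The Hilbert space `W^{s,2}(ℝᴺ)` and the Poincaré inequality -/

namespace MGT

noncomputable section

variable {N : ℕ} {s : ℝ}

theorem Lp_enorm_sq {X : Type*} [MeasurableSpace X] {μ : Measure X} (f : Lp ℝ 2 μ) :
    ‖f‖ₑ ^ 2 = ∫⁻ x, ‖f x‖ₑ ^ 2 ∂μ := by
  rw [Lp.enorm_def]
  have h := eLpNorm_nnreal_pow_eq_lintegral (f := (f : X → ℝ)) (p := 2) (μ := μ) two_ne_zero
  rw [← ENNReal.rpow_two]
  exact h.trans (lintegral_congr fun x => ENNReal.rpow_two _)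

theorem memLp_two_of_lintegral {X : Type*} [MeasurableSpace X] {μ : Measure X} {f : X → ℝ}
    (hf : AEStronglyMeasurable f μ) (h : ∫⁻ x, ‖f x‖ₑ ^ 2 ∂μ ≠ ⊤) : MemLp f 2 μ := by
  refine ⟨hf, ?_⟩
  rw [eLpNorm_lt_top_iff_lintegral_rpow_enorm_lt_top two_ne_zero ENNReal.ofNat_ne_top]
  simpa using h.lt_top

theorem lintegral_diffQuot_prod {u : RN N → ℝ} (hu : Measurable u) :
    ∫⁻ z, ‖diffQuot s u z‖ₑ ^ 2 = ∫⁻ x, ∫⁻ y, ‖diffQuot s u (x, y)‖ₑ ^ 2 :=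
  lintegral_prod _ ((measurable_diffQuot hu).enorm.pow_const 2).aemeasurable

/-- The map which takes `u ∈ W^{s,2}(ℝᴺ)` to its difference quotient. -/
def gagliardo (N : ℕ) (s : ℝ) : sobolev N s →L[ℝ] Lp ℝ 2 (volume : Measure (RN N × RN N)) :=
  (WithLp.sndL 2 ℝ _ _).comp (sobolev N s).subtypeL

theorem coeFn_gagliardo (p : sobolev N s) :
    gagliardo N s p =ᵐ[volume] diffQuot s (toL2 N s p) := p.2

theorem sobolev_norm_sq (p : sobolev N s) : ‖p‖ ^ 2 = ‖toL2 N s p‖ ^ 2 + ‖gagliardo N s p‖ ^ 2 :=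
  WithLp.prod_norm_sq_eq_of_L2 p.1

theorem gagliardo_enorm_sq (p : sobolev N s) :
    ‖gagliardo N s p‖ₑ ^ 2 = ∫⁻ x, ∫⁻ y, ‖diffQuot s (toL2 N s p) (x, y)‖ₑ ^ 2 := by
  rw [← lintegral_diffQuot_prod (Lp.stronglyMeasurable _).measurable, Lp_enorm_sq]
  exact lintegral_congr_ae ((coeFn_gagliardo p).mono fun z hz => by simp only [hz])

theorem enorm_sq_eq_ofReal_norm {X : Type*} [NormedAddCommGroup X] (x : X) :
    ‖x‖ₑ ^ 2 = ENNReal.ofReal (‖x‖ ^ 2) := by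
  rw [← ofReal_norm, ENNReal.ofReal_pow (norm_nonneg _)]

theorem sobolev_enorm_sq (p : sobolev N s) : ‖p‖ₑ ^ 2 = sobolevSq s univ (toL2 N s p) := by
  have h1 : ‖p‖ₑ ^ 2 = ENNReal.ofReal (‖toL2 N s p‖ ^ 2) + ENNReal.ofReal (‖gagliardo N s p‖ ^ 2) := by
    rw [enorm_sq_eq_ofReal_norm, sobolev_norm_sq, ENNReal.ofReal_add (sq_nonneg _) (sq_nonneg _)]
  have h2 : ENNReal.ofReal (‖toL2 N s p‖ ^ 2) = ∫⁻ x, ‖toL2 N s p x‖ₑ ^ 2 :=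
    (enorm_sq_eq_ofReal_norm (toL2 N s p)).symm.trans (Lp_enorm_sq _)
  have h3 := (enorm_sq_eq_ofReal_norm (gagliardo N s p)).symm.trans (gagliardo_enorm_sq p)
  refine h1.trans ((congrArg₂ (· + ·) h2 h3).trans ?_)
  unfold sobolevSq
  simp only [Measure.restrict_univ]

theorem toL2_injective : Function.Injective (toL2 N s) := by
  intro p q h
  have h1 : p.1.fst = q.1.fst := h
  refine Subtype.ext ?_
  have h2 : p.1.snd = q.1.snd := by
    have hp : (p.1.snd : RN N × RN N → ℝ) =ᵐ[volume] diffQuot s p.1.fst := p.2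
    have hq : (q.1.snd : RN N × RN N → ℝ) =ᵐ[volume] diffQuot s q.1.fst := q.2
    refine Lp.ext (hp.trans ?_)
    rw [h1]
    exact hq.symm
  exact WithLp.ofLp_injective 2 (Prod.ext h1 h2)

/-- Along a common subsequence both components converge almost everywhere, and the relation between
a function and its difference quotient passes to the pointwise limit. -/
theorem isClosed_sobolev : IsClosed (sobolev N s : Set (WithLp 2 (Lp ℝ 2
    (volume : Measure (RN N)) × Lp ℝ 2 (volume : Measure (RN N × RN N))))) := by
  refine isClosed_of_closure_subset fun p hp => ?_
  obtain ⟨u, hu, hlim⟩ := mem_closure_iff_seq_limit.1 hp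
  have h1 : Tendsto (fun n => (u n).fst) atTop (𝓝 p.fst) :=
    ((WithLp.fstL 2 ℝ _ _).continuous.tendsto p).comp hlim
  have h2 : Tendsto (fun n => (u n).snd) atTop (𝓝 p.snd) :=
    ((WithLp.sndL 2 ℝ _ _).continuous.tendsto p).comp hlim
  obtain ⟨φ, hφ, hφ1⟩ := (tendstoInMeasure_of_tendsto_Lp h1).exists_seq_tendsto_ae
  obtain ⟨ψ, hψ, hψ1⟩ :=
    (tendstoInMeasure_of_tendsto_Lp (h2.comp hφ.tendsto_atTop)).exists_seq_tendsto_ae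
  change (p.snd : RN N × RN N → ℝ) =ᵐ[volume] diffQuot s p.fst
  have hall : ∀ᵐ z : RN N × RN N, ∀ n, (u n).snd z = diffQuot s (u n).fst z :=
    ae_all_iff.2 fun n => hu n
  have hx : ∀ᵐ z : RN N × RN N, Tendsto (fun n => (u (φ n)).fst z.1) atTop (𝓝 (p.fst z.1)) :=
    Measure.quasiMeasurePreserving_fst.ae hφ1
  have hy : ∀ᵐ z : RN N × RN N, Tendsto (fun n => (u (φ n)).fst z.2) atTop (𝓝 (p.fst z.2)) :=
    Measure.quasiMeasurePreserving_snd.ae hφ1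
  filter_upwards [hall, hx, hy, hψ1] with z a b c d
  have l1 : Tendsto (fun n => diffQuot s (u (φ (ψ n))).fst z) atTop (𝓝 (diffQuot s p.fst z)) :=
    ((b.sub c).div_const _).comp hψ.tendsto_atTop
  refine tendsto_nhds_unique (d.congr fun n => ?_) l1
  exact a _

instance : CompleteSpace (sobolev N s) := isClosed_sobolev.completeSpace_coe

instance (Ω : Set (RN N)) : CompleteSpace (sobolevZero s Ω) := by
  have : IsClosed (sobolevZero s Ω : Set (sobolev N s)) :=
    ((restr Ωᶜ).comp (toL2 N s)).isClosed_ker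
  exact this.completeSpace_coe

theorem memLp_of_sobolevSq {u : RN N → ℝ} (hu : Measurable u) (h : sobolevSq s univ u ≠ ⊤) :
    MemLp u 2 volume :=
  memLp_two_of_lintegral hu.aestronglyMeasurable fun hc => h (by
    unfold sobolevSq; simp only [Measure.restrict_univ, hc, top_add])

theorem memLp_diffQuot_of_sobolevSq {u : RN N → ℝ} (hu : Measurable u)
    (h : sobolevSq s univ u ≠ ⊤) : MemLp (diffQuot s u) 2 volume :=
  memLp_two_of_lintegral (measurable_diffQuot hu).aestronglyMeasurable fun hc => h (by
    rw [lintegral_diffQuot_prod hu] at hc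
    unfold sobolevSq
    simp only [Measure.restrict_univ, hc, add_top])

open Classical in
/-- The element of `W^{s,2}(ℝᴺ)` given by a function, which is zero if the function is not in this
space. -/
def ofFun (s : ℝ) (u : RN N → ℝ) : sobolev N s :=
  if h : Measurable u ∧ sobolevSq s univ u ≠ ⊤ then
    ⟨WithLp.toLp 2 ((memLp_of_sobolevSq h.1 h.2).toLp, (memLp_diffQuot_of_sobolevSq h.1 h.2).toLp),
      (memLp_diffQuot_of_sobolevSq h.1 h.2).coeFn_toLp.trans
        (diffQuot_congr s (memLp_of_sobolevSq h.1 h.2).coeFn_toLp).symm⟩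
  else 0

theorem coeFn_ofFun {u : RN N → ℝ} (hu : Measurable u) (h : sobolevSq s univ u ≠ ⊤) :
    toL2 N s (ofFun s u) =ᵐ[volume] u := by
  have h1 : toL2 N s (ofFun s u) = (memLp_of_sobolevSq hu h).toLp := by
    unfold ofFun
    rw [dif_pos ⟨hu, h⟩]
    rfl
  rw [h1]
  exact MemLp.coeFn_toLp _

theorem sobolevSq_congr_ae {u v : RN N → ℝ} (h : u =ᵐ[volume] v) :
    sobolevSq s univ u = sobolevSq s univ v := by
  unfold sobolevSq
  simp only [Measure.restrict_univ]
  congr 1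
  · exact lintegral_congr_ae (h.mono fun x hx => by simp only [hx])
  · refine lintegral_congr_ae (h.mono fun x hx => lintegral_congr_ae (h.mono fun y hy => ?_))
    simp only [diffQuot, hx, hy]

theorem ofFun_enorm_sq {u : RN N → ℝ} (hu : Measurable u) (h : sobolevSq s univ u ≠ ⊤) :
    ‖ofFun s u‖ₑ ^ 2 = sobolevSq s univ u := by
  rw [sobolev_enorm_sq, sobolevSq_congr_ae (coeFn_ofFun hu h)]

theorem measurable_toL2 (p : sobolev N s) : Measurable (toL2 N s p) :=
  (Lp.stronglyMeasurable _).measurable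

theorem eq_ofFun {u : RN N → ℝ} (hu : Measurable u) {p : sobolev N s}
    (h : toL2 N s p =ᵐ[volume] u) : p = ofFun s u := by
  have hfin : sobolevSq s univ u ≠ ⊤ := by
    rw [← sobolevSq_congr_ae h, ← sobolev_enorm_sq]
    exact ENNReal.pow_ne_top enorm_ne_top
  exact toL2_injective (Lp.ext (h.trans (coeFn_ofFun hu hfin).symm))

theorem restr_coeFn (Ω : Set (RN N)) (f : Lp ℝ 2 (volume : Measure (RN N))) :
    restr Ω f =ᵐ[volume.restrict Ω] f :=
  LpToLpRestrictCLM_coeFn ℝ Ω f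

theorem mem_sobolevZero_iff {Ω : Set (RN N)} {p : sobolev N s} :
    p ∈ sobolevZero s Ω ↔ ∀ᵐ x ∂(volume.restrict Ωᶜ), toL2 N s p x = 0 := by
  change restr Ωᶜ (toL2 N s p) = 0 ↔ _
  rw [Lp.eq_zero_iff_ae_eq_zero]
  have h := restr_coeFn Ωᶜ (toL2 N s p)
  exact ⟨fun h' => h.symm.trans h', fun h' => h.trans h'⟩

/-- Two elements of `L²(ℝᴺ)` agree if they agree in `Ω` and outside. -/
theorem Lp_ext_of_restr {Ω : Set (RN N)} (hΩ : MeasurableSet Ω)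
    {f g : Lp ℝ 2 (volume : Measure (RN N))} (h1 : restr Ω f = restr Ω g)
    (h2 : ∀ᵐ x ∂(volume.restrict Ωᶜ), f x = g x) : f = g := by
  refine Lp.ext ?_
  have h1' : ∀ᵐ x ∂(volume.restrict Ω), f x = g x := by
    refine (restr_coeFn Ω f).symm.trans ?_
    rw [h1]
    exact restr_coeFn Ω g
  rw [ae_restrict_iff' hΩ] at h1'
  rw [ae_restrict_iff' hΩ.compl] at h2
  filter_upwards [h1', h2] with x a b
  by_cases hx : x ∈ Ω
  · exact a hx
  · exact b hx

theorem fracConst_pos (N : ℕ) (hs0 : 0 < s) (hs1 : s < 1) : 0 < fracConst N s := by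
  unfold fracConst
  have h1 := Real.Gamma_pos_of_pos (show 0 < (2 * s + N) / 2 by positivity)
  have h2 := Real.Gamma_pos_of_pos (show 0 < 1 - s by linarith)
  have := Real.pi_pos
  positivity

/-- The fractional Poincaré inequality. -/
theorem exists_poincare_lintegral (hN : 1 ≤ N) (hs0 : 0 < s) {Ω : Set (RN N)} (hΩ : IsOpen Ω)
    (hb : Bornology.IsBounded Ω) :
    ∃ k : ℝ, 0 < k ∧ ∀ u : RN N → ℝ, Measurable u → (∀ᵐ x ∂(volume.restrict Ωᶜ), u x = 0) →
      ENNReal.ofReal k * ∫⁻ x, ‖u x‖ₑ ^ 2 ≤ ∫⁻ x, ∫⁻ y, ‖diffQuot s u (x, y)‖ₑ ^ 2 := by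
  obtain ⟨R, hR, hΩR⟩ := hb.subset_ball_lt 0 (0 : RN N)
  -- The unit ball around `z` misses `Ω`. Keeping only the pairs in `Ω × B`, where `u y = 0` for
  -- almost every `y` and `‖x - y‖ ≤ 2 R + 2`, already bounds the seminorm below by a multiple of
  -- the `L²` norm.
  set z : RN N := EuclideanSpace.single ⟨0, hN⟩ (R + 1)
  have hz : ‖z‖ = R + 1 := by simp [z, abs_of_pos (by linarith : 0 < R + 1)]
  set B : Set (RN N) := Metric.ball z 1 with hB
  have hBΩ : B ⊆ Ωᶜ := by
    intro y hy hyΩ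
    have h1 : ‖y‖ < R := by simpa using hΩR hyΩ
    have h2 : ‖y - z‖ < 1 := by simpa [hB, dist_eq_norm] using hy
    have h3 : ‖z‖ ≤ ‖y‖ + ‖y - z‖ := by
      rw [norm_sub_rev]
      simpa using norm_add_le y (z - y)
    linarith
  set D : ℝ := 2 * R + 2
  set κ : ℝ := ((D ^ ((N : ℝ) / 2 + s)) ^ 2)⁻¹
  have hκ : 0 < κ := by positivity
  have hvB : 0 < volume B := Metric.measure_ball_pos _ _ one_pos
  have hvB' : volume B ≠ ⊤ := measure_ball_lt_top.ne
  set v : ℝ := (volume B).toReal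
  have hv : 0 < v := ENNReal.toReal_pos hvB.ne' hvB'
  refine ⟨κ * v, by positivity, fun u hum hu0 => ?_⟩
  have hΩm := hΩ.measurableSet
  have e1 : ∫⁻ x, ‖u x‖ₑ ^ 2 = ∫⁻ x in Ω, ‖u x‖ₑ ^ 2 := by
    rw [← lintegral_add_compl _ hΩm, lintegral_congr_ae (g := fun _ => 0) (μ := volume.restrict Ωᶜ)
      (hu0.mono fun x hx => by simp [hx])]
    simp
  have hu0B : ∀ᵐ y ∂(volume.restrict B), u y = 0 :=
    ae_mono (Measure.restrict_mono hBΩ le_rfl) hu0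
  have hpt : ∀ x ∈ Ω, ∀ y ∈ B, u y = 0 →
      ENNReal.ofReal κ * ‖u x‖ₑ ^ 2 ≤ ‖diffQuot s u (x, y)‖ₑ ^ 2 := by
    intro x hx y hy huy
    rw [enorm_sq_eq_ofReal, enorm_sq_eq_ofReal, ← ENNReal.ofReal_mul hκ.le]
    refine ENNReal.ofReal_le_ofReal ?_
    rw [diffQuot_sq, huy, sub_zero, mul_comm, div_eq_mul_inv]
    have hne : 0 < ‖x - y‖ := norm_pos_iff.2 (sub_ne_zero.2 fun h => hBΩ hy (h ▸ hx))
    have hle : ‖x - y‖ ≤ D := by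
      have h1 : ‖x‖ < R := by simpa using hΩR hx
      have h2 : ‖y - z‖ < 1 := by simpa [hB, dist_eq_norm] using hy
      calc ‖x - y‖ = ‖x - (y - z) - z‖ := by congr 1; abel
        _ ≤ ‖x - (y - z)‖ + ‖z‖ := norm_sub_le _ _
        _ ≤ ‖x‖ + ‖y - z‖ + ‖z‖ := by gcongr; exact norm_sub_le _ _
        _ ≤ D := by rw [hz]; simp only [D]; linarith
    simp only [κ]
    gcongr
  rw [e1, ENNReal.ofReal_mul hκ.le, ENNReal.ofReal_toReal hvB']
  rw [← lintegral_const_mul _ (by fun_prop)]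
  refine le_trans ?_ (setLIntegral_le_lintegral Ω _)
  refine setLIntegral_mono' hΩm fun x hx => ?_
  refine le_trans ?_ (setLIntegral_le_lintegral B _)
  calc ENNReal.ofReal κ * volume B * ‖u x‖ₑ ^ 2
      = ∫⁻ y in B, ENNReal.ofReal κ * ‖u x‖ₑ ^ 2 := by
        rw [setLIntegral_const]; ring
    _ ≤ _ := by
        refine lintegral_mono_ae ?_
        filter_upwards [hu0B, ae_restrict_mem measurableSet_ball] with y hy hyB
        exact hpt x hx y hyB hy

theorem le_gagliardo_of_lintegral {k : ℝ} (hk : 0 < k) (p : sobolev N s)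
    (h : ENNReal.ofReal k * ∫⁻ x, ‖toL2 N s p x‖ₑ ^ 2
      ≤ ∫⁻ x, ∫⁻ y, ‖diffQuot s (toL2 N s p) (x, y)‖ₑ ^ 2) :
    k * ‖toL2 N s p‖ ^ 2 ≤ ‖gagliardo N s p‖ ^ 2 := by
  have e4 := (enorm_sq_eq_ofReal_norm (gagliardo N s p)).symm.trans (gagliardo_enorm_sq p)
  have e5 := (enorm_sq_eq_ofReal_norm (toL2 N s p)).symm.trans (Lp_enorm_sq _)
  have e1 : ENNReal.ofReal (k * ‖toL2 N s p‖ ^ 2)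
      = ENNReal.ofReal k * ∫⁻ x, ‖toL2 N s p x‖ₑ ^ 2 :=
    (ENNReal.ofReal_mul hk.le).trans (congrArg (fun z => ENNReal.ofReal k * z) e5)
  exact (ENNReal.ofReal_le_ofReal_iff (sq_nonneg _)).1 (e1.le.trans (h.trans e4.ge))

theorem poincare_of_lintegral {Ω : Set (RN N)} {k : ℝ}
    (h : 0 < k ∧ ∀ u : RN N → ℝ, Measurable u → (∀ᵐ x ∂(volume.restrict Ωᶜ), u x = 0) →
      ENNReal.ofReal k * ∫⁻ x, ‖u x‖ₑ ^ 2 ≤ ∫⁻ x, ∫⁻ y, ‖diffQuot s u (x, y)‖ₑ ^ 2)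
    (p : sobolevZero s Ω) : k * ‖toL2 N s p‖ ^ 2 ≤ ‖gagliardo N s p‖ ^ 2 :=
  le_gagliardo_of_lintegral h.1 (p : sobolev N s)
    (h.2 (toL2 N s (p : sobolev N s)) (measurable_toL2 _) (mem_sobolevZero_iff.1 p.2))

theorem exists_poincare (hN : 1 ≤ N) (hs0 : 0 < s) {Ω : Set (RN N)} (hΩ : IsOpen Ω)
    (hb : Bornology.IsBounded Ω) :
    ∃ k : ℝ, 0 < k ∧ ∀ p : sobolevZero s Ω, k * ‖toL2 N s p‖ ^ 2 ≤ ‖gagliardo N s p‖ ^ 2 := by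
  have H := exists_poincare_lintegral (s := s) hN hs0 hΩ hb
  exact H.imp fun k h => ⟨h.1, fun p => poincare_of_lintegral h p⟩

end

end MGT

/-! ### Inhomogeneous exterior data and classical solutions, abstractly -/

namespace MGT

noncomputable section

local notation "⟪" x ", " y "⟫" => inner ℝ x y

variable {X Y H : Type*} [NormedAddCommGroup X] [InnerProductSpace ℝ X]
  [NormedAddCommGroup Y] [InnerProductSpace ℝ Y]
  [NormedAddCommGroup H] [InnerProductSpace ℝ H]
  {V : Submodule ℝ X} {G : X →L[ℝ] Y} {R : X →L[ℝ] H}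

section

variable [CompleteSpace Y] [CompleteSpace V]

/-- The operator on `V` which represents the form `κ ⟪G u, G v⟫`. -/
def formOp (V : Submodule ℝ X) [CompleteSpace V] (G : X →L[ℝ] Y) (κ : ℝ) : V →L[ℝ] V :=
  κ • (G.comp V.subtypeL).adjoint.comp (G.comp V.subtypeL)

theorem inner_formOp (κ : ℝ) (u w : V) :
    ⟪formOp V G κ u, w⟫ = κ * ⟪G (u : X), G (w : X)⟫ := by
  change ⟪κ • (G.comp V.subtypeL).adjoint (G (u : X)), w⟫ = _
  rw [real_inner_smul_left, ContinuousLinearMap.adjoint_inner_left]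
  rfl

theorem formOp_symm (κ : ℝ) (u w : V) : ⟪formOp V G κ u, w⟫ = ⟪u, formOp V G κ w⟫ :=
  calc ⟪formOp V G κ u, w⟫ = κ * ⟪G (u : X), G (w : X)⟫ := inner_formOp κ u w
    _ = κ * ⟪G (w : X), G (u : X)⟫ := by rw [real_inner_comm]
    _ = ⟪formOp V G κ w, u⟫ := (inner_formOp κ w u).symm
    _ = ⟪u, formOp V G κ w⟫ := real_inner_comm _ _

theorem formOp_coercive {κ δ : ℝ} (hV : ∀ v : V, δ * ‖v‖ ^ 2 ≤ κ * ‖G (v : X)‖ ^ 2) (u : V) :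
    δ * ‖u‖ ^ 2 ≤ ⟪formOp V G κ u, u⟫ := by
  rw [inner_formOp, real_inner_self_eq_norm_sq]
  exact hV u

/-- The projection onto `V` along the orthogonal complement with respect to the form. -/
theorem exists_formProj {κ δ : ℝ} (hδ : 0 < δ)
    (hV : ∀ v : V, δ * ‖v‖ ^ 2 ≤ κ * ‖G (v : X)‖ ^ 2) :
    ∃ P : X →L[ℝ] V, (∀ v : V, P (v : X) = v) ∧
      ∀ (u : X) (w : V), κ * ⟪G (P u : X), G (w : X)⟫ = κ * ⟪G u, G (w : X)⟫ := by
  obtain ⟨Q, hQ1, hQ2⟩ := exists_inverse_of_coercive hδ (formOp_coercive (V := V) hV)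
  refine ⟨Q.comp (κ • (G.comp V.subtypeL).adjoint.comp G), fun v => hQ2 v, fun u w => ?_⟩
  rw [← inner_formOp]
  change ⟪formOp V G κ (Q (κ • (G.comp V.subtypeL).adjoint (G u))), w⟫ = _
  rw [hQ1, real_inner_smul_left, ContinuousLinearMap.adjoint_inner_left]
  rfl

end

/-- The part of the open interval outside `F` is open and null, hence empty; the endpoints follow by
closure. It upgrades essential bounds on continuous sources to bounds at every time. -/
theorem Icc_subset_of_ae {T : ℝ} (hT : 0 < T) {F : Set ℝ} (hF : IsClosed F)
    (h : ∀ᵐ t ∂(volume.restrict (Ioo 0 T)), t ∈ F) : Icc 0 T ⊆ F := by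
  have h1 : Ioo 0 T ⊆ F := by
    rw [ae_restrict_iff' measurableSet_Ioo] at h
    have h2 : volume (Ioo 0 T ∩ Fᶜ) = 0 := by
      refine measure_mono_null (fun t ht => ?_) h
      exact fun hc => ht.2 (hc ht.1)
    have h3 := (isOpen_Ioo.inter hF.isOpen_compl).eq_empty_of_measure_zero h2
    intro t ht
    by_contra hc
    exact (h3 ▸ (⟨ht, hc⟩ : t ∈ Ioo 0 T ∩ Fᶜ) : t ∈ (∅ : Set ℝ))
  rw [← closure_Ioo hT.ne]
  exact closure_minimal h1 hF

theorem IsForcing.clm {Z Z' : Type*} [NormedAddCommGroup Z] [NormedSpace ℝ Z]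
    [NormedAddCommGroup Z'] [NormedSpace ℝ Z'] {f : ℝ → Z} (hf : IsForcing f) (L : Z →L[ℝ] Z') :
    IsForcing fun t => L (f t) :=
  ⟨L.contDiff.comp hf.smooth, fun t ht => by rw [hf.zero t ht, map_zero]⟩

theorem IsForcing.deriv_clm {Z Z' : Type*} [NormedAddCommGroup Z] [NormedSpace ℝ Z]
    [NormedAddCommGroup Z'] [NormedSpace ℝ Z'] {f : ℝ → Z} (hf : IsForcing f) (L : Z →L[ℝ] Z') :
    _root_.deriv (fun t => L (f t)) = fun t => L (_root_.deriv f t) :=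
  funext fun t => (L.hasFDerivAt.comp_hasDerivAt t (hf.hasDerivAt t)).deriv

theorem IsForcing.add {Z : Type*} [NormedAddCommGroup Z] [NormedSpace ℝ Z]
    {f g : ℝ → Z} (hf : IsForcing f) (hg : IsForcing g) : IsForcing fun t => f t + g t :=
  ⟨hf.smooth.add hg.smooth, fun t ht => by rw [hf.zero t ht, hg.zero t ht, add_zero]⟩

theorem IsForcing.smul {Z : Type*} [NormedAddCommGroup Z] [NormedSpace ℝ Z]
    {f : ℝ → Z} (hf : IsForcing f) (k : ℝ) : IsForcing fun t => k • f t :=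
  ⟨contDiff_const.smul hf.smooth, fun t ht => by rw [hf.zero t ht, smul_zero]⟩

theorem IsForcing.iteratedDeriv {Z : Type*} [NormedAddCommGroup Z] [NormedSpace ℝ Z]
    {f : ℝ → Z} (hf : IsForcing f) (m : ℕ) : IsForcing (_root_.iteratedDeriv m f) := by
  induction m with
  | zero => simpa using hf
  | succ m ih => rw [iteratedDeriv_succ]; exact ih.deriv

/-- `S` maps `Γ` to the solution of
`⟪R (v''' + α v''), R w⟫ + κ ⟪G (c² v + b v'), G w⟫ = 0` for all `w ∈ V`, with `v - Γ` in `V`, which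
vanishes up to time `0`. -/
structure IsInhomSolutionOperator (V : Submodule ℝ X) (G : X →L[ℝ] Y) (R : X →L[ℝ] H)
    (κ α b c : ℝ) (S : (ℝ → X) → ℝ → X) : Prop where
  zero : ∀ Γ, IsForcing Γ → ∀ t ≤ 0, S Γ t = 0
  hasDerivAt : ∀ Γ, IsForcing Γ → ∀ t, HasDerivAt (S Γ) (S (deriv Γ) t) t
  exterior : ∀ Γ, IsForcing Γ → ∀ t, S Γ t - Γ t ∈ V
  equation : ∀ Γ, IsForcing Γ → ∀ t, ∀ w : V,
    ⟪R (S (deriv (deriv (deriv Γ))) t + α • S (deriv (deriv Γ)) t), R (w : X)⟫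
      + κ * ⟪G (c ^ 2 • S Γ t + b • S (deriv Γ) t), G (w : X)⟫ = 0

/-- The datum is first made harmonic for the form by subtracting its projection to `V`; the
correction in `V` solves the homogeneous exterior problem. The estimate measures the data only
modulo `V`, because the harmonic representative depends on nothing else. -/
theorem exists_isInhomSolutionOperator [CompleteSpace Y] [CompleteSpace H] [CompleteSpace V] {κ δ : ℝ} (hδ : 0 < δ)
    (hV : ∀ v : V, δ * ‖v‖ ^ 2 ≤ κ * ‖G (v : X)‖ ^ 2)
    {α b c : ℝ} (hb : 0 < b) (hγ : 0 < α - c ^ 2 / b) {T : ℝ} (hT : 0 < T) :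
    ∃ S, IsInhomSolutionOperator V G R κ α b c S ∧ ∃ C : ℝ, 0 ≤ C ∧
      ∀ Γ : ℝ → X, IsForcing Γ → ∀ M M' : ℝ,
        (∀ᵐ τ ∂(volume.restrict (Ioo 0 T)), ∃ w : V,
          ‖deriv (deriv (deriv Γ)) τ + α • deriv (deriv Γ) τ - w‖ ≤ M) →
        ∀ t ∈ Icc 0 T, (∃ w : V, ‖Γ t - w‖ ≤ M') → ‖S Γ t‖ ≤ C * (M + M') := by
  obtain ⟨P, hP1, hP2⟩ := exists_formProj hδ hV
  set L : X →L[ℝ] X := ContinuousLinearMap.id ℝ X - V.subtypeL.comp P with hL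
  have hLapp : ∀ u, L u = u - (P u : X) := fun u => rfl
  have hLV : ∀ (u : X) (w : V), L (u - w) = L u := by
    intro u w
    rw [map_sub, hLapp (w : X), hP1, sub_self, sub_zero]
  have hLe : ∀ (u : X) (w : V), κ * ⟪G (L u), G (w : X)⟫ = 0 := by
    intro u w
    rw [hLapp, map_sub, inner_sub_left, mul_sub, hP2, sub_self]
  set J : V →L[ℝ] H := R.comp V.subtypeL
  obtain ⟨W, hW, hWT⟩ := exists_isSolutionOperator (A := formOp V G κ) J (formOp_symm κ) hδ
    (formOp_coercive hV) hb hγ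
  obtain ⟨C, hC, hWC⟩ := hWT T hT
  -- The harmonic part `L Γ` drops out of the elliptic term, so only its `'''` and `α ''` terms are
  -- left as a force.
  set F : (ℝ → X) → ℝ → H := fun Γ t =>
    (-(R.comp L)) (deriv (deriv (deriv Γ)) t + α • deriv (deriv Γ) t) with hF
  have hFf : ∀ Γ, IsForcing Γ → IsForcing (F Γ) := fun Γ h =>
    (h.deriv.deriv.deriv.add (h.deriv.deriv.smul α)).clm _
  have hFd : ∀ Γ, IsForcing Γ → deriv (F Γ) = F (deriv Γ) := by
    intro Γ h
    refine ((h.deriv.deriv.deriv.add (h.deriv.deriv.smul α)).deriv_clm _).trans (funext fun t => ?_)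
    simp only [hF]
    congr 1
    exact ((h.deriv.deriv.deriv.hasDerivAt t).add ((h.deriv.deriv.hasDerivAt t).const_smul α)).deriv
  refine ⟨fun Γ t => L (Γ t) + (W (F Γ) t : X), ⟨?_, ?_, ?_, ?_⟩, ‖L‖ + C * (‖R‖ * ‖L‖),
    by positivity, ?_⟩
  · intro Γ h t ht
    simp only [h.zero t ht, hW.zero _ (hFf Γ h) t ht, map_zero, Submodule.coe_zero, add_zero]
  · intro Γ h t
    have h1 := L.hasFDerivAt.comp_hasDerivAt t (h.hasDerivAt t)
    have h2 := V.subtypeL.hasFDerivAt.comp_hasDerivAt t (hW.hasDerivAt _ (hFf Γ h) t)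
    rw [hFd Γ h] at h2
    exact h1.add h2
  · intro Γ h t
    have : L (Γ t) + (W (F Γ) t : X) - Γ t = ((W (F Γ) t - P (Γ t) : V) : X) := by
      rw [hLapp, Submodule.coe_sub]; abel
    simp only [this]
    exact SetLike.coe_mem _
  · intro Γ h t w
    have e := congrArg (fun z => ⟪z, w⟫) (hW.equation _ (hFf Γ h) t)
    simp only [hFd Γ h, hFd _ h.deriv, hFd _ h.deriv.deriv] at e
    simp only [inner_add_left, inner_formOp, ContinuousLinearMap.adjoint_inner_left,
      ContinuousLinearMap.comp_apply] at e
    have e1 : ∀ v : V, J v = R (v : X) := fun _ => rfl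
    have eF : F Γ t = -(R (L (deriv (deriv (deriv Γ)) t + α • deriv (deriv Γ) t))) := rfl
    rw [eF] at e
    simp only [e1, map_add, map_smul, inner_add_left, inner_neg_left, real_inner_smul_left,
      Submodule.coe_add, Submodule.coe_smul, mul_add] at e ⊢
    have k1 := hLe (Γ t) w
    have k2 := hLe (deriv Γ t) w
    linear_combination e + c ^ 2 * k1 + b * k2
  · intro Γ h M M' hM t ht hM'
    obtain ⟨w, hw⟩ := hM'
    have h1 : ‖L (Γ t)‖ ≤ ‖L‖ * M' := by
      rw [← hLV _ w]
      exact (L.le_opNorm _).trans (by gcongr)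
    have hcl : IsClosed {τ | ‖F Γ τ‖ ≤ ‖R‖ * ‖L‖ * M} :=
      isClosed_le (hFf Γ h).smooth.continuous.norm continuous_const
    have h2 : Icc 0 T ⊆ {τ | ‖F Γ τ‖ ≤ ‖R‖ * ‖L‖ * M} := by
      refine Icc_subset_of_ae hT hcl (hM.mono fun τ hτ => ?_)
      obtain ⟨w, hw⟩ := hτ
      have eF : F Γ τ = -(R (L (deriv (deriv (deriv Γ)) τ + α • deriv (deriv Γ) τ))) := rfl
      change ‖F Γ τ‖ ≤ _
      rw [eF, norm_neg, ← hLV _ w, mul_assoc]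
      exact (R.le_opNorm _).trans (by gcongr; exact (L.le_opNorm _).trans (by gcongr))
    have h3 : ‖W (F Γ) t‖ ≤ C * (‖R‖ * ‖L‖ * M) := hWC _ (hFf Γ h) _ h2 t ht
    have hM0 : 0 ≤ M' := (norm_nonneg _).trans hw
    have hM1 : 0 ≤ C * (‖R‖ * ‖L‖ * M) := (norm_nonneg _).trans h3
    -- The sign of `M` follows because the bound holds at some time: `Ioo 0 T` has positive measure.
    have hM2 : 0 ≤ ‖L‖ * M := by
      have hne : (ae (volume.restrict (Ioo 0 T))).NeBot := by
        rw [ae_neBot, Ne, Measure.restrict_eq_zero, Real.volume_Ioo]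
        simpa using hT
      obtain ⟨τ, w, hw⟩ := hM.exists
      exact mul_nonneg (norm_nonneg _) ((norm_nonneg _).trans hw)
    calc ‖L (Γ t) + (W (F Γ) t : X)‖ ≤ ‖L‖ * M' + C * (‖R‖ * ‖L‖ * M) :=
          (norm_add_le _ _).trans (add_le_add h1 h3)
      _ ≤ _ := by
          have : 0 ≤ C * (‖R‖ * ‖L‖) * M' := by positivity
          nlinarith

namespace IsInhomSolutionOperator

variable {κ α b c : ℝ} {S : (ℝ → X) → ℝ → X} {Γ : ℝ → X}

theorem deriv_eq (hS : IsInhomSolutionOperator V G R κ α b c S) (h : IsForcing Γ) :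
    deriv (S Γ) = S (deriv Γ) :=
  funext fun t => (hS.hasDerivAt Γ h t).deriv

theorem iteratedDeriv_eq (hS : IsInhomSolutionOperator V G R κ α b c S) (h : IsForcing Γ) (m : ℕ) :
    iteratedDeriv m (S Γ) = S (iteratedDeriv m Γ) := by
  induction m with
  | zero => simp
  | succ m ih => rw [iteratedDeriv_succ, iteratedDeriv_succ, ih, hS.deriv_eq (h.iteratedDeriv m)]

theorem isForcing (hS : IsInhomSolutionOperator V G R κ α b c S) (h : IsForcing Γ) :
    IsForcing (S Γ) := by
  refine ⟨contDiff_of_differentiable_iteratedDeriv fun m _ => ?_, hS.zero Γ h⟩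
  rw [hS.iteratedDeriv_eq h]
  exact fun t => (hS.hasDerivAt _ (h.iteratedDeriv m) t).differentiableAt

/-- The equation holds in `H`, with `f` and `f'` representing the functionals `κ ⟪G v, G w⟫` and
`κ ⟪G v', G w⟫`. -/
theorem exists_classical [CompleteSpace H] (hS : IsInhomSolutionOperator V G R κ α b c S) (h : IsForcing Γ)
    (hb : 0 < b) :
    ∃ f f' : ℝ → H, ∀ t,
      (∀ w : V, κ * ⟪G (S Γ t), G (w : X)⟫ = ⟪f t, R (w : X)⟫) ∧
      (∀ w : V, κ * ⟪G (S (deriv Γ) t), G (w : X)⟫ = ⟪f' t, R (w : X)⟫) ∧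
      R (S (deriv (deriv (deriv Γ))) t) + α • R (S (deriv (deriv Γ)) t)
        + c ^ 2 • f t + b • f' t = 0 := by
  set k : ℝ → H := fun t =>
    -(R (S (deriv (deriv (deriv Γ))) t) + α • R (S (deriv (deriv Γ)) t)) with hk
  have hkc : Continuous fun t => b⁻¹ • k t := by
    have h3 := (hS.isForcing h.deriv.deriv.deriv).smooth.continuous
    have h2 := (hS.isForcing h.deriv.deriv).smooth.continuous
    fun_prop
  set M : H →L[ℝ] H := (-(c ^ 2 / b)) • ContinuousLinearMap.id ℝ H
  -- The candidate for `(-Δ)ˢ v`: if `c² f + b f' = k` in `H` and `f 0 = 0`, then `f` must represent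
  -- the functional, which satisfies the same ODE.
  set f : ℝ → H := linSol M fun t => b⁻¹ • k t
  have hf : ∀ t, HasDerivAt f (-(c ^ 2 / b) • f t + b⁻¹ • k t) t := fun t =>
    hasDerivAt_linSol M hkc t
  have hf0 : f 0 = 0 := by simp [f, linSol]
  have hode : ∀ t (w : V), κ * ⟪G (c ^ 2 • S Γ t + b • S (deriv Γ) t), G (w : X)⟫
      = ⟪k t, R (w : X)⟫ := by
    intro t w
    have := hS.equation Γ h t w
    rw [map_add, map_smul] at this
    rw [hk, inner_neg_left]
    linarith
  have key : ∀ (w : V) t, κ * ⟪G (S Γ t), G (w : X)⟫ = ⟪f t, R (w : X)⟫ := by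
    intro w
    -- The defect satisfies `D' = -(c²/b) D` and `D 0 = 0`, so it vanishes.
    set D : ℝ → ℝ := fun t => κ * ⟪G (S Γ t), G (w : X)⟫ - ⟪f t, R (w : X)⟫ with hD
    have hDd : ∀ t, HasDerivAt D (-(c ^ 2 / b) * D t) t := by
      intro t
      have h1 := ((G.hasFDerivAt.comp_hasDerivAt t (hS.hasDerivAt Γ h t)).inner ℝ
        (hasDerivAt_const t (G (w : X)))).const_mul κ
      have h2 := (hf t).inner ℝ (hasDerivAt_const t (R (w : X)))
      refine (h1.sub h2).congr_deriv ?_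
      have e := hode t w
      simp only [map_add, map_smul, inner_add_left, real_inner_smul_left, inner_zero_right,
        zero_add, hD] at e ⊢
      field_simp
      linear_combination e
    have hE : ∀ t, HasDerivAt (fun t => Real.exp (c ^ 2 / b * t) * D t) 0 t := by
      intro t
      have h1 := (((hasDerivAt_id t).const_mul (c ^ 2 / b)).exp).mul (hDd t)
      refine h1.congr_deriv ?_
      simp only [id]
      ring
    intro t
    have hconst := is_const_of_deriv_eq_zero (fun t => (hE t).differentiableAt)
      (fun t => (hE t).deriv) t 0
    have h0 : D 0 = 0 := by simp [hD, hf0, hS.zero Γ h 0 le_rfl]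
    rw [h0, mul_zero] at hconst
    have := (mul_eq_zero.1 hconst).resolve_left (Real.exp_pos _).ne'
    simp only [hD] at this
    linarith
  refine ⟨f, fun t => -(c ^ 2 / b) • f t + b⁻¹ • k t, fun t => ⟨fun w => key w t, fun w => ?_, ?_⟩⟩
  · have e := hode t w
    have e' := key w t
    simp only [map_add, map_smul, inner_add_left, real_inner_smul_left] at e ⊢
    field_simp
    linear_combination e - c ^ 2 * e'
  · rw [smul_add, smul_smul, smul_smul, mul_inv_cancel₀ hb.ne', one_smul]
    have : b * -(c ^ 2 / b) = -c ^ 2 := by field_simp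
    rw [this]
    simp only [hk]
    module

end IsInhomSolutionOperator

end

end MGT

/-! ### Uniqueness in the dual space and the modal equations -/

namespace MGT

noncomputable section

local notation "⟪" x ", " y "⟫" => inner ℝ x y

theorem ContDiffOn.hasDerivAt_iteratedDeriv {Z : Type*} [NormedAddCommGroup Z] [NormedSpace ℝ Z]
    {D : ℝ → Z} {n k : ℕ} {U : Set ℝ} (hU : IsOpen U) (hD : ContDiffOn ℝ n D U) (hk : k < n)
    {t : ℝ} (ht : t ∈ U) : HasDerivAt (iteratedDeriv k D) (iteratedDeriv (k + 1) D t) t := by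
  have h1 : DifferentiableOn ℝ (iteratedDeriv k D) U :=
    (hD.differentiableOn_iteratedDerivWithin (m := k) (by exact_mod_cast hk)
      hU.uniqueDiffOn).congr fun x hx => (iteratedDerivWithin_of_isOpen hU hx).symm
  rw [iteratedDeriv_succ]
  exact ((h1 t ht).differentiableAt (hU.mem_nhds ht)).hasDerivAt

variable {X Y H : Type*} [NormedAddCommGroup X] [InnerProductSpace ℝ X]
  [NormedAddCommGroup Y] [InnerProductSpace ℝ Y]
  [NormedAddCommGroup H] [InnerProductSpace ℝ H]
  {V : Submodule ℝ X} {G : X →L[ℝ] Y} {R : X →L[ℝ] H}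

/-- The inverse of the operator which maps `v` to the functional `w ↦ κ ⟪G v, G w⟫`. -/
theorem exists_dual_inverse [CompleteSpace Y] [CompleteSpace V] {κ δ : ℝ} (hδ : 0 < δ)
    (hV : ∀ v : V, δ * ‖v‖ ^ 2 ≤ κ * ‖G (v : X)‖ ^ 2) :
    ∃ K : StrongDual ℝ V →L[ℝ] V, ∀ D w, ⟪formOp V G κ (K D), w⟫ = D w := by
  obtain ⟨Q, hQ1, hQ2⟩ := exists_inverse_of_coercive hδ (formOp_coercive (V := V) hV)
  let Φ : StrongDual ℝ V →ₗ[ℝ] V :=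
    { toFun := fun D => Q ((InnerProductSpace.toDual ℝ V).symm D)
      map_add' := fun D E => by rw [map_add, map_add]
      map_smul' := fun k D => by rw [map_smulₛₗ, conj_trivial, map_smul, RingHom.id_apply] }
  refine ⟨⟨Φ, Q.continuous.comp (InnerProductSpace.toDual ℝ V).symm.continuous⟩, fun D w => ?_⟩
  change ⟪formOp V G κ (Q ((InnerProductSpace.toDual ℝ V).symm D)), w⟫ = D w
  rw [hQ1, InnerProductSpace.toDual_symm_apply]

/-- Applying the inverse `K` of the form operator turns the dual-valued `D` into a `V`-valued
function regular enough for the energy method. It satisfies the homogeneous equation first almost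
everywhere, then by continuity at every interior time, so the estimate with `M = 0` makes it vanish.
-/
theorem eq_zero_of_weak_solution [CompleteSpace Y] [CompleteSpace H] [CompleteSpace V] {κ δ : ℝ} (hδ : 0 < δ)
    (hV : ∀ v : V, δ * ‖v‖ ^ 2 ≤ κ * ‖G (v : X)‖ ^ 2)
    {α b c : ℝ} (hb : 0 < b) (hγ : 0 < α - c ^ 2 / b) {T : ℝ} (hT : 0 < T)
    {D : ℝ → StrongDual ℝ V} (h2 : ContDiffOn ℝ 2 D (Icc 0 T)) (h3 : ContDiffOn ℝ 3 D (Ioo 0 T))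
    (h0 : ∀ k ∈ Finset.range 3, iteratedDerivWithin k D (Icc 0 T) 0 = 0)
    (hae : ∀ᵐ t ∂(volume.restrict (Ioo 0 T)), ∃ z : V,
      (∀ w : V, ⟪R (z : X), R (w : X)⟫ = (c ^ 2 • D t + b • deriv D t) w) ∧
      ∀ w : V, (iteratedDeriv 3 D t + α • iteratedDeriv 2 D t) w
        + κ * ⟪G (z : X), G (w : X)⟫ = 0) :
    ∀ t ∈ Icc 0 T, D t = 0 := by
  obtain ⟨K, hK⟩ := exists_dual_inverse (V := V) hδ hV
  have hinj : ∀ {x y : V}, formOp V G κ x = formOp V G κ y → x = y := by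
    obtain ⟨Q, -, hQ2⟩ := exists_inverse_of_coercive hδ (formOp_coercive (V := V) hV)
    intro x y h
    rw [← hQ2 x, h, hQ2]
  set J : V →L[ℝ] H := R.comp V.subtypeL
  set A := formOp V G κ with hA
  set w : ℕ → ℝ → V := fun k t => K (iteratedDerivWithin k D (Icc 0 T) t) with hw
  set w3 : ℝ → V := fun t => K (iteratedDeriv 3 D t) with hw3
  have hun := uniqueDiffOn_Icc hT
  have heqd : ∀ k ≤ 2, ∀ t ∈ Ioo 0 T,
      iteratedDerivWithin k D (Icc 0 T) t = iteratedDeriv k D t := fun k hk t ht =>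
    iteratedDerivWithin_eq_iteratedDeriv hun
      ((h3.contDiffAt (isOpen_Ioo.mem_nhds ht)).of_le (by exact_mod_cast hk.trans (by norm_num)))
      (Ioo_subset_Icc_self ht)
  have hcont : ∀ k ≤ 2, ContinuousOn (w k) (Icc 0 T) := fun k hk =>
    K.continuous.comp_continuousOn
      (h2.continuousOn_iteratedDerivWithin (by exact_mod_cast hk) hun)
  have hder : ∀ k ≤ 2, ∀ t ∈ Ioo 0 T,
      HasDerivAt (w k) (K (iteratedDeriv (k + 1) D t)) t := by
    intro k hk t ht
    have h1 := K.hasFDerivAt.comp_hasDerivAt t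
      (ContDiffOn.hasDerivAt_iteratedDeriv isOpen_Ioo (n := 3) (k := k) h3 (by omega) ht)
    refine h1.congr_of_eventuallyEq ?_
    filter_upwards [isOpen_Ioo.mem_nhds ht] with τ hτ
    simp only [hw, Function.comp_apply, heqd k hk τ hτ]
  have hzero : ∀ k ≤ 2, w k 0 = 0 := fun k hk => by
    simp only [hw, h0 k (Finset.mem_range.2 (by omega)), map_zero]
  have hEq : ∀ t ∈ Ioo 0 T, (J.adjoint.comp J) (w3 t + α • w 2 t)
      + A (c ^ 2 • w 0 t + b • w 1 t) = 0 := by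
    have hc3 : ContinuousOn w3 (Ioo 0 T) := by
      refine K.continuous.comp_continuousOn ?_
      refine (h3.continuousOn_iteratedDerivWithin (m := 3) le_rfl isOpen_Ioo.uniqueDiffOn).congr
        fun x hx => (iteratedDerivWithin_of_isOpen isOpen_Ioo hx).symm
    have hc : ContinuousOn (fun t => (J.adjoint.comp J) (w3 t + α • w 2 t)
        + A (c ^ 2 • w 0 t + b • w 1 t)) (Ioo 0 T) := by
      have k0 := (hcont 0 (by norm_num)).mono Ioo_subset_Icc_self
      have k1 := (hcont 1 (by norm_num)).mono Ioo_subset_Icc_self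
      have k2 := (hcont 2 (by norm_num)).mono Ioo_subset_Icc_self
      fun_prop
    refine Measure.eqOn_open_of_ae_eq (μ := volume) ?_ isOpen_Ioo hc continuousOn_const
    filter_upwards [hae, ae_restrict_mem measurableSet_Ioo] with t hz ht
    obtain ⟨z, hz1, hz2⟩ := hz
    -- The variational identity says that `-A z` is the functional `D''' + α D''`, whose preimage
    -- under `A` is `w3 + α w2`.
    have e1 : z = -(w3 t + α • w 2 t) := by
      refine hinj (ext_inner_right ℝ fun v => ?_)
      have k := hz2 v
      rw [inner_formOp, map_neg, inner_neg_left]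
      have : ⟪formOp V G κ (w3 t + α • w 2 t), v⟫
          = (iteratedDeriv 3 D t + α • iteratedDeriv 2 D t) v := by
        rw [← hK]
        simp only [hw3, hw, heqd 2 le_rfl t ht, map_add, map_smul, hA]
      linarith
    -- The other information on `z`: as a functional, `J*J z` is `c² D + b D'`. Eliminating `z`
    -- gives the equation for `w`.
    have e2 : A (c ^ 2 • w 0 t + b • w 1 t) = (J.adjoint.comp J) z := by
      refine ext_inner_right ℝ fun v => ?_
      have k := hz1 v
      have : ⟪A (c ^ 2 • w 0 t + b • w 1 t), v⟫ = (c ^ 2 • D t + b • deriv D t) v := by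
        rw [← hK]
        simp only [hw, heqd 0 (by norm_num) t ht, heqd 1 (by norm_num) t ht, map_add, map_smul,
          iteratedDeriv_zero, iteratedDeriv_one, hA]
      rw [this, ← k, ContinuousLinearMap.comp_apply, ContinuousLinearMap.adjoint_inner_left]
      rfl
    change (J.adjoint.comp J) (w3 t + α • w 2 t) + A (c ^ 2 • w 0 t + b • w 1 t) = 0
    rw [e2, e1, map_neg]
    exact add_neg_cancel _
  have hBapp : ∀ x y : V, ⟪(J.adjoint.comp J) x, y⟫ = ⟪J x, J y⟫ := fun x y => by
    rw [ContinuousLinearMap.comp_apply, ContinuousLinearMap.adjoint_inner_left]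
  have hfin := energy_estimate (A := A) (B := J.adjoint.comp J) (F := fun _ => 0) (T := T) (M := 0)
    (w0 := w 0) (w1 := w 1) (w2 := w 2) (w3 := w3) (β := ‖J‖ ^ 2)
    (fun x y => (hBapp x y).trans (ContinuousLinearMap.adjoint_inner_right J x (J y)).symm)
    (fun x => by rw [hBapp, real_inner_self_eq_norm_sq]; positivity)
    (fun x => by
      rw [hBapp, real_inner_self_eq_norm_sq, ← mul_pow]
      exact pow_le_pow_left₀ (norm_nonneg _) (J.le_opNorm x) 2)
    (formOp_symm κ) hδ (formOp_coercive hV) hb hγ (sq_nonneg _)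
    (hcont 0 (by norm_num)) (hcont 1 (by norm_num)) (hcont 2 le_rfl)
    (fun t ht => by
      have := hder 0 (by norm_num) t ht
      rwa [← heqd 1 (by norm_num) t ht] at this)
    (fun t ht => by
      have := hder 1 (by norm_num) t ht
      rwa [← heqd 2 le_rfl t ht] at this)
    (fun t ht => hder 2 le_rfl t ht) hEq
    (fun t ht => by
      rw [inner_zero_left, hBapp, real_inner_self_eq_norm_sq]; positivity)
    (hzero 0 (by norm_num)) (hzero 1 (by norm_num)) (hzero 2 le_rfl)
  intro t ht
  have h1 := hfin t ht
  have h4 : w 0 t = 0 := by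
    have : ‖w 0 t‖ ^ 2 ≤ 0 := h1.trans_eq (by ring)
    exact norm_eq_zero.1 (pow_eq_zero_iff two_ne_zero |>.1 (le_antisymm this (sq_nonneg _)))
  ext v
  rw [← hK]
  have : K (D t) = 0 := by simpa [hw] using h4
  rw [this, map_zero, inner_zero_left]
  rfl

namespace IsInhomSolutionOperator

variable {κ α b c : ℝ} {S : (ℝ → X) → ℝ → X} {Γ : ℝ → X}

/-- The coefficients of the solution with respect to eigenvectors are given by Duhamel's formula. -/
theorem coeff_eq (hS : IsInhomSolutionOperator V G R κ α b c S) (h : IsForcing Γ)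
    (hR : ∀ t, R (Γ t) = 0) {φ : V} {lam : ℝ} (hlam : lam ≠ 0)
    (hφ : ∀ w : V, κ * ⟪G (φ : X), G (w : X)⟫ = ⟪lam • R (φ : X), R (w : X)⟫)
    {μ : Fin 3 → ℂ} (hμ : AreRoots α b c lam μ) (t : ℝ) :
    ∫ τ in (0 : ℝ)..t, (κ * ⟪G (Γ τ), G (φ : X)⟫) * (1 / lam) * kernel α μ (t - τ)
      = ⟪R (φ : X), R (S Γ t)⟫ := by
  have hd : ∀ Γ, IsForcing Γ → ∀ t, HasDerivAt (fun t => ⟪R (φ : X), R (S Γ t)⟫)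
      ⟪R (φ : X), R (S (deriv Γ) t)⟫ t := fun Γ h t =>
    (((innerSL ℝ (R (φ : X))).comp R).hasFDerivAt.comp_hasDerivAt t (hS.hasDerivAt Γ h t))
  have hGd : ∀ t, HasDerivAt (fun t => κ * ⟪G (Γ t), G (φ : X)⟫)
      (κ * ⟪G (deriv Γ t), G (φ : X)⟫) t := fun t => by
    have h1 := ((G.hasFDerivAt.comp_hasDerivAt t (h.hasDerivAt t)).inner ℝ
      (hasDerivAt_const t (G (φ : X)))).const_mul κ
    refine h1.congr_deriv ?_
    rw [inner_zero_right, zero_add]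
  have hR' : ∀ t, R (deriv Γ t) = 0 := fun t => by
    have h1 := R.hasFDerivAt.comp_hasDerivAt t (h.hasDerivAt t)
    have h2 : (R ∘ Γ) = fun _ => 0 := funext hR
    rw [h2] at h1
    exact h1.unique (hasDerivAt_const t 0)
  -- The eigenvalue equation is tested with `S Γ - Γ`, which lies in `V`. As `R Γ = 0`, the exterior
  -- datum survives only in the energy term, and that term is the source of the scalar ODE.
  have hsplit : ∀ Γ, IsForcing Γ → (∀ t, R (Γ t) = 0) → ∀ t,
      κ * ⟪G (S Γ t), G (φ : X)⟫ = κ * ⟪G (Γ t), G (φ : X)⟫ + lam * ⟪R (φ : X), R (S Γ t)⟫ := by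
    intro Γ h hR t
    have e := hφ ⟨S Γ t - Γ t, hS.exterior Γ h t⟩
    simp only [map_sub, inner_sub_right, hR t, sub_zero, real_inner_smul_left] at e
    rw [real_inner_comm, real_inner_comm (G (φ : X)) (G (Γ t))]
    linear_combination e
  refine duhamel_kernel hlam hμ (hd Γ h) (hd _ h.deriv) (hd _ h.deriv.deriv) hGd (fun t => ?_)
    ?_ ?_ ?_ ?_ t
  · have e := hS.equation Γ h t φ
    have e0 := hsplit Γ h hR t
    have e1 := hsplit _ h.deriv hR' t
    rw [real_inner_comm] at e
    simp only [map_add, map_smul, inner_add_left, inner_add_right, real_inner_smul_left,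
      real_inner_smul_right, mul_add] at e ⊢
    linear_combination e - c ^ 2 * e0 - b * e1
  · rw [hS.zero Γ h 0 le_rfl, map_zero, inner_zero_right]
  · rw [hS.zero _ h.deriv 0 le_rfl, map_zero, inner_zero_right]
  · rw [hS.zero _ h.deriv.deriv 0 le_rfl, map_zero, inner_zero_right]
  · rw [h.zero 0 le_rfl, map_zero, inner_zero_left, mul_zero]

end IsInhomSolutionOperator

end

end MGT

/-! ### Functionals induced by solutions; comparison of two weak solutions -/

namespace MGT

noncomputable section

local notation "⟪" x ", " y "⟫" => inner ℝ x y

/-- The transpose of `J`, with values in the dual space. -/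
def dualMap {V H : Type*} [NormedAddCommGroup V] [InnerProductSpace ℝ V]
    [NormedAddCommGroup H] [InnerProductSpace ℝ H] (J : V →L[ℝ] H) : H →L[ℝ] StrongDual ℝ V :=
  ⟨{ toFun := fun f => (innerSL ℝ f).comp J
     map_add' := fun f g => by ext v; simp
     map_smul' := fun k f => by ext v; simp },
   AddMonoidHomClass.continuous_of_bound
    ({ toFun := fun f => (innerSL ℝ f).comp J
       map_add' := fun f g => by ext v; simp
       map_smul' := fun k f => by ext v; simp } : H →ₗ[ℝ] StrongDual ℝ V)
    ‖J‖ fun f => by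
      refine (ContinuousLinearMap.opNorm_comp_le _ _).trans_eq ?_
      rw [innerSL_apply_norm, mul_comm]⟩

theorem IsForcing.iteratedDeriv_clm {Z Z' : Type*} [NormedAddCommGroup Z] [NormedSpace ℝ Z]
    [NormedAddCommGroup Z'] [NormedSpace ℝ Z'] {f : ℝ → Z} (hf : IsForcing f) (L : Z →L[ℝ] Z')
    (m : ℕ) :
    _root_.iteratedDeriv m (fun t => L (f t)) = fun t => L (_root_.iteratedDeriv m f t) := by
  induction m with
  | zero => simp
  | succ m ih => rw [iteratedDeriv_succ, ih, (hf.iteratedDeriv m).deriv_clm, iteratedDeriv_succ]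

theorem IsForcing.iteratedDerivWithin_eq {Z : Type*} [NormedAddCommGroup Z] [NormedSpace ℝ Z]
    {f : ℝ → Z} (hf : IsForcing f) {T : ℝ} (hT : 0 < T) (m : ℕ) {t : ℝ} (ht : t ∈ Icc 0 T) :
    iteratedDerivWithin m f (Icc 0 T) t = _root_.iteratedDeriv m f t :=
  iteratedDerivWithin_eq_iteratedDeriv (uniqueDiffOn_Icc hT)
    (hf.smooth.contDiffAt.of_le (by exact_mod_cast le_top)) ht

variable {X Y H : Type*} [NormedAddCommGroup X] [InnerProductSpace ℝ X]
  [NormedAddCommGroup Y] [InnerProductSpace ℝ Y]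
  [NormedAddCommGroup H] [InnerProductSpace ℝ H]
  {V : Submodule ℝ X} {G : X →L[ℝ] Y} {R : X →L[ℝ] H}

/-- The functional `w ↦ ⟪R u, R w⟫` on `V`. -/
def functionalOf (V : Submodule ℝ X) (R : X →L[ℝ] H) : X →L[ℝ] StrongDual ℝ V :=
  (dualMap (R.comp V.subtypeL)).comp R

theorem functionalOf_apply (u : X) (w : V) : functionalOf V R u w = ⟪R u, R (w : X)⟫ := rfl

namespace IsInhomSolutionOperator

variable {κ α b c T : ℝ} {S : (ℝ → X) → ℝ → X} {Γ : ℝ → X}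

theorem iteratedDerivWithin_eq (hS : IsInhomSolutionOperator V G R κ α b c S) (h : IsForcing Γ)
    (hT : 0 < T) (m : ℕ) {t : ℝ} (ht : t ∈ Icc 0 T) :
    iteratedDerivWithin m (S Γ) (Icc 0 T) t = S (iteratedDeriv m Γ) t :=
  ((hS.isForcing h).iteratedDerivWithin_eq hT m ht).trans (congrFun (hS.iteratedDeriv_eq h m) t)

theorem exists_classical_iteratedDerivWithin [CompleteSpace H]
    (hS : IsInhomSolutionOperator V G R κ α b c S) (h : IsForcing Γ) (hb : 0 < b) (hT : 0 < T)
    {t : ℝ} (ht : t ∈ Icc 0 T) :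
    ∃ f f' : H,
      (∀ w : V, κ * ⟪G (S Γ t), G (w : X)⟫ = ⟪f, R (w : X)⟫) ∧
      (∀ w : V, κ * ⟪G (iteratedDerivWithin 1 (S Γ) (Icc 0 T) t), G (w : X)⟫ = ⟪f', R (w : X)⟫) ∧
      R (iteratedDerivWithin 3 (S Γ) (Icc 0 T) t) + α • R (iteratedDerivWithin 2 (S Γ) (Icc 0 T) t)
        + c ^ 2 • f + b • f' = 0 := by
  obtain ⟨f, f', H⟩ := hS.exists_classical h hb
  refine ⟨f t, f' t, (H t).1, ?_, ?_⟩
  · rw [hS.iteratedDerivWithin_eq h hT 1 ht, iteratedDeriv_one]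
    exact (H t).2.1
  · rw [hS.iteratedDerivWithin_eq h hT 3 ht, hS.iteratedDerivWithin_eq h hT 2 ht, iteratedDeriv_succ,
      iteratedDeriv_succ, iteratedDeriv_one]
    exact (H t).2.2

theorem iteratedDeriv_clm {Z : Type*} [NormedAddCommGroup Z] [NormedSpace ℝ Z] (L : X →L[ℝ] Z)
    (hS : IsInhomSolutionOperator V G R κ α b c S) (h : IsForcing Γ) (m : ℕ) (t : ℝ) :
    iteratedDeriv m (fun τ => L (S Γ τ)) t = L (S (iteratedDeriv m Γ) t) := by
  rw [(hS.isForcing h).iteratedDeriv_clm L m, hS.iteratedDeriv_eq h m]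

theorem iteratedDeriv_functionalOf (hS : IsInhomSolutionOperator V G R κ α b c S)
    (h : IsForcing Γ) (m : ℕ) (t : ℝ) :
    iteratedDeriv m (fun τ => functionalOf V R (S Γ τ)) t
      = functionalOf V R (S (iteratedDeriv m Γ) t) :=
  hS.iteratedDeriv_clm (Z := StrongDual ℝ V) (functionalOf V R) h m t

theorem isForcing_functionalOf (hS : IsInhomSolutionOperator V G R κ α b c S) (h : IsForcing Γ) :
    IsForcing fun τ => functionalOf V R (S Γ τ) :=
  (hS.isForcing h).clm (Z' := StrongDual ℝ V) (functionalOf V R)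

theorem contDiff_functionalOf (hS : IsInhomSolutionOperator V G R κ α b c S) (h : IsForcing Γ)
    (n : ℕ) : ContDiff ℝ n fun τ => functionalOf V R (S Γ τ) :=
  (hS.isForcing_functionalOf h).smooth.of_le (by exact_mod_cast le_top)

theorem iteratedDerivWithin_functionalOf (hS : IsInhomSolutionOperator V G R κ α b c S)
    (h : IsForcing Γ) (hT : 0 < T) (m : ℕ) :
    iteratedDerivWithin m (fun τ => functionalOf V R (S Γ τ)) (Icc 0 T) 0 = 0 :=
  ((hS.isForcing_functionalOf h).iteratedDerivWithin_eq hT m ⟨le_rfl, hT.le⟩).trans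
    (((hS.isForcing_functionalOf h).iteratedDeriv m).zero 0 le_rfl)

theorem functionalOf_eq (hS : IsInhomSolutionOperator V G R κ α b c S) (h : IsForcing Γ) (t : ℝ) :
    functionalOf V R (c ^ 2 • S Γ t + b • S (deriv Γ) t) = c ^ 2 • functionalOf V R (S Γ t)
      + b • deriv (fun τ => functionalOf V R (S Γ τ)) t := by
  have h1 := hS.iteratedDeriv_functionalOf h 1 t
  rw [iteratedDeriv_one, iteratedDeriv_one] at h1
  rw [h1, map_add, map_smul, map_smul]

theorem variational (hS : IsInhomSolutionOperator V G R κ α b c S) (h : IsForcing Γ) (t : ℝ)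
    (w : V) :
    (iteratedDeriv 3 (fun τ => functionalOf V R (S Γ τ)) t
      + α • iteratedDeriv 2 (fun τ => functionalOf V R (S Γ τ)) t) w
      + κ * ⟪G (c ^ 2 • S Γ t + b • S (deriv Γ) t), G (w : X)⟫ = 0 := by
  rw [hS.iteratedDeriv_functionalOf h, hS.iteratedDeriv_functionalOf h, iteratedDeriv_succ,
    iteratedDeriv_succ, iteratedDeriv_one, ← hS.equation Γ h t w]
  simp only [map_add, map_smul, inner_add_left, add_apply, smul_apply, functionalOf_apply,
    real_inner_smul_left, smul_eq_mul]

theorem exterior_combination (hS : IsInhomSolutionOperator V G R κ α b c S) (h : IsForcing Γ)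
    {t : ℝ} {p : X} (hp : deriv Γ t = p) :
    c ^ 2 • S Γ t + b • S (deriv Γ) t - (c ^ 2 • Γ t + b • p) ∈ V := by
  have e : c ^ 2 • S Γ t + b • S (deriv Γ) t - (c ^ 2 • Γ t + b • p)
      = c ^ 2 • (S Γ t - Γ t) + b • (S (deriv Γ) t - deriv Γ t) := by rw [hp]; module
  rw [e]
  exact V.add_mem (V.smul_mem _ (hS.exterior _ h t)) (V.smul_mem _ (hS.exterior _ h.deriv t))

end IsInhomSolutionOperator

/-- Two weak solutions with the same exterior data agree. -/
theorem weak_solution_unique [CompleteSpace Y] [CompleteSpace H] [CompleteSpace V]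
    {κ δ : ℝ} (hδ : 0 < δ)
    (hV : ∀ v : V, δ * ‖v‖ ^ 2 ≤ κ * ‖G (v : X)‖ ^ 2)
    {α b c : ℝ} (hb : 0 < b) (hγ : 0 < α - c ^ 2 / b) {T : ℝ} (hT : 0 < T)
    {D D' : ℝ → StrongDual ℝ V}
    (h2 : ContDiffOn ℝ 2 D (Icc 0 T)) (h3 : ContDiffOn ℝ 3 D (Ioo 0 T))
    (h0 : ∀ k ∈ Finset.range 3, iteratedDerivWithin k D (Icc 0 T) 0 = 0)
    (h2' : ContDiffOn ℝ 2 D' (Icc 0 T)) (h3' : ContDiffOn ℝ 3 D' (Ioo 0 T))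
    (h0' : ∀ k ∈ Finset.range 3, iteratedDerivWithin k D' (Icc 0 T) 0 = 0)
    (hae : ∀ᵐ t ∂(volume.restrict (Ioo 0 T)), ∃ z z' : X, z - z' ∈ V ∧
      functionalOf V R z = c ^ 2 • D t + b • deriv D t ∧
      functionalOf V R z' = c ^ 2 • D' t + b • deriv D' t ∧
      (∀ w : V, (iteratedDeriv 3 D t + α • iteratedDeriv 2 D t) w + κ * ⟪G z, G (w : X)⟫ = 0) ∧
      ∀ w : V, (iteratedDeriv 3 D' t + α • iteratedDeriv 2 D' t) w + κ * ⟪G z', G (w : X)⟫ = 0) :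
    ∀ t ∈ Icc 0 T, D t = D' t := by
  have hun := uniqueDiffOn_Icc hT
  have hsub : ∀ k ≤ 3, ∀ t ∈ Ioo 0 T,
      iteratedDeriv k (D - D') t = iteratedDeriv k D t - iteratedDeriv k D' t := by
    intro k hk t ht
    have hk' : (k : ℕ∞ω) ≤ 3 := by exact_mod_cast hk
    exact iteratedDeriv_sub ((h3.contDiffAt (isOpen_Ioo.mem_nhds ht)).of_le hk')
      ((h3'.contDiffAt (isOpen_Ioo.mem_nhds ht)).of_le hk')
  have key := eq_zero_of_weak_solution (D := D - D') hδ hV hb hγ hT (h2.sub h2') (h3.sub h3')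
    (fun k hk => by
      have hk' : (k : ℕ∞ω) ≤ 2 := by
        have := Finset.mem_range.1 hk
        exact_mod_cast Nat.le_of_lt_succ this
      have h00 : (0 : ℝ) ∈ Icc 0 T := ⟨le_rfl, hT.le⟩
      rw [iteratedDerivWithin_sub h00 hun ((h2 0 h00).of_le hk') ((h2' 0 h00).of_le hk'), h0 k hk,
        h0' k hk, sub_zero])
    (by
      filter_upwards [hae, ae_restrict_mem measurableSet_Ioo] with t hz ht
      obtain ⟨z, z', hm, e1, e1', e2, e2'⟩ := hz
      have s1 := hsub 1 (by norm_num) t ht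
      simp only [iteratedDeriv_one] at s1
      refine ⟨⟨z - z', hm⟩, fun w => ?_, fun w => ?_⟩
      · change functionalOf V R (z - z') w = _
        rw [map_sub, e1, e1', s1, Pi.sub_apply]
        congr 1
        module
      · have k1 := e2 w
        have k2 := e2' w
        rw [hsub 3 le_rfl t ht, hsub 2 (by norm_num) t ht]
        simp only [add_apply, smul_apply, sub_apply, map_sub, inner_sub_left, smul_eq_mul]
          at k1 k2 ⊢
        linear_combination k1 - k2)
  intro t ht
  exact sub_eq_zero.1 (key t ht)

end

end MGT

/-! ### Test functions as smooth curves in `W^{s,2}(ℝᴺ)` -/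

namespace MGT

noncomputable section

variable {N : ℕ} {s : ℝ}

/-- Continuous functions supported in the ball of radius `r`, bounded by `M` and with Lipschitz
constant `M`. -/
structure IsLipschitzBump (r M : ℝ) (u : RN N → ℝ) : Prop where
  continuous : Continuous u
  bound : ∀ x, |u x| ≤ M
  lipschitz : ∀ x y, |u x - u y| ≤ M * ‖x - y‖
  support : ∀ x, r < ‖x‖ → u x = 0

/-- The squared increment is at most `4 M²` times the truncated factor of `tailKernel`, and it
vanishes unless one of the two points lies in the fixed ball. -/
theorem exists_sobolevSq_le_of_isLipschitzBump (hN : 1 ≤ N) (hs0 : 0 < s) (hs1 : s < 1) (r : ℝ) :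
    ∃ C : ℝ≥0, ∀ (M : ℝ) (u : RN N → ℝ), IsLipschitzBump r M u →
      sobolevSq s univ u ≤ C * ENNReal.ofReal (M ^ 2) := by
  set B : Set (RN N) := Metric.closedBall 0 r with hB
  have hBm : MeasurableSet B := measurableSet_closedBall
  have hBv : volume B ≠ ⊤ := measure_closedBall_lt_top.ne
  have hfin := tailMass_ne_top hN hs0 hs1
  have hmem : ∀ {M : ℝ} {u : RN N → ℝ}, IsLipschitzBump r M u → ∀ x ∉ B, u x = 0 := by
    intro M u hu x hx
    exact hu.support x (by simpa [hB] using hx)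
  refine ⟨(volume B).toNNReal + (tailMass N s).toNNReal * (4 * (volume B).toNNReal)
    + (tailMass N s).toNNReal * (4 * (volume B).toNNReal), fun M u hu => ?_⟩
  set φ : RN N → ℝ≥0∞ := B.indicator fun _ => 4 * ENNReal.ofReal (M ^ 2) with hφ
  have hφm : Measurable φ := measurable_const.indicator hBm
  have hφi : ∫⁻ x in univ, φ x = 4 * ENNReal.ofReal (M ^ 2) * volume B := by
    rw [Measure.restrict_univ, lintegral_indicator hBm, setLIntegral_const]
  have h1 : ∫⁻ x in univ, ‖u x‖ₑ ^ 2 ≤ ENNReal.ofReal (M ^ 2) * volume B := by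
    rw [Measure.restrict_univ, ← setLIntegral_const, ← lintegral_indicator hBm]
    refine lintegral_mono fun x => ?_
    by_cases hx : x ∈ B
    · rw [indicator_of_mem hx, enorm_sq_eq_ofReal]
      exact ENNReal.ofReal_le_ofReal (sq_le_sq' (abs_le.1 (hu.bound x)).1 (abs_le.1 (hu.bound x)).2)
    · simp [hmem hu x hx]
  have hpt : ∀ x y, u x ≠ u y → ‖diffQuot s u (x, y)‖ₑ ^ 2
      ≤ 4 * ENNReal.ofReal (M ^ 2) * ENNReal.ofReal (tailKernel N s (x - y)) := by
    intro x y hxy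
    have hM : 0 ≤ M := (abs_nonneg _).trans (hu.bound x)
    rw [enorm_sq_eq_ofReal, ← ENNReal.ofReal_ofNat 4, ← ENNReal.ofReal_mul (by norm_num),
      ← ENNReal.ofReal_mul (by positivity)]
    refine ENNReal.ofReal_le_ofReal ?_
    rw [diffQuot_sq, tailKernel, ← mul_div_assoc]
    refine div_le_div_of_nonneg_right ?_ (by positivity)
    have e1 : (u x - u y) ^ 2 ≤ M ^ 2 * ‖x - y‖ ^ 2 := by
      rw [← mul_pow, ← sq_abs]
      exact pow_le_pow_left₀ (abs_nonneg _) (hu.lipschitz x y) 2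
    have e2 : (u x - u y) ^ 2 ≤ (2 * M) ^ 2 := by
      rw [← sq_abs]
      refine pow_le_pow_left₀ (abs_nonneg _) ?_ 2
      have := abs_sub (u x) (u y)
      linarith [hu.bound x, hu.bound y]
    rcases le_total (‖x - y‖ ^ 2) 1 with h | h
    · rw [min_eq_left h]; nlinarith [sq_nonneg (u x - u y)]
    · rw [min_eq_right h]; nlinarith
  have h2 := lintegral_diffQuot_le (s := s) (A := univ) MeasurableSet.univ (u := u) (φ := φ) (ψ := φ)
    (w := fun _ _ => 0) hφm hφm fun x _ y _ => by
      by_cases hxy : u x = u y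
      · simp [diffQuot, hxy]
      rw [zero_add]
      by_cases hx : x ∈ B
      · rw [hφ, indicator_of_mem hx]
        exact (hpt x y hxy).trans le_self_add
      · have hy : y ∈ B := by
          by_contra hy
          exact hxy ((hmem hu x hx).trans (hmem hu y hy).symm)
        rw [hφ, indicator_of_mem hy]
        exact (hpt x y hxy).trans le_add_self
  rw [hφi] at h2
  simp only [lintegral_zero, zero_add] at h2
  refine (add_le_add h1 h2).trans (le_of_eq ?_)
  push_cast
  rw [ENNReal.coe_toNNReal hBv, ENNReal.coe_toNNReal hfin]
  ring

theorem exists_norm_ofFun_le (hN : 1 ≤ N) (hs0 : 0 < s) (hs1 : s < 1) (r : ℝ) :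
    ∃ C : ℝ, 0 ≤ C ∧ ∀ (M : ℝ) (u : RN N → ℝ), IsLipschitzBump r M u →
      toL2 N s (ofFun s u) =ᵐ[volume] u ∧ (0 ≤ M → ‖ofFun s u‖ ≤ C * M) := by
  obtain ⟨C, hC⟩ := exists_sobolevSq_le_of_isLipschitzBump (s := s) hN hs0 hs1 r
  refine ⟨Real.sqrt C, Real.sqrt_nonneg _, fun M u hu => ?_⟩
  have h1 := hC M u hu
  have hne : sobolevSq s univ u ≠ ⊤ :=
    (h1.trans_lt (ENNReal.mul_lt_top ENNReal.coe_lt_top ENNReal.ofReal_lt_top)).ne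
  refine ⟨coeFn_ofFun hu.continuous.measurable hne, fun hM => ?_⟩
  have h2 : ENNReal.ofReal (‖ofFun s u‖ ^ 2) ≤ ENNReal.ofReal (C * M ^ 2) := by
    rw [← enorm_sq_eq_ofReal_norm, ofFun_enorm_sq hu.continuous.measurable hne,
      ENNReal.ofReal_mul C.coe_nonneg, ENNReal.ofReal_coe_nnreal]
    exact h1
  rw [ENNReal.ofReal_le_ofReal_iff (by positivity)] at h2
  refine le_of_sq_le_sq ?_ (by positivity)
  rw [mul_pow, Real.sq_sqrt C.coe_nonneg]
  exact h2

theorem abs_taylor_le {k k1 k2 : ℝ → ℝ} (h0 : ∀ t, HasDerivAt k (k1 t) t)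
    (h1 : ∀ t, HasDerivAt k1 (k2 t) t) {B : ℝ} (hB : ∀ t, |k2 t| ≤ B) (t h : ℝ) :
    |k (t + h) - k t - h * k1 t| ≤ B * h ^ 2 := by
  have e1 : ∀ τ, |k1 τ - k1 t| ≤ B * |τ - t| := fun τ =>
    convex_univ.norm_image_sub_le_of_norm_hasDerivWithin_le
      (fun x _ => (h1 x).hasDerivWithinAt) (fun x _ => hB x) (mem_univ _) (mem_univ _)
  have hB0 : 0 ≤ B := (abs_nonneg _).trans (hB 0)
  have e2 := (convex_uIcc t (t + h)).norm_image_sub_le_of_norm_hasDerivWithin_le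
    (f := fun τ => k τ - τ * k1 t) (f' := fun τ => k1 τ - k1 t) (C := B * |h|)
    (fun x _ => ((h0 x).sub (by simpa using (hasDerivAt_id x).mul_const (k1 t))).hasDerivWithinAt)
    (fun x hx => (e1 x).trans (mul_le_mul_of_nonneg_left
      (by simpa using abs_sub_left_of_mem_uIcc hx) hB0)) left_mem_uIcc right_mem_uIcc
  simp only [Real.norm_eq_abs] at e2
  have e3 : k (t + h) - (t + h) * k1 t - (k t - t * k1 t) = k (t + h) - k t - h * k1 t := by ring
  rw [e3, add_sub_cancel_left, mul_assoc, abs_mul_abs_self] at e2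
  rwa [sq]

theorem coeFn_toL2_sub {p q : sobolev N s} {u v : RN N → ℝ} (hp : toL2 N s p =ᵐ[volume] u)
    (hq : toL2 N s q =ᵐ[volume] v) : toL2 N s (p - q) =ᵐ[volume] fun x => u x - v x := by
  have h : toL2 N s (p - q) = toL2 N s p - toL2 N s q := map_sub _ _ _
  rw [h]
  exact (Lp.coeFn_sub _ _).trans (hp.sub hq)

theorem coeFn_toL2_add {p q : sobolev N s} {u v : RN N → ℝ} (hp : toL2 N s p =ᵐ[volume] u)
    (hq : toL2 N s q =ᵐ[volume] v) : toL2 N s (p + q) =ᵐ[volume] fun x => u x + v x := by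
  have h : toL2 N s (p + q) = toL2 N s p + toL2 N s q := map_add _ _ _
  rw [h]
  exact (Lp.coeFn_add _ _).trans (hp.add hq)

theorem coeFn_toL2_smul {p : sobolev N s} {u : RN N → ℝ} (hp : toL2 N s p =ᵐ[volume] u) (k : ℝ) :
    toL2 N s (k • p) =ᵐ[volume] fun x => k * u x := by
  have h : toL2 N s (k • p) = k • toL2 N s p := map_smul _ _ _
  rw [h]
  exact (Lp.coeFn_smul _ _).trans (hp.mono fun x hx => by simp only [Pi.smul_apply, hx, smul_eq_mul])

theorem eq_zero_of_coeFn {p : sobolev N s} (h : toL2 N s p =ᵐ[volume] fun _ => 0) : p = 0 := by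
  refine toL2_injective ?_
  have h0 : toL2 N s (0 : sobolev N s) = 0 := map_zero _
  rw [h0]
  exact Lp.ext (h.trans (Lp.coeFn_zero _ _ _).symm)

theorem restr_eq_zero {Ω : Set (RN N)} {f : Lp ℝ 2 (volume : Measure (RN N))}
    (h : ∀ᵐ x ∂(volume.restrict Ω), f x = 0) : restr Ω f = 0 :=
  (Lp.eq_zero_iff_ae_eq_zero).2 ((restr_coeFn Ω f).trans h)

/-- The partial derivative with respect to time. -/
def timeD (g : RN N × ℝ → ℝ) (z : RN N × ℝ) : ℝ := fderiv ℝ g z (0, 1)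

/-- The curve in `W^{s,2}(ℝᴺ)` given by a function on space-time. -/
def lift (s : ℝ) (g : RN N × ℝ → ℝ) (t : ℝ) : sobolev N s := ofFun s fun x => g (x, t)

namespace IsTestFunction

variable {Ω : Set (RN N)} {T : ℝ} {g : RN N × ℝ → ℝ}

theorem timeD (hg : IsTestFunction Ω T g) : IsTestFunction Ω T (timeD g) := by
  have h1 : tsupport (MGT.timeD g) ⊆ tsupport g := by
    refine closure_minimal (fun z hz => ?_) (isClosed_tsupport g)
    refine tsupport_fderiv_subset ℝ (f := g) (subset_tsupport _ ?_)
    intro h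
    exact hz (by simp [MGT.timeD, h])
  refine ⟨?_, ?_, h1.trans hg.support⟩
  · exact (hg.smooth.fderiv_right (m := ∞) (by simp)).clm_apply contDiff_const
  · exact hg.compact.isCompact.of_isClosed_subset (isClosed_tsupport _) h1

theorem hasDerivAt (hg : IsTestFunction Ω T g) (x : RN N) (t : ℝ) :
    HasDerivAt (fun τ => g (x, τ)) (MGT.timeD g (x, t)) t := by
  have h1 := (hg.smooth.differentiable (by simp) (x, t)).hasFDerivAt
  exact h1.comp_hasDerivAt t ((hasDerivAt_const t x).prodMk (hasDerivAt_id t))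

theorem iterate_timeD (hg : IsTestFunction Ω T g) (m : ℕ) :
    IsTestFunction Ω T (MGT.timeD^[m] g) := by
  induction m with
  | zero => exact hg
  | succ m ih => rw [Function.iterate_succ_apply']; exact ih.timeD

theorem timeDeriv_eq (hg : IsTestFunction Ω T g) (m : ℕ) (x : RN N) (t : ℝ) :
    timeDeriv m g x t = (MGT.timeD^[m] g) (x, t) := by
  unfold timeDeriv
  induction m generalizing t with
  | zero => simp
  | succ m ih =>
    rw [iteratedDeriv_succ, Function.iterate_succ_apply', funext ih]
    exact ((hg.iterate_timeD m).hasDerivAt x t).deriv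

theorem exists_isLipschitzBump (hg : IsTestFunction Ω T g) :
    ∃ r M : ℝ, 0 ≤ M ∧ ∀ t, IsLipschitzBump r M fun x => g (x, t) := by
  obtain ⟨M1, hM1⟩ := hg.smooth.continuous.bounded_above_of_compact_support hg.compact
  obtain ⟨L, hL⟩ := ContDiff.lipschitzWith_of_hasCompactSupport hg.compact hg.smooth (by simp)
  obtain ⟨r, hr⟩ := hg.compact.isCompact.isBounded.exists_norm_le
  refine ⟨r, max M1 L, le_max_of_le_right L.coe_nonneg, fun t => ⟨?_, fun x => ?_, fun x y => ?_,
    fun x hx => ?_⟩⟩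
  · exact hg.smooth.continuous.comp (by fun_prop)
  · exact (hM1 (x, t)).trans (le_max_left _ _)
  · have h1 := hL.dist_le_mul (x, t) (y, t)
    rw [Real.dist_eq, Prod.dist_eq, dist_self, max_eq_left dist_nonneg, dist_eq_norm] at h1
    exact h1.trans (by gcongr; exact le_max_right _ _)
  · by_contra h
    have h1 := hr (x, t) (subset_tsupport _ h)
    have h2 : ‖x‖ ≤ ‖(x, t)‖ := le_max_left _ _
    linarith

theorem eq_zero_of_notMem (hg : IsTestFunction Ω T g) {x : RN N} {t : ℝ}
    (h : (x, t) ∉ Ωᶜ ×ˢ Ioo 0 T) : g (x, t) = 0 :=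
  image_eq_zero_of_notMem_tsupport fun h' => h (hg.support h')

theorem coeFn_lift (hg : IsTestFunction Ω T g) (hN : 1 ≤ N) (hs0 : 0 < s) (hs1 : s < 1) (t : ℝ) :
    toL2 N s (lift s g t) =ᵐ[volume] fun x => g (x, t) := by
  obtain ⟨r, M, hM, h⟩ := hg.exists_isLipschitzBump
  obtain ⟨C, hC, hCM⟩ := exists_norm_ofFun_le (s := s) hN hs0 hs1 r
  exact (hCM M _ (h t)).1

/-- Taylor's formula in time, applied to `g (x, ·)` for the bound and to `g (x, ·) - g (y, ·)` for
the Lipschitz constant. Both constants are of order `h²`. -/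
theorem isLipschitzBump_taylor {r M : ℝ} (hg : IsTestFunction Ω T g)
    (h0 : ∀ t, ∀ x, r < ‖x‖ → g (x, t) = 0) (h1 : ∀ t, ∀ x, r < ‖x‖ → MGT.timeD g (x, t) = 0)
    (h2 : ∀ t, IsLipschitzBump r M fun x => MGT.timeD (MGT.timeD g) (x, t)) (t h : ℝ) :
    IsLipschitzBump r (M * h ^ 2)
      fun x => g (x, t + h) - g (x, t) - h * MGT.timeD g (x, t) := by
  refine ⟨?_, fun x => ?_, fun x y => ?_, fun x hx => ?_⟩
  · have c1 := hg.smooth.continuous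
    have c2 := hg.timeD.smooth.continuous
    fun_prop
  · exact abs_taylor_le (k := fun τ => g (x, τ)) (hg.hasDerivAt x) (hg.timeD.hasDerivAt x)
      (fun τ => (h2 τ).bound x) t h
  · have := abs_taylor_le (k := fun τ => g (x, τ) - g (y, τ))
      (fun τ => (hg.hasDerivAt x τ).sub (hg.hasDerivAt y τ))
      (fun τ => (hg.timeD.hasDerivAt x τ).sub (hg.timeD.hasDerivAt y τ))
      (fun τ => (h2 τ).lipschitz x y) t h
    calc _ = _ := by congr 1; ring
      _ ≤ _ := this
      _ = _ := by ring
  · simp only [h0 _ x hx, h1 _ x hx]; ring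

/-- The Sobolev norm of a Lipschitz bump is linear in its constant, so the Taylor remainder has norm
`O(h²)`. -/
theorem hasDerivAt_lift (hg : IsTestFunction Ω T g) (hN : 1 ≤ N) (hs0 : 0 < s) (hs1 : s < 1)
    (t : ℝ) : HasDerivAt (lift s g) (lift s (MGT.timeD g) t) t := by
  obtain ⟨r0, M0, -, h0⟩ := hg.exists_isLipschitzBump
  obtain ⟨r1, M1, -, h1⟩ := hg.timeD.exists_isLipschitzBump
  obtain ⟨r2, M, hM, h2⟩ := hg.timeD.timeD.exists_isLipschitzBump
  set r := max r0 (max r1 r2)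
  have hr0 : r0 ≤ r := le_max_left _ _
  have hr1 : r1 ≤ r := (le_max_left _ _).trans (le_max_right _ _)
  have hr2 : r2 ≤ r := (le_max_right _ _).trans (le_max_right _ _)
  have H := exists_norm_ofFun_le (s := s) hN hs0 hs1 r
  obtain ⟨C, hC, hCM⟩ := H
  have hb : ∀ h, IsLipschitzBump r (M * h ^ 2)
      fun x => g (x, t + h) - g (x, t) - h * MGT.timeD g (x, t) :=
    isLipschitzBump_taylor hg (fun τ x hx => (h0 τ).support x (hr0.trans_lt hx))
      (fun τ x hx => (h1 τ).support x (hr1.trans_lt hx))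
      (fun τ => ⟨(h2 τ).continuous, (h2 τ).bound, (h2 τ).lipschitz,
        fun x hx => (h2 τ).support x (hr2.trans_lt hx)⟩) t
  have heq : ∀ h : ℝ, lift s g (t + h) - lift s g t - h • lift s (MGT.timeD g) t
      = ofFun s fun x => g (x, t + h) - g (x, t) - h * MGT.timeD g (x, t) := by
    intro h
    refine eq_ofFun (hb h).continuous.measurable ?_
    exact coeFn_toL2_sub (coeFn_toL2_sub (hg.coeFn_lift hN hs0 hs1 (t + h))
      (hg.coeFn_lift hN hs0 hs1 t)) (coeFn_toL2_smul (hg.timeD.coeFn_lift hN hs0 hs1 t) h)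
  rw [hasDerivAt_iff_isLittleO_nhds_zero]
  refine Asymptotics.IsBigO.trans_isLittleO (g := fun h : ℝ => h ^ 2) ?_ ?_
  · refine Asymptotics.IsBigO.of_bound (C * M) (Eventually.of_forall fun h => ?_)
    rw [heq, Real.norm_of_nonneg (sq_nonneg h), mul_assoc]
    exact (hCM _ _ (hb h)).2 (by positivity)
  · simpa using Asymptotics.isLittleO_pow_id (𝕜 := ℝ) one_lt_two

theorem deriv_lift (hg : IsTestFunction Ω T g) (hN : 1 ≤ N) (hs0 : 0 < s) (hs1 : s < 1) :
    deriv (lift s g) = lift s (MGT.timeD g) :=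
  funext fun t => (hg.hasDerivAt_lift hN hs0 hs1 t).deriv

theorem iteratedDeriv_lift (hg : IsTestFunction Ω T g) (hN : 1 ≤ N) (hs0 : 0 < s) (hs1 : s < 1)
    (m : ℕ) : iteratedDeriv m (lift s g) = lift s (MGT.timeD^[m] g) := by
  induction m with
  | zero => simp
  | succ m ih =>
    rw [iteratedDeriv_succ, ih, (hg.iterate_timeD m).deriv_lift hN hs0 hs1,
      Function.iterate_succ_apply']

theorem isForcing_lift (hg : IsTestFunction Ω T g) (hN : 1 ≤ N) (hs0 : 0 < s) (hs1 : s < 1) :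
    IsForcing (lift s g) := by
  refine ⟨contDiff_of_differentiable_iteratedDeriv fun m _ => ?_, fun t ht => ?_⟩
  · rw [hg.iteratedDeriv_lift hN hs0 hs1]
    exact fun t => ((hg.iterate_timeD m).hasDerivAt_lift hN hs0 hs1 t).differentiableAt
  · have h0 : ∀ x, g (x, t) = 0 := fun x =>
      hg.eq_zero_of_notMem fun h => (lt_of_lt_of_le h.2.1 ht).false
    have h1 := hg.coeFn_lift hN hs0 hs1 t
    exact eq_zero_of_coeFn (h1.mono fun x hx => Eq.trans hx (h0 x))

theorem restr_lift (hg : IsTestFunction Ω T g) (hN : 1 ≤ N) (hs0 : 0 < s) (hs1 : s < 1)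
    (hΩ : MeasurableSet Ω) (t : ℝ) : restr Ω (toL2 N s (lift s g t)) = 0 := by
  refine restr_eq_zero ?_
  have h1 := ae_restrict_of_ae (s := Ω) (hg.coeFn_lift hN hs0 hs1 t)
  filter_upwards [h1, ae_restrict_mem hΩ] with x hx hxΩ
  refine Eq.trans hx (hg.eq_zero_of_notMem fun h => h.1 hxΩ)

end IsTestFunction

end

end MGT

/-! ### Nonlocal integration by parts -/

namespace MGT

noncomputable section

variable {N : ℕ} {s : ℝ}

theorem diffQuot_mul_diffQuot (u v : RN N → ℝ) (x y : RN N) :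
    diffQuot s u (x, y) * diffQuot s v (x, y)
      = (u x - u y) * ((v x - v y) / ‖x - y‖ ^ ((N : ℝ) + 2 * s)) := by
  have h : ‖x - y‖ ^ ((N : ℝ) / 2 + s) * ‖x - y‖ ^ ((N : ℝ) / 2 + s)
      = ‖x - y‖ ^ ((N : ℝ) + 2 * s) := by
    rw [← sq, ← Real.rpow_natCast, ← Real.rpow_mul (norm_nonneg _)]
    congr 1
    push_cast
    ring
  simp only [diffQuot]
  rw [div_mul_div_comm, h, mul_div_assoc]

/-- On `Ω × Ω` the increments of `u` vanish, and on the product of the complements those of `v` do.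
The two mixed regions contribute equally by symmetry, hence the factor `2`. -/
theorem integral_diffQuot_mul {Ω : Set (RN N)} (hΩ : MeasurableSet Ω) {u v : RN N → ℝ}
    (hint : Integrable (fun z => diffQuot s u z * diffQuot s v z)
      (volume : Measure (RN N × RN N)))
    (hu : ∀ x ∈ Ω, u x = 0) (hv : ∀ᵐ x ∂(volume.restrict Ωᶜ), v x = 0) :
    ∫ z, diffQuot s u z * diffQuot s v z
      = 2 * ∫ x in Ωᶜ, u x * ∫ y in Ω, (v x - v y) / ‖x - y‖ ^ ((N : ℝ) + 2 * s) := by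
  set F : RN N × RN N → ℝ := fun z => diffQuot s u z * diffQuot s v z with hF
  have hsymm : ∀ z : RN N × RN N, F z.swap = F z := fun z => by
    have h1 : F z.swap = _ := diffQuot_mul_diffQuot u v z.2 z.1
    have h2 : F z = _ := diffQuot_mul_diffQuot u v z.1 z.2
    rw [h1, h2, norm_sub_rev]
    ring
  set A : Set (RN N × RN N) := Ωᶜ ×ˢ Ω with hA
  set A' : Set (RN N × RN N) := Ω ×ˢ Ωᶜ with hA'
  have hAm : MeasurableSet A := hΩ.compl.prod hΩ
  have hAm' : MeasurableSet A' := hΩ.prod hΩ.compl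
  have hv' : ∀ᵐ x : RN N, x ∉ Ω → v x = 0 := (ae_restrict_iff' hΩ.compl).1 hv
  have hv1 : ∀ᵐ z : RN N × RN N, z.1 ∉ Ω → v z.1 = 0 :=
    Measure.quasiMeasurePreserving_fst.ae hv'
  have hv2 : ∀ᵐ z : RN N × RN N, z.2 ∉ Ω → v z.2 = 0 :=
    Measure.quasiMeasurePreserving_snd.ae hv'
  have hsplit : F =ᵐ[volume] fun z => A.indicator F z + A'.indicator F z := by
    filter_upwards [hv1, hv2] with z h1 h2
    have hz : F z = _ := diffQuot_mul_diffQuot u v z.1 z.2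
    by_cases hx : z.1 ∈ Ω <;> by_cases hy : z.2 ∈ Ω
    · rw [indicator_of_notMem (fun h => h.1 hx), indicator_of_notMem (fun h => h.2 hy), hz,
        hu _ hx, hu _ hy]
      ring
    · rw [indicator_of_notMem (fun h => h.1 hx), indicator_of_mem (show z ∈ A' from ⟨hx, hy⟩), zero_add]
    · rw [indicator_of_mem (show z ∈ A from ⟨hx, hy⟩), indicator_of_notMem (fun h => hx h.1), add_zero]
    · rw [indicator_of_notMem (fun h => hy h.2), indicator_of_notMem (fun h => hx h.1), hz,
        h1 hx, h2 hy]
      ring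
  have hswap : ∫ z, A'.indicator F z = ∫ z, A.indicator F z := by
    have h1 := integral_prod_swap (μ := (volume : Measure (RN N))) (ν := (volume : Measure (RN N)))
      (A.indicator F)
    rw [← Measure.volume_eq_prod] at h1
    rw [← h1]
    refine integral_congr_ae (Eventually.of_forall fun z => ?_)
    have hiff : z ∈ A' ↔ z.swap ∈ A := and_comm
    change A'.indicator F z = A.indicator F z.swap
    by_cases hz : z ∈ A'
    · rw [indicator_of_mem hz, indicator_of_mem (hiff.1 hz), hsymm]
    · rw [indicator_of_notMem hz, indicator_of_notMem fun h => hz (hiff.2 h)]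
  have hA1 : ∫ z, A.indicator F z
      = ∫ x in Ωᶜ, u x * ∫ y in Ω, (v x - v y) / ‖x - y‖ ^ ((N : ℝ) + 2 * s) := by
    rw [integral_indicator hAm, hA, Measure.volume_eq_prod, setIntegral_prod _ (by
      rw [← Measure.volume_eq_prod]; exact hint.integrableOn)]
    refine integral_congr_ae (Eventually.of_forall fun x => ?_)
    simp only
    rw [← integral_const_mul]
    refine setIntegral_congr_fun hΩ fun y hy => ?_
    have hz : F (x, y) = _ := diffQuot_mul_diffQuot u v x y
    simp only [hz, hu y hy, sub_zero]
  rw [integral_congr_ae hsplit, integral_add (hint.indicator hAm) (hint.indicator hAm'), hswap, hA1]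
  ring

theorem mul_integral_eq_nonlocalNormal {Ω : Set (RN N)} (u v : RN N → ℝ) :
    fracConst N s / 2 * (2 * ∫ x in Ωᶜ, u x *
      ∫ y in Ω, (v x - v y) / ‖x - y‖ ^ ((N : ℝ) + 2 * s))
      = ∫ x in Ωᶜ, u x * nonlocalNormal s Ω v x := by
  rw [← mul_assoc, div_mul_cancel₀ _ two_ne_zero, ← integral_const_mul]
  refine integral_congr_ae (Eventually.of_forall fun x => ?_)
  simp only [nonlocalNormal]
  ring

theorem inner_gagliardo {p q : sobolev N s} {u v : RN N → ℝ} (hp : toL2 N s p =ᵐ[volume] u)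
    (hq : toL2 N s q =ᵐ[volume] v) :
    Integrable (fun z => diffQuot s u z * diffQuot s v z) (volume : Measure (RN N × RN N)) ∧
    inner ℝ (gagliardo N s p) (gagliardo N s q) = ∫ z, diffQuot s u z * diffQuot s v z := by
  have h1 := (coeFn_gagliardo p).trans (diffQuot_congr s hp)
  have h2 := (coeFn_gagliardo q).trans (diffQuot_congr s hq)
  have h3 : (fun z => inner ℝ (gagliardo N s p z) (gagliardo N s q z))
      =ᵐ[volume] fun z => diffQuot s u z * diffQuot s v z := by
    filter_upwards [h1, h2] with z a b
    simp only [a, b]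
    exact mul_comm _ _
  exact ⟨(L2.integrable_inner _ _).congr h3, (L2.inner_def _ _).trans (integral_congr_ae h3)⟩

/-- Nonlocal integration by parts. -/
theorem energy_eq_integral_nonlocalNormal {Ω : Set (RN N)} (hΩ : MeasurableSet Ω)
    {p : sobolev N s} {u : RN N → ℝ} (hp : toL2 N s p =ᵐ[volume] u) (hu : ∀ x ∈ Ω, u x = 0)
    (φ : sobolevZero s Ω) :
    energy p φ = ∫ x in Ωᶜ, u x * nonlocalNormal s Ω (toL2 N s φ) x := by
  have H := inner_gagliardo (q := (φ : sobolev N s)) hp EventuallyEq.rfl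
  have h1 := integral_diffQuot_mul hΩ H.1 hu (mem_sobolevZero_iff.1 φ.2)
  exact (congrArg (fun z => fracConst N s / 2 * z) (H.2.trans h1)).trans
    (mul_integral_eq_nonlocalNormal u _)

end

end MGT

/-! ### Density of test functions and coercivity of the energy -/

namespace MGT

noncomputable section

variable {N : ℕ} {s : ℝ} {Ω : Set (RN N)}

/-- The restriction to `Ω` of functions in `W^{s,2}(ℝᴺ)`. -/
def restrSobolev (N : ℕ) (s : ℝ) (Ω : Set (RN N)) :
    sobolev N s →L[ℝ] Lp ℝ 2 ((volume : Measure (RN N)).restrict Ω) :=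
  (restr Ω).comp (toL2 N s)

theorem isLipschitzBump_of_contDiff {φ : RN N → ℝ} (h1 : ContDiff ℝ ∞ φ) (h2 : HasCompactSupport φ) :
    ∃ r M, IsLipschitzBump r M φ := by
  obtain ⟨M1, hM1⟩ := h1.continuous.bounded_above_of_compact_support h2
  obtain ⟨L, hL⟩ := ContDiff.lipschitzWith_of_hasCompactSupport h2 h1 (by simp)
  obtain ⟨r, hr⟩ := h2.isCompact.isBounded.exists_norm_le
  refine ⟨r, max M1 L, h1.continuous, fun x => (hM1 x).trans (le_max_left _ _), fun x y => ?_,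
    fun x hx => ?_⟩
  · have h1 := hL.dist_le_mul x y
    rw [Real.dist_eq, dist_eq_norm] at h1
    exact h1.trans (by gcongr; exact le_max_right _ _)
  · by_contra h
    linarith [hr x (subset_tsupport _ h)]

theorem inner_restr_eq {f : Lp ℝ 2 ((volume : Measure (RN N)).restrict Ω)}
    {q : Lp ℝ 2 (volume : Measure (RN N))} {φ : RN N → ℝ} (hq : q =ᵐ[volume] φ) :
    inner ℝ f (restr Ω q) = ∫ x in Ω, φ x • f x := by
  rw [L2.inner_def]
  refine integral_congr_ae ?_
  filter_upwards [restr_coeFn Ω q, ae_restrict_of_ae hq] with x a b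
  rw [a, b]
  rfl

theorem ae_restrict_compl_of_ae_eq (hΩ : MeasurableSet Ω) {f u : RN N → ℝ} (h : f =ᵐ[volume] u)
    (hu : ∀ x ∉ Ω, u x = 0) : ∀ᵐ x ∂(volume.restrict Ωᶜ), f x = 0 := by
  filter_upwards [ae_restrict_of_ae h, ae_restrict_mem hΩ.compl] with x a b
  rw [a, hu x b]

/-- Smooth functions with compact support in `Ω` belong to `sobolevZero s Ω`, so the fundamental
lemma of the calculus of variations applies. -/
theorem eq_zero_of_toDual (hN : 1 ≤ N) (hs0 : 0 < s) (hs1 : s < 1) (hΩ : IsOpen Ω)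
    {f : Lp ℝ 2 ((volume : Measure (RN N)).restrict Ω)} (h : toDual s Ω f = 0) : f = 0 := by
  refine (Lp.eq_zero_iff_ae_eq_zero).2 ?_
  have hli : LocallyIntegrableOn f Ω (volume.restrict Ω) :=
    ((Lp.memLp f).locallyIntegrable (by norm_num)).locallyIntegrableOn _
  have key := hΩ.ae_eq_zero_of_integral_contDiff_smul_eq_zero hli fun φ h1 h2 h3 => by
    obtain ⟨r, M, hb⟩ := isLipschitzBump_of_contDiff h1 h2
    obtain ⟨C, hC⟩ := exists_sobolevSq_le_of_isLipschitzBump (s := s) hN hs0 hs1 r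
    have hne : sobolevSq s univ φ ≠ ⊤ :=
      ((hC M φ hb).trans_lt (ENNReal.mul_lt_top ENNReal.coe_lt_top ENNReal.ofReal_lt_top)).ne
    have hco := coeFn_ofFun hb.continuous.measurable hne
    have hmem : ofFun s φ ∈ sobolevZero s Ω := mem_sobolevZero_iff.2
      (ae_restrict_compl_of_ae_eq hΩ.measurableSet hco fun x hx =>
        image_eq_zero_of_notMem_tsupport fun h' => hx (h3 h'))
    have e := congrArg (fun D : DualSobolev s Ω => D ⟨ofFun s φ, hmem⟩) h
    exact (inner_restr_eq hco).symm.trans e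
  filter_upwards [key, ae_restrict_mem hΩ.measurableSet] with x a b using a b

theorem mul_div_one_add_mul_le {C k a d n : ℝ} (hC : 0 ≤ C) (hk : 0 < k) (h : k * a ≤ d)
    (hn : n = a + d) : C * (k / (1 + k)) * n ≤ C * d := by
  rw [mul_assoc]
  refine mul_le_mul_of_nonneg_left ?_ hC
  rw [div_mul_eq_mul_div, div_le_iff₀ (by linarith), hn]
  linarith

theorem exists_coercive (hN : 1 ≤ N) (hs0 : 0 < s) (hs1 : s < 1) (hΩ : IsOpen Ω)
    (hb : Bornology.IsBounded Ω) :
    ∃ δ : ℝ, 0 < δ ∧ ∀ p : sobolevZero s Ω,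
      δ * ‖p‖ ^ 2 ≤ fracConst N s / 2 * ‖gagliardo N s (p : sobolev N s)‖ ^ 2 := by
  have H := exists_poincare hN hs0 hΩ hb
  have hC := fracConst_pos N hs0 hs1
  exact H.elim fun k hk => ⟨fracConst N s / 2 * (k / (1 + k)),
    mul_pos (half_pos hC) (div_pos hk.1 (by linarith [hk.1])), fun p =>
    mul_div_one_add_mul_le (half_pos hC).le hk.1 (hk.2 p) (sobolev_norm_sq (p : sobolev N s))⟩

end

end MGT

/-! ### The abstract solution as a classical and as a weak solution -/

namespace MGT

noncomputable section

variable {N : ℕ} {s : ℝ} {Ω : Set (RN N)} {T α b c : ℝ} {g : RN N × ℝ → ℝ}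
  {S : (ℝ → sobolev N s) → ℝ → sobolev N s}

/-- `S` is a solution operator of the initial and exterior value problem. -/
abbrev IsMGTOperator (Ω : Set (RN N)) (α b c : ℝ)
    (S : (ℝ → sobolev N s) → ℝ → sobolev N s) : Prop :=
  IsInhomSolutionOperator (sobolevZero s Ω) (gagliardo N s) (restrSobolev N s Ω)
    (fracConst N s / 2) α b c S

theorem ae_eq_of_sub_mem {p q : sobolev N s} {u : RN N → ℝ} (h : p - q ∈ sobolevZero s Ω)
    (hq : toL2 N s q =ᵐ[volume] u) : ∀ᵐ x ∂(volume.restrict Ωᶜ), toL2 N s p x = u x := by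
  have h1 := mem_sobolevZero_iff.1 h
  have h2 := ae_restrict_of_ae (s := Ωᶜ)
    (coeFn_toL2_sub (p := p) (q := q) (u := toL2 N s p) EventuallyEq.rfl hq)
  filter_upwards [h1, h2] with x a b
  exact sub_eq_zero.1 (b.symm.trans a)

theorem isSmoothClassicalSolution (hN : 1 ≤ N) (hs0 : 0 < s) (hs1 : s < 1) (hb : 0 < b)
    (hT : 0 < T) (hS : IsMGTOperator Ω α b c S) (hg : IsTestFunction Ω T g) :
    IsSmoothClassicalSolution s Ω T α b c g (S (lift s g)) := by
  have hΓ : IsForcing (lift s g) := hg.isForcing_lift hN hs0 hs1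
  have hv := hS.isForcing hΓ
  refine ⟨hv.smooth.contDiffOn, fun t ht => ?_, fun k _ => ?_, fun t _ =>
    ae_eq_of_sub_mem (hS.exterior _ hΓ t) (hg.coeFn_lift hN hs0 hs1 t)⟩
  · exact hS.exists_classical_iteratedDerivWithin hΓ hb hT ht
  · have e := (hv.iteratedDerivWithin_eq hT k ⟨le_rfl, hT.le⟩).trans
      ((hv.iteratedDeriv k).zero 0 le_rfl)
    exact (congrArg (restrSobolev N s Ω) e).trans (map_zero (restrSobolev N s Ω))

theorem isWeakSolution (hN : 1 ≤ N) (hs0 : 0 < s) (hs1 : s < 1)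
    (hT : 0 < T) (hS : IsMGTOperator Ω α b c S) (hg : IsTestFunction Ω T g) :
    IsWeakSolution s Ω T α b c g (fun t => toL2 N s (S (lift s g) t)) := by
  have hΓ : IsForcing (lift s g) := hg.isForcing_lift hN hs0 hs1
  have hv := hS.isForcing hΓ
  have hc2 : ContDiff ℝ 2 fun τ => toDual s Ω (restr Ω (toL2 N s (S (lift s g) τ))) :=
    hS.contDiff_functionalOf hΓ 2
  have hc3 : ContDiff ℝ 3 fun τ => toDual s Ω (restr Ω (toL2 N s (S (lift s g) τ))) :=
    hS.contDiff_functionalOf hΓ 3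
  refine ⟨?_, hc2.contDiffOn, hc3.contDiffOn,
    ?_, fun k _ => hS.iteratedDerivWithin_functionalOf hΓ hT k, fun t _ =>
    ae_eq_of_sub_mem (hS.exterior _ hΓ t) (hg.coeFn_lift hN hs0 hs1 t)⟩
  · exact ((restrSobolev N s Ω).continuous.comp hv.smooth.continuous).continuousOn
  · refine Eventually.of_forall fun t => ⟨c ^ 2 • S (lift s g) t + b • S (deriv (lift s g)) t,
      hS.functionalOf_eq hΓ t, ?_, hS.variational hΓ t⟩
    have h2 := hS.exterior_combination hΓ (congrFun (hg.deriv_lift (s := s) hN hs0 hs1) t)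
    have h3 := ae_eq_of_sub_mem h2 (coeFn_toL2_add
      (coeFn_toL2_smul (hg.coeFn_lift hN hs0 hs1 t) (c ^ 2))
      (coeFn_toL2_smul (hg.timeD.coeFn_lift hN hs0 hs1 t) b))
    refine h3.mono fun x hx => Eq.trans hx ?_
    rw [hg.timeDeriv_eq]
    rfl

end

end MGT

/-! ### Concrete uniqueness, series representation and norm estimates -/

namespace MGT

noncomputable section

variable {N : ℕ} {s : ℝ} {Ω : Set (RN N)} {T α b c : ℝ} {g : RN N × ℝ → ℝ}
  {S : (ℝ → sobolev N s) → ℝ → sobolev N s}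

theorem sub_mem_sobolevZero {p q : sobolev N s}
    (h : ∀ᵐ x ∂(volume.restrict Ωᶜ), toL2 N s p x = toL2 N s q x) : p - q ∈ sobolevZero s Ω := by
  refine mem_sobolevZero_iff.2 ?_
  have h2 := ae_restrict_of_ae (s := Ωᶜ) (coeFn_toL2_sub (p := p) (q := q) (u := toL2 N s p)
    (v := toL2 N s q) EventuallyEq.rfl EventuallyEq.rfl)
  filter_upwards [h, h2] with x a b
  exact b.trans (sub_eq_zero.2 a)

theorem IsWeakSolution.restr_eq (hN : 1 ≤ N) (hs0 : 0 < s) (hs1 : s < 1) (hΩ : IsOpen Ω)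
    (hΩb : Bornology.IsBounded Ω) (hb : 0 < b) (hγ : 0 < α - c ^ 2 / b) (hT : 0 < T)
    {u v : ℝ → Lp ℝ 2 (volume : Measure (RN N))}
    (hu : IsWeakSolution s Ω T α b c g u) (hv : IsWeakSolution s Ω T α b c g v) :
    ∀ t ∈ Icc 0 T, restr Ω (u t) = restr Ω (v t) := by
  have H := exists_coercive hN hs0 hs1 hΩ hΩb
  refine H.elim fun δ hδ => ?_
  have key : ∀ t ∈ Icc 0 T, toDual s Ω (restr Ω (u t)) = toDual s Ω (restr Ω (v t)) := by
    refine weak_solution_unique (V := sobolevZero s Ω) (G := gagliardo N s)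
      (R := restrSobolev N s Ω) hδ.1 hδ.2 hb hγ hT hu.contDiff_two hu.contDiff_three hu.initial
      hv.contDiff_two hv.contDiff_three hv.initial ?_
    filter_upwards [hu.variational, hv.variational] with t hz hz'
    exact hz.elim fun z h => hz'.elim fun z' h' => ⟨z, z',
      sub_mem_sobolevZero (by filter_upwards [h.2.1, h'.2.1] with x a b using a.trans b.symm),
      h.1, h'.1, h.2.2, h'.2.2⟩
  intro t ht
  refine sub_eq_zero.1 (eq_zero_of_toDual (s := s) hN hs0 hs1 hΩ ?_)
  refine ContinuousLinearMap.ext fun w => ?_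
  have e := congrArg (fun D : DualSobolev s Ω => D w) (key t ht)
  have e1 : ∀ f h : Lp ℝ 2 ((volume : Measure (RN N)).restrict Ω),
      toDual s Ω (f - h) w = toDual s Ω f w - toDual s Ω h w := fun f h =>
    inner_sub_left (𝕜 := ℝ) f h _
  exact (e1 _ _).trans (sub_eq_zero.2 e)

theorem IsWeakSolution.eq (hN : 1 ≤ N) (hs0 : 0 < s) (hs1 : s < 1) (hΩ : IsOpen Ω)
    (hΩb : Bornology.IsBounded Ω) (hb : 0 < b) (hγ : 0 < α - c ^ 2 / b) (hT : 0 < T)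
    {u v : ℝ → Lp ℝ 2 (volume : Measure (RN N))}
    (hu : IsWeakSolution s Ω T α b c g u) (hv : IsWeakSolution s Ω T α b c g v) :
    ∀ t ∈ Ioo 0 T, u t = v t := by
  intro t ht
  refine Lp_ext_of_restr hΩ.measurableSet
    (hu.restr_eq hN hs0 hs1 hΩ hΩb hb hγ hT hv t (Ioo_subset_Icc_self ht)) ?_
  filter_upwards [hu.exterior t ht, hv.exterior t ht] with x a b using a.trans b.symm

/-- An eigenfunction with eigenvalue `0` would have zero energy and vanish by coercivity, against
orthonormality. -/
theorem IsEigenbasis.ne_zero (hN : 1 ≤ N) (hs0 : 0 < s) (hs1 : s < 1) (hΩ : IsOpen Ω)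
    (hΩb : Bornology.IsBounded Ω) {φ : ℕ → sobolevZero s Ω} {lam : ℕ → ℝ}
    (h : IsEigenbasis s Ω φ lam) (n : ℕ) : lam n ≠ 0 := by
  have H := exists_coercive hN hs0 hs1 hΩ hΩb
  refine H.elim fun δ hδ hlam => ?_
  have h1 : energy (φ n : sobolev N s) (φ n) = 0 := by
    refine (h.eigen n (φ n)).trans ?_
    have e : ∀ f : Lp ℝ 2 ((volume : Measure (RN N)).restrict Ω),
        toDual s Ω (lam n • f) (φ n) = lam n * toDual s Ω f (φ n) := fun f =>
      real_inner_smul_left f _ _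
    rw [e, hlam, zero_mul]
  have h2 : fracConst N s / 2 * ‖gagliardo N s (φ n : sobolev N s)‖ ^ 2 = 0 := by
    refine Eq.trans ?_ h1
    exact congrArg (fun z => fracConst N s / 2 * z) (real_inner_self_eq_norm_sq _).symm
  have h3 : ‖φ n‖ ^ 2 ≤ 0 := by
    have h4 := (hδ.2 (φ n)).trans_eq h2
    exact nonpos_of_mul_nonpos_right h4 hδ.1
  have h5 : φ n = 0 := norm_eq_zero.1
    ((pow_eq_zero_iff two_ne_zero).1 (le_antisymm h3 (sq_nonneg _)))
  have h6 := h.orthonormal.ne_zero n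
  refine h6 ?_
  have h7 : restrSobolev N s Ω (φ n : sobolev N s) = 0 := by
    rw [h5]
    exact map_zero (restrSobolev N s Ω)
  exact h7

theorem hasSum_inner_smul {H ι : Type*} [NormedAddCommGroup H] [InnerProductSpace ℝ H]
    [CompleteSpace H] {v : ι → H} (hv : Orthonormal ℝ v)
    (h : (Submodule.span ℝ (range v)).topologicalClosure = ⊤) (x : H) :
    HasSum (fun i => (inner ℝ (v i) x : ℝ) • v i) x := by
  have hB := (HilbertBasis.mk hv h.ge).hasSum_repr x
  simpa only [HilbertBasis.repr_apply_apply, HilbertBasis.coe_mk] using hB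

theorem hasSum_coeff (hN : 1 ≤ N) (hs0 : 0 < s) (hs1 : s < 1) (hΩ : IsOpen Ω)
    (hΩb : Bornology.IsBounded Ω) (hS : IsMGTOperator Ω α b c S) (hg : IsTestFunction Ω T g)
    {φ : ℕ → sobolevZero s Ω} {lam : ℕ → ℝ} {μ : ℕ → Fin 3 → ℂ} (hφ : IsEigenbasis s Ω φ lam)
    (hμ : ∀ n, AreRoots α b c (lam n) (μ n)) (t : ℝ) :
    HasSum (fun n => coeff s Ω α g (toL2 N s (φ n)) (lam n) (μ n) t •
      restr Ω (toL2 N s (φ n))) (restr Ω (toL2 N s (S (lift s g) t))) := by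
  have hΓ : IsForcing (lift s g) := hg.isForcing_lift hN hs0 hs1
  have hc : ∀ n, coeff s Ω α g (toL2 N s (φ n)) (lam n) (μ n) t
      = inner ℝ (restr Ω (toL2 N s (φ n))) (restr Ω (toL2 N s (S (lift s g) t))) := by
    intro n
    have h1 := hS.coeff_eq hΓ (hg.restr_lift hN hs0 hs1 hΩ.measurableSet)
      (hφ.ne_zero hN hs0 hs1 hΩ hΩb n) (hφ.eigen n) (hμ n) t
    refine Eq.trans ?_ h1
    unfold coeff
    refine intervalIntegral.integral_congr fun τ _ => ?_
    have h2 := energy_eq_integral_nonlocalNormal hΩ.measurableSet (hg.coeFn_lift hN hs0 hs1 τ)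
      (fun x hx => hg.eq_zero_of_notMem fun h => h.1 hx) (φ n)
    exact congrArg (fun z => z * (1 / lam n) * kernel α (μ n) (t - τ)) h2.symm
  have hB := hasSum_inner_smul hφ.orthonormal hφ.total (restr Ω (toL2 N s (S (lift s g) t)))
  have e : (fun n => coeff s Ω α g (toL2 N s (φ n)) (lam n) (μ n) t • restr Ω (toL2 N s (φ n)))
      = fun n => inner ℝ (restr Ω (toL2 N s (φ n))) (restr Ω (toL2 N s (S (lift s g) t))) •
        restr Ω (toL2 N s (φ n)) :=
    funext fun n => congrArg (fun z : ℝ => z • restr Ω (toL2 N s (φ n))) (hc n)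
  rw [e]
  exact hB

/-- Elements of `W^{s,2}(ℝᴺ)` are controlled modulo `W₀^{s,2}(Ω̄)` by their norm outside `Ω`. -/
theorem exists_norm_sub_le (hN : 1 ≤ N) (hs0 : 0 < s) (hs1 : s < 1) (hΩ : IsOpen Ω)
    (hΩb : Bornology.IsBounded Ω) (hΩL : HasLipschitzBoundary Ω) :
    ∃ C : ℝ, 0 ≤ C ∧ ∀ (p : sobolev N s) (u : RN N → ℝ), Measurable u →
      toL2 N s p =ᵐ[volume] u → ∀ M : ℝ≥0∞, M ≠ ⊤ → sobolevENorm s Ωᶜ u ≤ M →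
      ∃ w : sobolevZero s Ω, ‖p - w‖ ≤ C * M.toReal := by
  have H := exists_sobolev_extension hN hs0 hs1 hΩ hΩb hΩL
  refine H.elim fun C hC => ⟨Real.sqrt C, Real.sqrt_nonneg _, fun p u hu hp M hM huM => ?_⟩
  refine (hC u hu).elim fun G hG => ?_
  have h1 : sobolevSq s univ G ≤ ENNReal.ofReal (C * M.toReal ^ 2) := by
    rw [ENNReal.ofReal_mul C.coe_nonneg, ENNReal.ofReal_coe_nnreal,
      ENNReal.ofReal_pow ENNReal.toReal_nonneg, ENNReal.ofReal_toReal hM]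
    refine hG.2.2.trans (mul_le_mul_right ?_ _)
    rw [← sobolevENorm_sq]
    exact pow_le_pow_left' huM 2
  have hne : sobolevSq s univ G ≠ ⊤ := (h1.trans_lt ENNReal.ofReal_lt_top).ne
  -- The extension `G` of the exterior values differs from `p` by an element of `V`; this difference
  -- is the witness `w`.
  have hmem : p - ofFun s G ∈ sobolevZero s Ω := by
    refine sub_mem_sobolevZero ?_
    filter_upwards [ae_restrict_of_ae hp, ae_restrict_of_ae (coeFn_ofFun hG.1 hne),
      ae_restrict_mem hΩ.measurableSet.compl] with x a b hx
    exact a.trans ((hG.2.1 x hx).symm.trans b.symm)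
  refine ⟨⟨p - ofFun s G, hmem⟩, ?_⟩
  have h2 : ENNReal.ofReal (‖ofFun s G‖ ^ 2) ≤ ENNReal.ofReal (C * M.toReal ^ 2) :=
    ((enorm_sq_eq_ofReal_norm _).symm.trans (ofFun_enorm_sq hG.1 hne)).trans_le h1
  have h3 := (ENNReal.ofReal_le_ofReal_iff (mul_nonneg C.coe_nonneg (sq_nonneg _))).1 h2
  have h4 : ‖ofFun s G‖ ≤ Real.sqrt C * M.toReal := by
    refine le_of_sq_le_sq ?_ (mul_nonneg (Real.sqrt_nonneg _) ENNReal.toReal_nonneg)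
    rw [mul_pow, Real.sq_sqrt C.coe_nonneg]
    exact h3
  have h5 : p - (p - ofFun s G) = ofFun s G := sub_sub_cancel _ _
  exact (congrArg norm h5).trans_le h4

/-- Infinite norms on the right make the bound trivial only if the constant is positive, which
explains the summand `1`. -/
theorem enorm_le_of_norm_le {X : Type*} [NormedAddCommGroup X] {x : X} {C C' : ℝ} {e e' : ℝ≥0∞}
    (hC : 0 ≤ C) (hC' : 0 ≤ C')
    (h : e ≠ ⊤ → e' ≠ ⊤ → ‖x‖ ≤ C * (C' * e.toReal + C' * e'.toReal)) :
    ‖x‖ₑ ≤ ENNReal.ofReal (C * C' + 1) * (e + e') := by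
  have hpos : 0 < C * C' + 1 := by positivity
  by_cases he : e = ⊤
  · rw [he, top_add, ENNReal.mul_top (ENNReal.ofReal_pos.2 hpos).ne']
    exact le_top
  by_cases he' : e' = ⊤
  · rw [he', add_top, ENNReal.mul_top (ENNReal.ofReal_pos.2 hpos).ne']
    exact le_top
  rw [← ofReal_norm, ← ENNReal.ofReal_toReal (ENNReal.add_ne_top.2 ⟨he, he'⟩),
    ← ENNReal.ofReal_mul hpos.le, ENNReal.toReal_add he he']
  refine ENNReal.ofReal_le_ofReal ((h he he').trans ?_)
  have h1 : 0 ≤ e.toReal := ENNReal.toReal_nonneg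
  have h2 : 0 ≤ e'.toReal := ENNReal.toReal_nonneg
  nlinarith

theorem exists_norm_sub_le_congr {X : Type*} [NormedAddCommGroup X] [NormedSpace ℝ X]
    {V : Submodule ℝ X} {Γ p q : ℝ → X} {M τ : ℝ} (hq : deriv (deriv Γ) = q)
    (hp : deriv (deriv (deriv Γ)) = p) (h : ∃ w : V, ‖p τ + α • q τ - w‖ ≤ M) :
    ∃ w : V, ‖deriv (deriv (deriv Γ)) τ + α • deriv (deriv Γ) τ - w‖ ≤ M := by
  rwa [hp, hq]

theorem exists_norm_sub_le_congr' {X : Type*} [NormedAddCommGroup X] [NormedSpace ℝ X]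
    {V : Submodule ℝ X} {x y : X} {M : ℝ} (hxy : x = y) (h : ∃ w : V, ‖y - w‖ ≤ M) :
    ∃ w : V, ‖x - w‖ ≤ M := by
  rwa [hxy]

/-- The `m`-th time derivative of the solution is the solution for the `m`-th derivative of the
datum, so the abstract bound applies to it with both data terms measured modulo `V`. -/
theorem enorm_iteratedDerivWithin_le (hN : 1 ≤ N) (hs0 : 0 < s) (hs1 : s < 1) (hT : 0 < T)
    {C C' : ℝ} (hC : 0 ≤ C) (hC' : 0 ≤ C')
    (hE : ∀ (p : sobolev N s) (u : RN N → ℝ), Measurable u →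
      toL2 N s p =ᵐ[volume] u → ∀ M : ℝ≥0∞, M ≠ ⊤ → sobolevENorm s Ωᶜ u ≤ M →
      ∃ w : sobolevZero s Ω, ‖p - w‖ ≤ C' * M.toReal)
    (hS : IsMGTOperator Ω α b c S)
    (hSC : ∀ Γ : ℝ → sobolev N s, IsForcing Γ → ∀ M M' : ℝ,
        (∀ᵐ τ ∂(volume.restrict (Ioo 0 T)), ∃ w : sobolevZero s Ω,
          ‖deriv (deriv (deriv Γ)) τ + α • deriv (deriv Γ) τ - w‖ ≤ M) →
        ∀ t ∈ Icc 0 T, (∃ w : sobolevZero s Ω, ‖Γ t - w‖ ≤ M') → ‖S Γ t‖ ≤ C * (M + M'))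
    (hg : IsTestFunction Ω T g) (m : ℕ) {t : ℝ} (ht : t ∈ Icc 0 T) :
    ‖iteratedDerivWithin m (S (lift s g)) (Icc 0 T) t‖ₑ ≤ ENNReal.ofReal (C * C' + 1) *
      (essSup (fun τ => sobolevENorm s Ωᶜ
          (fun x => timeDeriv (m + 3) g x τ + α * timeDeriv (m + 2) g x τ))
        (volume.restrict (Ioo 0 T))
      + sobolevENorm s Ωᶜ (fun x => timeDeriv m g x t)) := by
  have hΓ : IsForcing (lift s g) := hg.isForcing_lift hN hs0 hs1
  refine enorm_le_of_norm_le hC hC' fun he he' => ?_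
  have h1 := hS.iteratedDerivWithin_eq hΓ hT m ht
  have hm := hg.iteratedDeriv_lift (s := s) hN hs0 hs1 m
  refine (congrArg norm h1).trans_le (hSC _ (hΓ.iteratedDeriv m) _ _ ?_ t ht ?_)
  · filter_upwards [ENNReal.ae_le_essSup (μ := volume.restrict (Ioo 0 T))
      fun τ => sobolevENorm s Ωᶜ
        (fun x => timeDeriv (m + 3) g x τ + α * timeDeriv (m + 2) g x τ)] with τ hτ
    have d1 : deriv (deriv (iteratedDeriv m (lift s g))) = lift s (timeD^[m + 2] g) := by
      rw [← iteratedDeriv_succ, ← iteratedDeriv_succ, hg.iteratedDeriv_lift hN hs0 hs1]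
    have d2 : deriv (deriv (deriv (iteratedDeriv m (lift s g)))) = lift s (timeD^[m + 3] g) := by
      rw [← iteratedDeriv_succ, ← iteratedDeriv_succ, ← iteratedDeriv_succ,
        hg.iteratedDeriv_lift hN hs0 hs1]
    refine exists_norm_sub_le_congr d1 d2 ?_
    have g3 := hg.iterate_timeD (m + 3)
    have g2 := hg.iterate_timeD (m + 2)
    have hco := coeFn_toL2_add (g3.coeFn_lift (s := s) hN hs0 hs1 τ)
      (coeFn_toL2_smul (g2.coeFn_lift (s := s) hN hs0 hs1 τ) α)
    have hmeas : Measurable fun x => (timeD^[m + 3] g) (x, τ) + α * (timeD^[m + 2] g) (x, τ) := by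
      have c3 := g3.smooth.continuous
      have c2 := g2.smooth.continuous
      exact Continuous.measurable (by fun_prop)
    refine hE _ _ hmeas hco _ he ?_
    simpa only [hg.timeDeriv_eq] using hτ
  · have gm := hg.iterate_timeD m
    have hmeas : Measurable fun x => (timeD^[m] g) (x, t) :=
      Continuous.measurable (by have := gm.smooth.continuous; fun_prop)
    have hw := hE _ _ hmeas (gm.coeFn_lift hN hs0 hs1 t) _ he'
    refine exists_norm_sub_le_congr' (congrFun hm t) (hw ?_)
    simp only [hg.timeDeriv_eq, le_refl]

end

end MGT

theorem mainTheorem6 (N : ℕ) (hN : 1 ≤ N) (s : ℝ) (hs0 : 0 < s) (hs1 : s < 1)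
    (Ω : Set (RN N)) (hΩo : IsOpen Ω) (hΩb : Bornology.IsBounded Ω)
    (hΩL : HasLipschitzBoundary Ω)
    (α b c : ℝ) (hb : 0 < b) (hγ : 0 < α - c ^ 2 / b) (T : ℝ) (hT : 0 < T) :
    ∃ C : ℝ, 0 < C ∧ ∀ g : RN N × ℝ → ℝ, IsTestFunction Ω T g →
      ∃ v : ℝ → sobolev N s,
        -- existence
        IsSmoothClassicalSolution s Ω T α b c g v ∧
        IsWeakSolution s Ω T α b c g (fun t => toL2 N s (v t)) ∧
        -- uniqueness
        (∀ u : ℝ → Lp ℝ 2 (volume : Measure (RN N)), IsWeakSolution s Ω T α b c g u →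
          (∀ t ∈ Icc 0 T, restr Ω (u t) = restr Ω (toL2 N s (v t))) ∧
          ∀ t ∈ Ioo 0 T, u t = toL2 N s (v t)) ∧
        -- series representation, with convergence in `L²(Ω)`
        (∀ (φ : ℕ → sobolevZero s Ω) (lam : ℕ → ℝ) (μ : ℕ → Fin 3 → ℂ),
          IsEigenbasis s Ω φ lam → (∀ n, AreRoots α b c (lam n) (μ n)) →
          ∀ t ∈ Icc 0 T,
            HasSum (fun n => coeff s Ω α g (toL2 N s (φ n)) (lam n) (μ n) t •
              restr Ω (toL2 N s (φ n))) (restr Ω (toL2 N s (v t)))) ∧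
        -- estimates
        ∀ m : ℕ, ∀ t ∈ Icc 0 T,
          ‖iteratedDerivWithin m v (Icc 0 T) t‖ₑ ≤ ENNReal.ofReal C *
            (essSup (fun τ => sobolevENorm s Ωᶜ
                (fun x => timeDeriv (m + 3) g x τ + α * timeDeriv (m + 2) g x τ))
              (volume.restrict (Ioo 0 T))
            + sobolevENorm s Ωᶜ (fun x => timeDeriv m g x t)) := by
  have hco := exists_coercive hN hs0 hs1 hΩo hΩb
  refine hco.elim fun δ hδ => ?_
  have hop := exists_isInhomSolutionOperator (V := sobolevZero s Ω) (G := gagliardo N s)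
    (R := restrSobolev N s Ω) hδ.1 hδ.2 hb hγ hT
  refine hop.elim fun S hS => hS.2.elim fun C hC => ?_
  have hE := exists_norm_sub_le hN hs0 hs1 hΩo hΩb hΩL
  refine hE.elim fun C' hC' => ⟨C * C' + 1, add_pos_of_nonneg_of_pos (mul_nonneg hC.1 hC'.1) one_pos,
    fun g hg => ⟨S (lift s g), isSmoothClassicalSolution hN hs0 hs1 hb hT hS.1 hg,
      isWeakSolution hN hs0 hs1 hT hS.1 hg, fun u hu => ?_, fun φ lam μ hφ hμ t _ =>
      hasSum_coeff hN hs0 hs1 hΩo hΩb hS.1 hg hφ hμ t, fun m t ht =>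
      enorm_iteratedDerivWithin_le hN hs0 hs1 hT hC.1 hC'.1 hC'.2 hS.1 hC.2 hg m ht⟩⟩
  have hv := isWeakSolution hN hs0 hs1 hT hS.1 hg
  exact ⟨hu.restr_eq hN hs0 hs1 hΩo hΩb hb hγ hT hv, hu.eq hN hs0 hs1 hΩo hΩb hb hγ hT hv⟩
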